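/- \textbf{Model.} Let $\mathcal S,\mathcal X$ be finite sets of states and of private signals, and let $G=(V,E)$ be a (finite or infinite) tree with finite degrees; $\partial i$ is the set of neighbours of $i\in V$. The state of the world $s\in\mathcal S$ is drawn from a prior $\mathbb P[s]$; given $s$, the agents $i\in V$ receive independent private signals $x_i\in\mathcal X$ with laws $\mathbb P[x_i\mid s]$. At each time $t=0,1,2,\dots$ agent $i$ casts the vote $$\sigma_i(t)\in\arg\max_{s\in\mathcal S}\ \mathbb P\big[s \,\big|\, x_i,\ (\sigma_j(r))_{j\in\partial i,\,r<t}\big],$$ where ties are broken by a deterministic rule that may depend on the agent, on her private signal and on the votes of her neighbours before time $t$. The tree, the prior, the signal laws and the tie-breaking rule are common knowledge. \textbf{Computation.} Computational effort is the number of steps of a random access machine over the reals: the operations $+$, truncated $-$ and $<$ on natural numbers, the operations $+,-,\times,/$ and $<$ on reals, accesses to memory, the reading of a value of the prior or of a signal law, the query for the degree or for the $k$-th neighbour of an agent, and the comparison of two agents cost one step each; a query to the tie-breaking rule costs its length. To compute $\sigma_i(t)$, agent $i$ gives the machine $|\mathcal S|$, $|\mathcal X|$, $t$, $x_i$, the votes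 $\sigma_j(r)$ for $j\in\partial i$ and $r<t$, and a reference to herself. \textbf{Statement.} There is a single program, the same for all such models, with the following property. For all $|\mathcal S|$, $|\mathcal X|$, $d$, $t_0\in\mathbb N$, $b>1$ and $c>0$ there are $C\in\mathbb R$ and $k\in\mathbb N$ such that for every $\varepsilon\in(0,1)$ there is a time $t$ for which the following holds. Let $G$ have maximum degree at most $d$, and let $i$ be an agent for whom learning is doubly exponentially fast, in the sense that $$-\log \mathbb P[\sigma_i(r)\ne s]\ \ge\ c\,b^{r}\qquad\text{for all } r\ge t_0\qquad(\text{where } -\log 0=\infty).$$ Then $\mathbb P[\sigma_i(t)\ne s]\le\varepsilon$; and, for every outcome of the state and of the signals, the program, run by agent $i$ at each of the times $r=0,1,\dots,t$, halts each time with her vote $\sigma_i(r)$, and the total number of steps of these runs is at most $$C\,\big(1+\log(1/\varepsilon)\big)^{k}.$$ -/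

import Mathlib

open MeasureTheory ProbabilityTheory

universe u

noncomputable section

/-! ## The social learning model -/

/-- Everything that is common knowledge among the agents: a tree `G` with finite degrees, together
with an enumeration of the neighbours of each agent; the prior on the state of the world (one of
`q` states); the law of each agent's private signal (one of `m` signals) given the state; and a
deterministic tie-breaking rule.  `tie v x t h M` is the action which agent `v`, having the private
signal `x` and having seen the `k`-th neighbour vote `h k r` at time `r < t`, chooses at time `t`
when `M` is the set of the states which are maximal a posteriori. -/
structure Network (q m : ℕ) (V : Type u) where
  G : SimpleGraph V
  isTree : G.IsTree
  deg : V → ℕ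
  nbr : ∀ v : V, Fin (deg v) ≃ G.neighborSet v
  prior : PMF (Fin q)
  lik : V → Fin q → PMF (Fin m)
  tie : ∀ (v : V), Fin m → ∀ t : ℕ, (Fin (deg v) → Fin t → Fin q) → Finset (Fin q) → Fin q
  tie_mem : ∀ v x t h M, M.Nonempty → tie v x t h M ∈ M

/-- An outcome: the state of the world and the private signals of all agents. -/
abbrev Outcome (q m : ℕ) (V : Type u) : Type u := Fin q × (V → Fin m)

namespace Network

variable {q m : ℕ} {V : Type u} (A : Network q m V)

/-- The joint law: the state has law `prior`, and given the state `s` the private signals are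
independent, that of agent `v` having law `lik v s`. -/
def law : Measure (Outcome q m V) :=
  ∑ s : Fin q, A.prior s •
    (Measure.infinitePi fun v => (A.lik v s).toMeasure).map (Prod.mk s)

/-- The event that agent `v` has private signal `x` and that the votes of the `k`-th neighbour
before time `t` are `h k`, where `traj w ω` lists the votes of `w` before time `t`. -/
def infoEvent {t : ℕ} (traj : V → Outcome q m V → Fin t → Fin q) (v : V) (x : Fin m)
    (h : Fin (A.deg v) → Fin t → Fin q) : Set (Outcome q m V) :=
  {ω | ω.2 v = x ∧ ∀ k, traj (A.nbr v k) ω = h k}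

open Classical in
/-- The states of maximal posterior probability given an event `F`. -/
def mapStates (F : Set (Outcome q m V)) : Finset (Fin q) :=
  Finset.univ.filter fun s => ∀ s', A.law[{ω | ω.1 = s'} | F] ≤ A.law[{ω | ω.1 = s} | F]

/-- The Bayesian decision of agent `v` at time `t` as a function of her information. -/
def decision {t : ℕ} (traj : V → Outcome q m V → Fin t → Fin q) (v : V) (x : Fin m)
    (h : Fin (A.deg v) → Fin t → Fin q) : Fin q :=
  A.tie v x t h (A.mapStates (A.infoEvent traj v x h))

/-- `traj t v ω` lists the votes of agent `v` at the times `0, …, t - 1`. -/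
def traj : (t : ℕ) → V → Outcome q m V → Fin t → Fin q
  | 0, _, _ => Fin.elim0
  | t + 1, v, ω =>
      Fin.snoc (α := fun _ => Fin q) (traj t v ω)
        (A.decision (traj t) v (ω.2 v) fun k => traj t (A.nbr v k) ω)

/-- The vote of agent `v` at time `t`. -/
def vote (t : ℕ) (v : V) (ω : Outcome q m V) : Fin q :=
  A.traj (t + 1) v ω (Fin.last t)

/-- The event that the vote of agent `v` at time `t` is wrong. -/
def errorEvent (t : ℕ) (v : V) : Set (Outcome q m V) := {ω | A.vote t v ω ≠ ω.1}

/-- `- log P(error of v at time t) ≥ c * b ^ t` for all `t ≥ t₀`, where `- log 0 = ∞`. -/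
def DoublyExponential (v : V) (b c : ℝ) (t₀ : ℕ) : Prop :=
  ∀ t ≥ t₀, ((c * b ^ t : ℝ) : EReal) ≤ -ENNReal.log (A.law (A.errorEvent t v))

end Network

/-! ## The machine model

A program of a random access machine over the reals.  Its memory consists of finitely many
(those which occur in the program) two-dimensional arrays of natural numbers, of real numbers and
of references to agents.  Elementary operations, each at unit cost, are: addition, truncated
subtraction and comparison of natural numbers; the field operations and comparison of reals;
looking up a cell of an array; looking up an entry of the prior or of a signal law; following an
edge of the tree; asking for the degree of an agent; comparing two references.  -/

namespace Machine

/-- Expressions for natural numbers; `get a i j` is the cell `(i, j)` of the array named `a`. -/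
inductive NExpr : Type
  | lit (n : ℕ)
  | get (a : ℕ) (i j : NExpr)
  | add (e f : NExpr)
  | sub (e f : NExpr)

/-- Expressions for agents; `nbr v k` is the `k`-th neighbour of `v`. -/
inductive VExpr : Type
  | get (a : ℕ) (i j : NExpr)
  | nbr (v : VExpr) (k : NExpr)

/-- Expressions for real numbers; `prior s` is the prior probability of the state `s`, and
`lik v s x` is the probability that agent `v` has private signal `x` if the state is `s`. -/
inductive RExpr : Type
  | zero
  | one
  | get (a : ℕ) (i j : NExpr)
  | add (e f : RExpr)
  | sub (e f : RExpr)
  | mul (e f : RExpr)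
  | div (e f : RExpr)
  | prior (s : NExpr)
  | lik (v : VExpr) (s x : NExpr)

/-- Tests: `<` for natural numbers, `<` for reals, equality of agents. -/
inductive Test : Type
  | nlt (e f : NExpr)
  | rlt (e f : RExpr)
  | veq (v w : VExpr)

/-- Programs.  The first three arguments `a i j` of an assignment give the target cell.
`askDeg` stores the degree of an agent.  `askTie` stores the answer of the tie-breaking rule for
the agent `v`, signal `x`, time `t`, the observed votes in the array `H` (cell `(k, r)` holds the
vote of the `k`-th neighbour at time `r`), and the set of those states `s` for which the
cell `(s, 0)` of the array `M` is nonzero. -/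
inductive Prog : Type
  | skip
  | setN (a : ℕ) (i j e : NExpr)
  | setR (a : ℕ) (i j : NExpr) (e : RExpr)
  | setV (a : ℕ) (i j : NExpr) (v : VExpr)
  | askDeg (a : ℕ) (i j : NExpr) (v : VExpr)
  | askTie (a : ℕ) (i j : NExpr) (v : VExpr) (x t : NExpr) (H M : ℕ)
  | seq (p r : Prog)
  | ite (b : Test) (p r : Prog)
  | while (b : Test) (p : Prog)

/-- The memory: array name, row, column. -/
structure Mem (V : Type u) where
  nat : ℕ → ℕ → ℕ → ℕ
  real : ℕ → ℕ → ℕ → ℝ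
  node : ℕ → ℕ → ℕ → V

/-- Overwrite one cell. -/
def upd {α : Type u} (f : ℕ → ℕ → ℕ → α) (a i j : ℕ) (y : α) : ℕ → ℕ → ℕ → α :=
  fun a' i' j' => if a' = a ∧ i' = i ∧ j' = j then y else f a' i' j'

/-! The cost of an expression or a test is the number of elementary operations in it. -/

def NExpr.cost : NExpr → ℕ
  | .lit _ => 1
  | .get _ i j => i.cost + j.cost + 1
  | .add e f => e.cost + f.cost + 1
  | .sub e f => e.cost + f.cost + 1

def VExpr.cost : VExpr → ℕ
  | .get _ i j => i.cost + j.cost + 1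
  | .nbr v k => v.cost + k.cost + 1

def RExpr.cost : RExpr → ℕ
  | .zero => 1
  | .one => 1
  | .get _ i j => i.cost + j.cost + 1
  | .add e f => e.cost + f.cost + 1
  | .sub e f => e.cost + f.cost + 1
  | .mul e f => e.cost + f.cost + 1
  | .div e f => e.cost + f.cost + 1
  | .prior s => s.cost + 1
  | .lik v s x => v.cost + s.cost + x.cost + 1

def Test.cost : Test → ℕ
  | .nlt e f => e.cost + f.cost + 1
  | .rlt e f => e.cost + f.cost + 1
  | .veq v w => v.cost + w.cost + 1

section Semantics

variable {q m : ℕ} {V : Type u} (A : Network q m V)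

def NExpr.eval (μ : Mem V) : NExpr → ℕ
  | .lit n => n
  | .get a i j => μ.nat a (i.eval μ) (j.eval μ)
  | .add e f => e.eval μ + f.eval μ
  | .sub e f => e.eval μ - f.eval μ

/-- An index that is out of range leads back to the agent herself. -/
def VExpr.eval (μ : Mem V) : VExpr → V
  | .get a i j => μ.node a (i.eval μ) (j.eval μ)
  | .nbr v k =>
      if h : k.eval μ < A.deg (v.eval μ) then A.nbr (v.eval μ) ⟨k.eval μ, h⟩ else v.eval μ

/-- Probabilities of states and signals that are out of range are `0`. -/
def RExpr.eval (μ : Mem V) : RExpr → ℝ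
  | .zero => 0
  | .one => 1
  | .get a i j => μ.real a (i.eval μ) (j.eval μ)
  | .add e f => e.eval μ + f.eval μ
  | .sub e f => e.eval μ - f.eval μ
  | .mul e f => e.eval μ * f.eval μ
  | .div e f => e.eval μ / f.eval μ
  | .prior s => if h : s.eval μ < q then (A.prior ⟨s.eval μ, h⟩).toReal else 0
  | .lik v s x =>
      if h : s.eval μ < q ∧ x.eval μ < m then
        (A.lik (v.eval A μ) ⟨s.eval μ, h.1⟩ ⟨x.eval μ, h.2⟩).toReal
      else 0

def Test.holds (μ : Mem V) : Test → Prop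
  | .nlt e f => e.eval μ < f.eval μ
  | .rlt e f => e.eval A μ < f.eval A μ
  | .veq v w => v.eval A μ = w.eval A μ

open Classical in
/-- The answer of the tie-breaking rule to a query; it is `0` if the query is ill-formed. -/
def tieAnswer (μ : Mem V) (v : V) (x t H M : ℕ) : ℕ :=
  if h : x < m ∧ ∀ k : Fin (A.deg v), ∀ r : Fin t, μ.nat H k r < q then
    (A.tie v ⟨x, h.1⟩ t (fun k r => ⟨μ.nat H k r, h.2 k r⟩)
      (Finset.univ.filter fun s : Fin q => μ.nat M s 0 ≠ 0) : ℕ)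
  else 0

/-- `Exec A p μ n ν`: from memory `μ` the program `p` halts after `n` steps with memory `ν`.
A query to the tie-breaking rule is charged with its length. -/
inductive Exec : Prog → Mem V → ℕ → Mem V → Prop
  | skip (μ : Mem V) : Exec .skip μ 1 μ
  | setN (a : ℕ) (i j e : NExpr) (μ : Mem V) :
      Exec (.setN a i j e) μ (i.cost + j.cost + e.cost + 1)
        { μ with nat := upd μ.nat a (i.eval μ) (j.eval μ) (e.eval μ) }
  | setR (a : ℕ) (i j : NExpr) (e : RExpr) (μ : Mem V) :
      Exec (.setR a i j e) μ (i.cost + j.cost + e.cost + 1)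
        { μ with real := upd μ.real a (i.eval μ) (j.eval μ) (e.eval A μ) }
  | setV (a : ℕ) (i j : NExpr) (v : VExpr) (μ : Mem V) :
      Exec (.setV a i j v) μ (i.cost + j.cost + v.cost + 1)
        { μ with node := upd μ.node a (i.eval μ) (j.eval μ) (v.eval A μ) }
  | askDeg (a : ℕ) (i j : NExpr) (v : VExpr) (μ : Mem V) :
      Exec (.askDeg a i j v) μ (i.cost + j.cost + v.cost + 1)
        { μ with nat := upd μ.nat a (i.eval μ) (j.eval μ) (A.deg (v.eval A μ)) }
  | askTie (a : ℕ) (i j : NExpr) (v : VExpr) (x t : NExpr) (H M : ℕ) (μ : Mem V) :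
      Exec (.askTie a i j v x t H M) μ
        (i.cost + j.cost + v.cost + x.cost + t.cost +
          (A.deg (v.eval A μ) * t.eval μ + q + 1))
        { μ with nat := upd μ.nat a (i.eval μ) (j.eval μ)
                    (tieAnswer A μ (v.eval A μ) (x.eval μ) (t.eval μ) H M) }
  | seq {p r : Prog} {μ ν ξ : Mem V} {k l : ℕ} :
      Exec p μ k ν → Exec r ν l ξ → Exec (.seq p r) μ (k + l) ξ
  | iteTrue {b : Test} {p r : Prog} {μ ν : Mem V} {k : ℕ} :
      b.holds A μ → Exec p μ k ν → Exec (.ite b p r) μ (b.cost + k) ν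
  | iteFalse {b : Test} {p r : Prog} {μ ν : Mem V} {k : ℕ} :
      ¬ b.holds A μ → Exec r μ k ν → Exec (.ite b p r) μ (b.cost + k) ν
  | whileTrue {b : Test} {p : Prog} {μ ν ξ : Mem V} {k l : ℕ} :
      b.holds A μ → Exec p μ k ν → Exec (.while b p) ν l ξ →
        Exec (.while b p) μ (b.cost + k + l) ξ
  | whileFalse {b : Test} {p : Prog} {μ : Mem V} :
      ¬ b.holds A μ → Exec (.while b p) μ b.cost μ

/-- The input of agent `v` at time `t`, if `ω` is the outcome: the natural numbers `q`, `m`, `t` and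
her private signal in the first four cells of row `0` of the array `0`; the vote of her `k`-th
neighbour at time `r < t` in the cell `(k, r)` of the array `1`; a reference to herself in
every cell for agents.  All other cells are `0`. -/
def input (v : V) (t : ℕ) (ω : Outcome q m V) : Mem V where
  nat := fun a i j =>
    if a = 0 ∧ i = 0 then
      (if j = 0 then q else if j = 1 then m else if j = 2 then t
        else if j = 3 then (ω.2 v : ℕ) else 0)
    else if a = 1 then
      (if h : i < A.deg v ∧ j < t then (A.vote j (A.nbr v ⟨i, h.1⟩) ω : ℕ) else 0)
    else 0
  real := fun _ _ _ => 0
  node := fun _ _ _ => v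

/-- In the outcome `ω`, the program `p`, run by agent `v` at time `t` on what she knows then,
halts after `n` steps with her vote at time `t` in the cell `(0, 0)` of the array `0`. -/
def ComputesVote (p : Prog) (v : V) (t : ℕ) (ω : Outcome q m V) (n : ℕ) : Prop :=
  ∃ ν : Mem V, Exec A p (input A v t ω) n ν ∧ ν.nat 0 0 0 = (A.vote t v ω : ℕ)

end Semantics

end Machine

end

/-! Doubly exponential learning needs very few rounds: error `ε` is reached once `c * b ^ t ≥ log (1
/ ε)`, so `t` of order `log log (1 / ε)` suffices. Any computation costing `exp (O(t))` is then
polynomial in `log (1 / ε)`. What has to be shown is that a vote at time `t` can be computed in `exp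
(O(t))` steps, although the signal configurations in a ball of radius `t` can be doubly
exponentially many.

This is dynamic programming on the tree. For an edge from `i` to `j`, replace `i` by an agent who
votes a prescribed sequence `τ`, and let `msg r i j s σ τ` be the probability, given the state `s`,
that `j` then votes `σ` before time `r`. In testing whether `j` votes `σ`, her other neighbours may
be assumed to react to `σ` itself instead of to her actual votes (`mem_cavityEvent_succ`), by
induction on time. Their reactions depend only on signals in disjoint branches, so they are
independent given `s`, and a message of level `r + 1` becomes a finite sum of products of messages
of level `r` (`msg_succ`). In the same way the posterior weight of a state is prior times signal
likelihood times a product of messages, so the votes occurring in the recursion are themselves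
computable from messages (`own_eq_tie`). For bounded degree the walks of length at most `t + 1`, the
pairs of histories on an edge and the tuples of histories around an agent are all `exp (O(t))` in
number.

The program lists the walks from the agent and fills a table of messages level by level; each level
is valid on a ball smaller by one. A row is filled by scattering: for each signal and each tuple of
neighbours' histories the agent is simulated, and the resulting probability is added to the cells
which the outcome determines (`sum_contribution`). Cells are addressed by an injective code of
histories (`code_inj`).

Correctness and running time are proved together by weakest preconditions in which each loop is
entered for at most `B` rounds. The cost is then at most `B` to a power that depends only on the
program text (`exec_of_wp`), and `B` may be taken exponential in `t` (`bounds_pow`). -/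

noncomputable section

/-! ### Probability: the recursion for likelihoods of histories on a tree. -/

namespace Network

variable {q m : ℕ} {V : Type u} (A : Network q m V)

/-! ### Votes and the cavity process -/

theorem traj_apply (t : ℕ) (v : V) (ω : Outcome q m V) (r : Fin t) :
    A.traj t v ω r = A.vote r v ω := by
  induction t with
  | zero => exact r.elim0
  | succ t ih =>
    refine Fin.lastCases ?_ (fun r => ?_) r
    · rfl
    · rw [traj, Fin.snoc_castSucc, ih]; rfl

/-- The vote at time `t` of agent `v` with signal `x` whose `k`-th neighbour votes `h k r` at
time `r`. -/
def own (v : V) (x : Fin m) (h : Fin (A.deg v) → ℕ → Fin q) (t : ℕ) : Fin q :=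
  A.decision (A.traj t) v x fun k r => h k r

theorem own_congr {v : V} {x : Fin m} {h h' : Fin (A.deg v) → ℕ → Fin q} {t : ℕ}
    (H : ∀ k, ∀ r < t, h k r = h' k r) : A.own v x h t = A.own v x h' t := by
  unfold own
  congr 1
  funext k r
  exact H k r r.2

theorem vote_eq_own (t : ℕ) (v : V) (ω : Outcome q m V) :
    A.vote t v ω = A.own v (ω.2 v) (fun k r => A.vote r (A.nbr v k) ω) t := by
  have h : A.vote t v ω
      = A.decision (A.traj t) v (ω.2 v) (fun k => A.traj t (A.nbr v k) ω) := by
    rw [vote, traj, Fin.snoc_last]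
  rw [h, own]
  congr 1
  funext k r
  exact A.traj_apply t _ ω r

open Classical in
/-- The votes of `j` if the agent `i` is replaced by one who votes `τ`; only the first `t` votes
are meaningful. -/
def cavity : ℕ → V → V → (ℕ → Fin q) → (V → Fin m) → ℕ → Fin q
  | 0, _, _, τ, _ => τ
  | t + 1, i, j, τ, y => A.own j (y j) fun k =>
      if (A.nbr j k : V) = i then τ else cavity t j (A.nbr j k) (cavity t i j τ y) y

/-- Causality: a vote depends on the replaced agent's votes at strictly earlier times only. -/
theorem cavity_congr (t : ℕ) {i j : V} {τ τ' : ℕ → Fin q} {y : V → Fin m} {r : ℕ} (hr : r < t)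
    (H : ∀ r' < r, τ r' = τ' r') : A.cavity t i j τ y r = A.cavity t i j τ' y r := by
  induction t generalizing i j τ τ' r with
  | zero => omega
  | succ t ih =>
    rw [cavity, cavity]
    refine A.own_congr fun k r' hr' => ?_
    split_ifs
    · exact H r' hr'
    · exact ih (by omega) fun s hs => ih (by omega) fun s' hs' => H _ (by omega)

/-- The recursion depth is immaterial once it exceeds the time of the vote, because each level of
the recursion looks back by at least one time step. -/
theorem cavity_succ {t : ℕ} {i j : V} {τ : ℕ → Fin q} {y : V → Fin m} {r : ℕ} (hr : r < t) :
    A.cavity (t + 1) i j τ y r = A.cavity t i j τ y r := by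
  induction t generalizing i j τ r with
  | zero => omega
  | succ t ih =>
    rw [cavity, cavity]
    refine A.own_congr fun k r' hr' => ?_
    split_ifs
    · rfl
    · rw [ih (by omega)]
      exact A.cavity_congr t (by omega) fun s hs => ih (by omega)

/-- Replacing an agent by a dummy who votes exactly as she does changes nothing. -/
theorem vote_eq_cavity {t : ℕ} (i j : V) (ω : Outcome q m V) {r : ℕ} (hr : r < t) :
    A.vote r j ω = A.cavity t i j (fun r => A.vote r i ω) ω.2 r := by
  induction t generalizing i j r with
  | zero => omega
  | succ t ih =>
    rw [cavity, vote_eq_own]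
    refine A.own_congr fun k r' hr' => ?_
    split_ifs with h
    · rw [h]
    · rw [ih j (A.nbr j k) (by omega)]
      exact A.cavity_congr t (by omega) fun s hs => ih i j (by omega)

/-- The event that `j` votes `σ` before time `r` if `i` is replaced by one who votes `τ`. -/
def cavityEvent (r : ℕ) (i j : V) (σ τ : ℕ → Fin q) : Set (V → Fin m) :=
  {y | ∀ r' < r, A.cavity r i j τ y r' = σ r'}

theorem cavityEvent_congr {r : ℕ} {i j : V} {σ σ' τ τ' : ℕ → Fin q}
    (hσ : ∀ r' < r, σ r' = σ' r') (hτ : ∀ r' < r, τ r' = τ' r') :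
    A.cavityEvent r i j σ τ = A.cavityEvent r i j σ' τ' := by
  ext y
  refine forall₂_congr fun r' hr' => ?_
  rw [hσ r' hr', A.cavity_congr r hr' fun s hs => hτ s (by omega)]

open Classical in
-- The decoupling step. On the right the neighbours react to the fixed sequence `σ`, not to the
-- votes of `j`, so their reactions no longer involve the signal of `j` or each other. Both versions
-- agree by strong induction on time: while `j` has followed `σ`, her neighbours cannot tell the
-- difference.
theorem mem_cavityEvent_succ {r : ℕ} {i j : V} {σ τ : ℕ → Fin q} {y : V → Fin m} :
    y ∈ A.cavityEvent (r + 1) i j σ τ ↔ ∀ r' < r + 1, A.own j (y j) (fun k =>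
      if (A.nbr j k : V) = i then τ else A.cavity r j (A.nbr j k) σ y) r' = σ r' := by
  have key : ∀ r' < r + 1, (∀ s < r', A.cavity r i j τ y s = σ s) →
      A.cavity (r + 1) i j τ y r' = A.own j (y j) (fun k =>
        if (A.nbr j k : V) = i then τ else A.cavity r j (A.nbr j k) σ y) r' := by
    intro r' hr' H
    rw [cavity]
    refine A.own_congr fun k s hs => ?_
    split_ifs
    · rfl
    · exact A.cavity_congr r (by omega) fun s' hs' => H s' (by omega)
  constructor
  · intro H r' hr'
    rw [← key r' hr', H r' hr']
    intro s hs
    rw [← H s (by omega), A.cavity_succ (by omega)]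
  · intro H r' hr'
    induction r' using Nat.strong_induction_on with
    | _ r' ih =>
      rw [key r' hr', H r' hr']
      intro s hs
      rw [← ih s hs (by omega), A.cavity_succ (by omega)]

/-- The same decoupling around the observer: her signal and the observed histories determine her own
votes, so what she sees is a conjunction of one event for each branch. -/
theorem mem_infoEvent_iff {r : ℕ} {v : V} {x : Fin m} {h : Fin (A.deg v) → ℕ → Fin q}
    {ω : Outcome q m V} :
    ω ∈ A.infoEvent (A.traj r) v x (fun k r' => h k r') ↔
      ω.2 v = x ∧ ∀ k, ω.2 ∈ A.cavityEvent r v (A.nbr v k) (h k) (A.own v x h) := by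
  have h1 : ω ∈ A.infoEvent (A.traj r) v x (fun k r' => h k r') ↔
      ω.2 v = x ∧ ∀ k, ∀ r' < r, A.vote r' (A.nbr v k) ω = h k r' := by
    refine and_congr_right fun _ => forall_congr' fun k => ?_
    rw [funext_iff]
    constructor
    · intro H r' hr'
      have := H ⟨r', hr'⟩
      rwa [traj_apply] at this
    · intro H r'
      rw [traj_apply, H r' r'.2]
  rw [h1]
  refine and_congr_right fun hx => ?_
  have key : ∀ r' ≤ r, (∀ k, ∀ s < r', A.vote s (A.nbr v k) ω = h k s) →
      A.vote r' v ω = A.own v x h r' := by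
    intro r' hr' H
    rw [vote_eq_own, hx]
    exact A.own_congr H
  constructor
  · intro H k r' hr'
    rw [← H k r' hr', A.vote_eq_cavity v (A.nbr v k) ω hr']
    exact A.cavity_congr r hr' fun s hs =>
      (key s (by omega) fun k s' hs' => H k s' (by omega)).symm
  · intro H k r' hr'
    induction r' using Nat.strong_induction_on generalizing k with
    | _ r' ih =>
      rw [← H k r' hr', A.vote_eq_cavity v (A.nbr v k) ω hr']
      exact A.cavity_congr r hr' fun s hs =>
        key s (by omega) fun k s' hs' => ih s' (by omega) k (by omega)

/-! ### Branches of the tree -/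

/-- The agents that can be reached from `j` without passing through `i`. -/
def branch (i j : V) : Set V := {v | ∃ p : A.G.Walk j v, i ∉ p.support}

theorem adj_nbr (v : V) (k : Fin (A.deg v)) : A.G.Adj v (A.nbr v k) := (A.nbr v k).2

/-- In a tree the path `j`, `i`, `j'` is the only path between these two neighbours of `i`, and the
support of every walk contains the support of its path. -/
theorem mem_support_of_walk {i j j' : V} (h : A.G.Adj i j) (h' : A.G.Adj i j') (hne : j ≠ j')
    (p : A.G.Walk j j') : i ∈ p.support := by
  classical
  have hq : (SimpleGraph.Walk.cons h.symm (SimpleGraph.Walk.cons h' .nil)).IsPath := by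
    simp [SimpleGraph.Walk.isPath_def, h.ne', h'.ne, hne]
  have : p.toPath = ⟨_, hq⟩ :=
    (A.isTree.isAcyclic.subsingleton_path j j').elim _ _
  apply p.support_toPath_subset_support
  rw [this]
  simp

theorem self_mem_branch {i j : V} (h : i ≠ j) : j ∈ A.branch i j :=
  ⟨.nil, by simpa using h⟩

theorem not_mem_branch {i j : V} : i ∉ A.branch i j := by
  rintro ⟨p, hp⟩
  exact hp p.end_mem_support

/-- If a walk from `l` avoiding `j` met `i`, its initial piece would join two neighbours of `j`
without passing through `j`. -/
theorem branch_subset {i j l : V} (h : A.G.Adj j i) (h' : A.G.Adj j l) (hne : l ≠ i) :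
    A.branch j l ⊆ A.branch i j := by
  classical
  rintro v ⟨p, hp⟩
  refine ⟨.cons h' p, ?_⟩
  rw [SimpleGraph.Walk.support_cons, List.mem_cons, not_or]
  refine ⟨h.ne', fun hi => hp ?_⟩
  exact p.support_takeUntil_subset_support hi (A.mem_support_of_walk h' h hne (p.takeUntil i hi))

theorem branch_disjoint {i j j' : V} (h : A.G.Adj i j) (h' : A.G.Adj i j') (hne : j ≠ j') :
    Disjoint (A.branch i j) (A.branch i j') := by
  rw [Set.disjoint_left]
  rintro v ⟨p, hp⟩ ⟨p', hp'⟩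
  have := A.mem_support_of_walk h h' hne (p.append p'.reverse)
  rw [SimpleGraph.Walk.mem_support_append_iff, SimpleGraph.Walk.support_reverse,
    List.mem_reverse] at this
  exact this.elim hp hp'

/-! ### Independence of the branches -/

/-- The law of the signals given the state. -/
def sigLaw (s : Fin q) : Measure (V → Fin m) :=
  Measure.infinitePi fun v => (A.lik v s).toMeasure

instance (s : Fin q) : IsProbabilityMeasure (A.sigLaw s) := by
  unfold sigLaw; infer_instance

/-- The σ-algebra generated by the signals of the agents in `S`. -/
@[reducible] def sigAlgebra (m : ℕ) (S : Set V) : MeasurableSpace (V → Fin m) :=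
  ⨆ u ∈ S, MeasurableSpace.comap (fun y : V → Fin m => y u) inferInstance

theorem sigAlgebra_mono {S T : Set V} (h : S ⊆ T) : sigAlgebra m S ≤ sigAlgebra m T :=
  biSup_mono h

theorem comap_eval_le (u : V) :
    MeasurableSpace.comap (fun y : V → Fin m => y u) inferInstance ≤ MeasurableSpace.pi :=
  (measurable_pi_apply u).comap_le

theorem sigAlgebra_le (S : Set V) : sigAlgebra m S ≤ MeasurableSpace.pi :=
  iSup₂_le fun u _ => comap_eval_le u

theorem measurableSet_sigAlgebra_eval {S : Set V} {v : V} (hv : v ∈ S) (x : Fin m) :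
    MeasurableSet[sigAlgebra m S] {y : V → Fin m | y v = x} := by
  have h : MeasurableSpace.comap (fun y : V → Fin m => y v) inferInstance ≤ sigAlgebra m S :=
    le_iSup₂_of_le v hv le_rfl
  exact h _ ⟨{x}, measurableSet_singleton x, rfl⟩

theorem indep_sigAlgebra (s : Fin q) {S T : Set V} (h : Disjoint S T) :
    Indep (sigAlgebra m S) (sigAlgebra m T) (A.sigLaw s) := by
  have : iIndepFun (fun u (y : V → Fin m) => y u) (A.sigLaw s) :=
    iIndepFun_infinitePi (X := fun _ y => y) fun _ => measurable_id
  exact indep_iSup_of_disjoint (fun u => comap_eval_le u) this h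

theorem sigLaw_eval (s : Fin q) (v : V) (x : Fin m) :
    (A.sigLaw s).real {y | y v = x} = (A.lik v s x).toReal := by
  have h : (A.sigLaw s).map (fun y => y v) = (A.lik v s).toMeasure :=
    Measure.infinitePi_map_eval _ v
  have h2 : {y : V → Fin m | y v = x} = (fun y => y v) ⁻¹' {x} := rfl
  rw [measureReal_def, h2, ← Measure.map_apply (measurable_pi_apply v) (measurableSet_singleton x),
    h, PMF.toMeasure_apply_singleton _ _ (measurableSet_singleton x)]

/-- The root and the branches at its neighbours are pairwise disjoint sets of agents, so events
determined by their signals are independent given the state. The branches are split off one at a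
time. -/
theorem sigLaw_inter_branches (s : Fin q) (v : V) (x : Fin m) (S : Finset (Fin (A.deg v)))
    (D : Fin (A.deg v) → Set (V → Fin m))
    (hD : ∀ k ∈ S, MeasurableSet[sigAlgebra m (A.branch v (A.nbr v k))] (D k)) :
    (A.sigLaw s).real ({y | y v = x} ∩ ⋂ k ∈ S, D k)
      = (A.lik v s x).toReal * ∏ k ∈ S, (A.sigLaw s).real (D k) := by
  classical
  induction S using Finset.induction_on with
  | empty => simp [sigLaw_eval]
  | insert k S hk ih =>
    have hset : ({y : V → Fin m | y v = x} ∩ ⋂ k' ∈ insert k S, D k')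
        = ({y | y v = x} ∩ ⋂ k' ∈ S, D k') ∩ D k := by
      rw [Finset.set_biInter_insert, ← Set.inter_assoc, Set.inter_right_comm]
    have hdisj : Disjoint ({v} ∪ ⋃ k' ∈ S, A.branch v (A.nbr v k')) (A.branch v (A.nbr v k)) := by
      rw [Set.disjoint_union_left, Set.disjoint_iUnion₂_left]
      refine ⟨Set.disjoint_singleton_left.2 A.not_mem_branch, fun k' hk' => ?_⟩
      refine A.branch_disjoint (A.adj_nbr v k') (A.adj_nbr v k) fun h => hk ?_
      rwa [← (A.nbr v).injective (Subtype.ext h)]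
    have hmeas : MeasurableSet[sigAlgebra m ({v} ∪ ⋃ k' ∈ S, A.branch v (A.nbr v k'))]
        ({y : V → Fin m | y v = x} ∩ ⋂ k' ∈ S, D k') := by
      refine MeasurableSet.inter (measurableSet_sigAlgebra_eval (by simp) x)
        (Finset.measurableSet_biInter _ fun k' hk' => ?_)
      exact sigAlgebra_mono (Set.subset_union_of_subset_right
        (Set.subset_biUnion_of_mem (u := fun k' => A.branch v (A.nbr v k')) hk') _) _
        (hD k' (Finset.mem_insert_of_mem hk'))
    have := (Indep_iff _ _ _).1 (A.indep_sigAlgebra s hdisj) _ _ hmeas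
      (hD k (Finset.mem_insert_self _ _))
    rw [hset, measureReal_def, this, ENNReal.toReal_mul, ← measureReal_def, ← measureReal_def,
      ih fun k' hk' => hD k' (Finset.mem_insert_of_mem hk'), Finset.prod_insert hk]
    ring

/-! ### The recursion for the messages -/

/-- The probability, given the state `s`, that `j` votes `σ` before time `r` if the agent `i` is
replaced by one who votes `τ`. -/
def msg (r : ℕ) (i j : V) (s : Fin q) (σ τ : ℕ → Fin q) : ℝ :=
  (A.sigLaw s).real (A.cavityEvent r i j σ τ)

theorem msg_zero (i j : V) (s : Fin q) (σ τ : ℕ → Fin q) : A.msg 0 i j s σ τ = 1 := by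
  have : A.cavityEvent 0 i j σ τ = Set.univ := by ext y; simp [cavityEvent]
  rw [msg, this, probReal_univ]

theorem msg_congr {r : ℕ} {i j : V} {s : Fin q} {σ σ' τ τ' : ℕ → Fin q}
    (hσ : ∀ r' < r, σ r' = σ' r') (hτ : ∀ r' < r, τ r' = τ' r') :
    A.msg r i j s σ τ = A.msg r i j s σ' τ' := by
  rw [msg, msg, A.cavityEvent_congr hσ hτ]

/-- The event of `mem_infoEvent_iff` in terms of the signals. -/
theorem infoEvent_eq (r : ℕ) (v : V) (x : Fin m) (h : Fin (A.deg v) → ℕ → Fin q) :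
    A.infoEvent (A.traj r) v x (fun k r' => h k r') = Prod.snd ⁻¹' ({y | y v = x} ∩
      ⋂ k ∈ (Finset.univ : Finset (Fin (A.deg v))),
        A.cavityEvent r v (A.nbr v k) (h k) (A.own v x h)) := by
  ext ω
  rw [mem_infoEvent_iff]
  simp

theorem law_apply {F : Set (Outcome q m V)} (hF : MeasurableSet F) :
    A.law F = ∑ s, A.prior s * A.sigLaw s (Prod.mk s ⁻¹' F) := by
  rw [law, Measure.finsetSum_apply]
  refine Finset.sum_congr rfl fun s _ => ?_
  rw [Measure.smul_apply, Measure.map_apply measurable_prodMk_left hF, smul_eq_mul]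
  rfl

instance : IsProbabilityMeasure A.law where
  measure_univ := by
    rw [A.law_apply MeasurableSet.univ]
    simp only [Set.preimage_univ, measure_univ, mul_one]
    rw [← tsum_fintype (L := .unconditional _), A.prior.tsum_coe]

variable [NeZero q]

/-- Extend a finite sequence of votes. -/
def ext {r : ℕ} (h : Fin r → Fin q) : ℕ → Fin q := fun t => if ht : t < r then h ⟨t, ht⟩ else 0

theorem ext_apply {r : ℕ} (h : Fin r → Fin q) {t : ℕ} (ht : t < r) :
    ext h t = h ⟨t, ht⟩ := dif_pos ht

/-- Agent `j`, with signal `x` and histories `h` of her neighbours, votes `σ` up to time `r`, and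
`h` says that `i` votes `τ` before time `r`. -/
def Compat (r : ℕ) (i j : V) (σ τ : ℕ → Fin q) (x : Fin m)
    (h : Fin (A.deg j) → ℕ → Fin q) : Prop :=
  (∀ k, (A.nbr j k : V) = i → ∀ t < r, h k t = τ t) ∧ ∀ t < r + 1, A.own j x h t = σ t

open Classical in
-- Partition according to the signal of `j` and the histories of her neighbours. `Compat` also pins
-- the history of `i` to `τ`; this coordinate is not random, and leaving it free would make the
-- pieces overlap.
theorem cavityEvent_succ (r : ℕ) (i j : V) (σ τ : ℕ → Fin q) :
    A.cavityEvent (r + 1) i j σ τ = ⋃ xh ∈ (Finset.univ.filter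
        fun xh : Fin m × (Fin (A.deg j) → Fin r → Fin q) =>
          A.Compat r i j σ τ xh.1 fun k => ext (xh.2 k)),
      ({y | y j = xh.1} ∩ ⋂ k ∈ (Finset.univ.filter fun k => (A.nbr j k : V) ≠ i),
        A.cavityEvent r j (A.nbr j k) (ext (xh.2 k)) σ) := by
  ext y
  rw [mem_cavityEvent_succ]
  simp only [Set.mem_iUnion, Finset.mem_filter, Finset.mem_univ, true_and, Set.mem_inter_iff,
    Set.mem_ofPred_eq, Set.mem_iInter, exists_prop, Prod.exists]
  constructor
  · intro H
    refine ⟨y j, fun k t => if (A.nbr j k : V) = i then τ t else A.cavity r j (A.nbr j k) σ y t,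
      ⟨fun k hk t ht => ?_, fun t ht => ?_⟩, rfl, fun k hk t ht => ?_⟩
    · simp only [ext_apply _ ht, if_pos hk]
    · rw [← H t ht]
      refine A.own_congr fun k t' ht' => ?_
      simp only [ext_apply _ (show t' < r by omega)]
      split_ifs <;> rfl
    · simp only [ext_apply _ ht, if_neg hk]
  · rintro ⟨x, h, ⟨hτ, hσ⟩, rfl, hk⟩ t ht
    rw [← hσ t ht]
    refine A.own_congr fun k t' ht' => ?_
    split_ifs with hi
    · exact (hτ k hi t' (by omega)).symm
    · exact hk k hi t' (by omega)

/-- With `i` replaced by a fixed sequence, nothing behind `i` can influence `j`: only signals in the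
branch at `j` matter. -/
theorem measurableSet_cavityEvent (r : ℕ) {i j : V} (hij : A.G.Adj j i) (σ τ : ℕ → Fin q) :
    MeasurableSet[sigAlgebra m (A.branch i j)] (A.cavityEvent r i j σ τ) := by
  classical
  induction r generalizing i j σ τ with
  | zero =>
    have : A.cavityEvent 0 i j σ τ = Set.univ := by ext y; simp [cavityEvent]
    rw [this]; exact MeasurableSet.univ
  | succ r ih =>
    rw [cavityEvent_succ]
    refine Finset.measurableSet_biUnion _ fun xh _ => MeasurableSet.inter
      (measurableSet_sigAlgebra_eval (A.self_mem_branch hij.ne') _)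
      (Finset.measurableSet_biInter _ fun k hk => ?_)
    exact sigAlgebra_mono (A.branch_subset hij (A.adj_nbr j k) (Finset.mem_filter.1 hk).2) _
      (ih (A.adj_nbr j k).symm _ _)

theorem measurableSet_cavityEvent' (r : ℕ) {i j : V} (hij : A.G.Adj j i) (σ τ : ℕ → Fin q) :
    MeasurableSet (A.cavityEvent r i j σ τ) :=
  sigAlgebra_le _ _ (A.measurableSet_cavityEvent r hij σ τ)

open Classical in
-- The dynamic programming recursion: the pieces of `cavityEvent_succ` are disjoint, and each of
-- them has product probability by independence of the branches. The neighbour `i` contributes the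
-- factor `1`.
theorem msg_succ (r : ℕ) (i j : V) (s : Fin q) (σ τ : ℕ → Fin q) :
    A.msg (r + 1) i j s σ τ = ∑ x : Fin m, ∑ h : Fin (A.deg j) → Fin r → Fin q,
      if A.Compat r i j σ τ x (fun k => ext (h k)) then
        (A.lik j s x).toReal * ∏ k, if (A.nbr j k : V) = i then 1 else
          A.msg r j (A.nbr j k) s (ext (h k)) σ
      else 0 := by
  rw [msg, cavityEvent_succ, measureReal_biUnion_finset]
  · rw [Finset.sum_filter, ← Finset.univ_product_univ, Finset.sum_product]
    refine Finset.sum_congr rfl fun x _ => Finset.sum_congr rfl fun h _ => ?_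
    split_ifs
    · rw [A.sigLaw_inter_branches s j x _ _ fun k _ =>
        A.measurableSet_cavityEvent r (A.adj_nbr j k).symm _ _, Finset.prod_filter]
      congr 1
      refine Finset.prod_congr rfl fun k _ => ?_
      rw [ite_not]; rfl
    · rfl
  · intro xh hxh xh' hxh' hne
    refine Set.disjoint_left.2 fun y hy hy' => hne ?_
    simp only [Finset.coe_filter, Finset.mem_univ, true_and, Set.mem_ofPred_eq, Set.mem_inter_iff,
      Set.mem_iInter, Finset.mem_filter] at hxh hxh' hy hy'
    refine Prod.ext (hy.1.symm.trans hy'.1) (funext fun k => funext fun t => ?_)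
    have e : ext (xh.2 k) t = ext (xh'.2 k) t := by
      by_cases hk : (A.nbr j k : V) = i
      · exact (hxh.1 k hk t t.2).trans (hxh'.1 k hk t t.2).symm
      · rw [← hy.2 k hk t t.2, ← hy'.2 k hk t t.2]
    rwa [ext_apply _ t.2, ext_apply _ t.2] at e
  · intro xh _
    refine MeasurableSet.inter (measurable_pi_apply j (measurableSet_singleton _))
      (Finset.measurableSet_biInter _ fun k _ =>
        A.measurableSet_cavityEvent' r (A.adj_nbr j k).symm _ _)

/-! ### The Bayesian decision in terms of the messages -/

/-- The joint probability of the state `s`, the signal `x` of agent `v`, and the histories `h` of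
her neighbours before time `r`. -/
def weight (r : ℕ) (v : V) (x : Fin m) (h : Fin (A.deg v) → ℕ → Fin q) (s : Fin q) : ℝ :=
  (A.prior s).toReal * (A.lik v s x).toReal *
    ∏ k, A.msg r v (A.nbr v k) s (h k) (A.own v x h)

theorem measurableSet_infoEvent (r : ℕ) (v : V) (x : Fin m) (h : Fin (A.deg v) → ℕ → Fin q) :
    MeasurableSet (A.infoEvent (A.traj r) v x (fun k r' => h k r')) := by
  rw [infoEvent_eq]
  exact measurable_snd ((measurable_pi_apply v (measurableSet_singleton _)).inter
    (Finset.measurableSet_biInter _ fun k _ =>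
      A.measurableSet_cavityEvent' r (A.adj_nbr v k).symm _ _))

theorem law_infoEvent_inter (r : ℕ) (v : V) (x : Fin m) (h : Fin (A.deg v) → ℕ → Fin q)
    (s : Fin q) :
    A.law.real (A.infoEvent (A.traj r) v x (fun k r' => h k r') ∩ {ω | ω.1 = s})
      = A.weight r v x h s := by
  have hs : MeasurableSet {ω : Outcome q m V | ω.1 = s} := measurable_fst (measurableSet_singleton s)
  rw [measureReal_def, A.law_apply ((A.measurableSet_infoEvent r v x h).inter hs),
    Finset.sum_eq_single s]
  · rw [ENNReal.toReal_mul, ← measureReal_def, weight, mul_assoc, infoEvent_eq]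
    have : (Prod.mk s ⁻¹' (Prod.snd ⁻¹' ({y : V → Fin m | y v = x} ∩
        ⋂ k ∈ (Finset.univ : Finset (Fin (A.deg v))),
        A.cavityEvent r v (A.nbr v k) (h k) (A.own v x h)) ∩ {ω : Outcome q m V | ω.1 = s}))
        = ({y : V → Fin m | y v = x} ∩ ⋂ k ∈ (Finset.univ : Finset (Fin (A.deg v))),
          A.cavityEvent r v (A.nbr v k) (h k) (A.own v x h)) := by
      ext y; simp
    rw [this, A.sigLaw_inter_branches s v x _ _ fun k _ =>
        A.measurableSet_cavityEvent r (A.adj_nbr v k).symm _ _]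
    rfl
  · intro s' _ hne
    have : (Prod.mk s' ⁻¹' (A.infoEvent (A.traj r) v x (fun k r' => h k r') ∩
        {ω : Outcome q m V | ω.1 = s})) = ∅ := by
      ext y; simp [hne]
    rw [this, measure_empty, mul_zero]
  · simp

open Classical in
-- Posterior and joint probabilities differ by a factor that does not depend on the state, so they
-- have the same maximisers.
theorem mapStates_infoEvent (r : ℕ) (v : V) (x : Fin m) (h : Fin (A.deg v) → ℕ → Fin q) :
    A.mapStates (A.infoEvent (A.traj r) v x (fun k r' => h k r'))
      = Finset.univ.filter fun s => ∀ s', A.weight r v x h s' ≤ A.weight r v x h s := by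
  unfold mapStates
  refine Finset.filter_congr fun s _ => forall_congr' fun s' => ?_
  rw [cond_apply (A.measurableSet_infoEvent r v x h), cond_apply (A.measurableSet_infoEvent r v x h),
    ← A.law_infoEvent_inter, ← A.law_infoEvent_inter, measureReal_def, measureReal_def,
    ENNReal.toReal_le_toReal (measure_ne_top _ _) (measure_ne_top _ _)]
  set F := A.infoEvent (A.traj r) v x (fun k r' => h k r')
  by_cases h0 : A.law F = 0
  -- On a null event the conditional probabilities and the weights are all `0`, so every state is
  -- maximal on both sides.
  · have : ∀ s, A.law (F ∩ {ω | ω.1 = s}) = 0 := fun s => measure_inter_null_of_null_left _ h0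
    simp [this]
  · exact ENNReal.mul_le_mul_iff_right (ENNReal.inv_ne_zero.2 (measure_ne_top _ _))
      (ENNReal.inv_ne_top.2 h0)

open Classical in
-- The weight at level `r` involves the agent's own votes before time `r` only, so this determines
-- the votes one after another without circularity.
theorem own_eq_tie (r : ℕ) (v : V) (x : Fin m) (h : Fin (A.deg v) → ℕ → Fin q) :
    A.own v x h r = A.tie v x r (fun k r' => h k r')
      (Finset.univ.filter fun s => ∀ s', A.weight r v x h s' ≤ A.weight r v x h s) := by
  rw [← mapStates_infoEvent]; rfl

end Network

/-! ### Computation: a program logic with cost bounds, and the program evaluating the recursion. -/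

namespace Machine

variable {q m : ℕ} {V : Type u} (A : Network q m V) (B : ℕ)

/-! ### Weakest preconditions

`wp A B p Q μ` says that `p`, started in `μ`, halts in a memory with the property `Q`, that no loop
is traversed more than `B` times when it is entered, and that no query to the tie-breaking rule is
longer than `B`. -/

/-- At most `B` rounds of a loop with test `b` and body transformer `W`. -/
def loopWp (b : Mem V → Prop) (W : (Mem V → Prop) → Mem V → Prop) (Q : Mem V → Prop) :
    ℕ → Mem V → Prop
  | 0, μ => ¬ b μ ∧ Q μ
  | n + 1, μ => (b μ → W (loopWp b W Q n) μ) ∧ (¬ b μ → Q μ)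

def wp : Prog → (Mem V → Prop) → Mem V → Prop
  | .skip, Q, μ => Q μ
  | .setN a i j e, Q, μ => Q { μ with nat := upd μ.nat a (i.eval μ) (j.eval μ) (e.eval μ) }
  | .setR a i j e, Q, μ => Q { μ with real := upd μ.real a (i.eval μ) (j.eval μ) (e.eval A μ) }
  | .setV a i j v, Q, μ => Q { μ with node := upd μ.node a (i.eval μ) (j.eval μ) (v.eval A μ) }
  | .askDeg a i j v, Q, μ =>
      Q { μ with nat := upd μ.nat a (i.eval μ) (j.eval μ) (A.deg (v.eval A μ)) }
  | .askTie a i j v x t H M, Q, μ =>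
      A.deg (v.eval A μ) * t.eval μ + q + 1 ≤ B ∧
      Q { μ with nat := upd μ.nat a (i.eval μ) (j.eval μ)
                    (tieAnswer A μ (v.eval A μ) (x.eval μ) (t.eval μ) H M) }
  | .seq p r, Q, μ => wp p (wp r Q) μ
  | .ite b p r, Q, μ => (b.holds A μ → wp p Q μ) ∧ (¬ b.holds A μ → wp r Q μ)
  | .while b p, Q, μ => loopWp (b.holds A) (wp p) Q B μ

/-- The exponent in the bound for the cost of a program. -/
def Prog.wt : Prog → ℕ
  | .skip => 1
  | .setN _ i j e => i.cost + j.cost + e.cost + 1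
  | .setR _ i j e => i.cost + j.cost + e.cost + 1
  | .setV _ i j v => i.cost + j.cost + v.cost + 1
  | .askDeg _ i j v => i.cost + j.cost + v.cost + 1
  | .askTie _ i j v x t _ _ => i.cost + j.cost + v.cost + x.cost + t.cost + 2
  | .seq p r => p.wt + r.wt + 1
  | .ite b p r => b.cost + p.wt + r.wt + 1
  | .while b p => b.cost + p.wt + 3

theorem le_two_pow_of_le {B : ℕ} (hB : 2 ≤ B) (c : ℕ) : c ≤ B ^ c :=
  Nat.lt_two_pow_self.le.trans (Nat.pow_le_pow_left hB c)

/-- Sums of costs are absorbed into the exponent, so that bounds compose along the syntax of a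
program. -/
theorem add_pow_le {B : ℕ} (hB : 2 ≤ B) {x y a b : ℕ} (hx : x ≤ B ^ a) (hy : y ≤ B ^ b) :
    x + y ≤ B ^ (a + b + 1) := by
  have h1 : B ^ a ≤ B ^ (a + b) := Nat.pow_le_pow_right (by omega) (by omega)
  have h2 : B ^ b ≤ B ^ (a + b) := Nat.pow_le_pow_right (by omega) (by omega)
  rw [pow_succ]
  nlinarith

/-- Every construct raises the exponent by an amount read off from the program; a loop multiplies
the cost of its body by at most the number of rounds. So total correctness with loop bound `B`
yields a running time polynomial in `B` for a fixed program. -/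
theorem exec_of_wp {B : ℕ} (hB : 2 ≤ B) (p : Prog) {Q : Mem V → Prop} {μ : Mem V}
    (h : wp A B p Q μ) : ∃ n ν, n ≤ B ^ p.wt ∧ Exec A p μ n ν ∧ Q ν := by
  induction p generalizing Q μ with
  | skip => exact ⟨1, μ, le_two_pow_of_le hB 1, .skip μ, h⟩
  | setN a i j e => exact ⟨_, _, le_two_pow_of_le hB _, .setN a i j e μ, h⟩
  | setR a i j e => exact ⟨_, _, le_two_pow_of_le hB _, .setR a i j e μ, h⟩
  | setV a i j e => exact ⟨_, _, le_two_pow_of_le hB _, .setV a i j e μ, h⟩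
  | askDeg a i j e => exact ⟨_, _, le_two_pow_of_le hB _, .askDeg a i j e μ, h⟩
  | askTie a i j v x t H M =>
    refine ⟨_, _, ?_, .askTie a i j v x t H M μ, h.2⟩
    exact add_pow_le hB (le_two_pow_of_le hB _) (h.1.trans (pow_one B).ge)
  | seq p r ihp ihr =>
    obtain ⟨n, ν, hn, hp, hν⟩ := ihp h
    obtain ⟨k, ξ, hk, hr, hξ⟩ := ihr hν
    exact ⟨_, ξ, add_pow_le hB hn hk, .seq hp hr, hξ⟩
  | ite b p r ihp ihr =>
    by_cases hb : b.holds A μ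
    · obtain ⟨n, ν, hn, hp, hν⟩ := ihp (h.1 hb)
      refine ⟨_, ν, ?_, .iteTrue hb hp, hν⟩
      refine (add_pow_le hB (le_two_pow_of_le hB b.cost) hn).trans
        (Nat.pow_le_pow_right (by omega) ?_)
      simp only [Prog.wt]; omega
    · obtain ⟨n, ν, hn, hp, hν⟩ := ihr (h.2 hb)
      refine ⟨_, ν, ?_, .iteFalse hb hp, hν⟩
      refine (add_pow_le hB (le_two_pow_of_le hB b.cost) hn).trans
        (Nat.pow_le_pow_right (by omega) ?_)
      simp only [Prog.wt]; omega
  | _ b p ih =>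
    have key : ∀ N μ, loopWp (b.holds A) (wp A B p) Q N μ →
        ∃ n ν, n ≤ (N + 1) * (b.cost + B ^ p.wt) ∧ Exec A (.while b p) μ n ν ∧ Q ν := by
      intro N
      induction N with
      | zero =>
        intro μ h
        exact ⟨_, μ, by omega, .whileFalse h.1, h.2⟩
      | succ N ihN =>
        intro μ h
        by_cases hb : b.holds A μ
        · obtain ⟨n, ν, hn, hp, hν⟩ := ih (h.1 hb)
          obtain ⟨k, ξ, hk, hr, hξ⟩ := ihN ν hν
          refine ⟨_, ξ, ?_, .whileTrue hb hp hr, hξ⟩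
          rw [add_mul (N + 1), one_mul]
          omega
        · exact ⟨_, μ, by nlinarith [Nat.zero_le (B ^ p.wt)], .whileFalse hb, h.2 hb⟩
    obtain ⟨n, ν, hn, hex, hQ⟩ := key B μ h
    refine ⟨n, ν, hn.trans ?_, hex, hQ⟩
    -- The factor `B + 1` counts the final failing test too, and is at most `B ^ 2`.
    have h1 := add_pow_le hB (le_two_pow_of_le hB b.cost) (le_refl (B ^ p.wt))
    calc (B + 1) * (b.cost + B ^ p.wt) ≤ B ^ 2 * B ^ (b.cost + p.wt + 1) :=
          Nat.mul_le_mul (by nlinarith) h1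
      _ = B ^ Prog.wt (.while b p) := by rw [← pow_add]; simp only [Prog.wt]; ring_nf

theorem loopWp_mono {b : Mem V → Prop} {W : (Mem V → Prop) → Mem V → Prop}
    (hW : ∀ Q Q' : Mem V → Prop, (∀ ν, Q ν → Q' ν) → ∀ μ, W Q μ → W Q' μ)
    {Q Q' : Mem V → Prop} (hQ : ∀ ν, Q ν → Q' ν) (n : ℕ) (μ : Mem V)
    (h : loopWp b W Q n μ) : loopWp b W Q' n μ := by
  induction n generalizing μ with
  | zero => exact ⟨h.1, hQ _ h.2⟩
  | succ n ih => exact ⟨fun hb => hW _ _ ih μ (h.1 hb), fun hb => hQ _ (h.2 hb)⟩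

theorem wp_mono (p : Prog) {Q Q' : Mem V → Prop} (hQ : ∀ ν, Q ν → Q' ν) {μ : Mem V}
    (h : wp A B p Q μ) : wp A B p Q' μ := by
  induction p generalizing Q Q' μ with
  | skip => exact hQ _ h
  | setN a i j e => exact hQ _ h
  | setR a i j e => exact hQ _ h
  | setV a i j e => exact hQ _ h
  | askDeg a i j e => exact hQ _ h
  | askTie a i j v x t H M => exact ⟨h.1, hQ _ h.2⟩
  | seq p r ihp ihr => exact ihp (fun ν hν => ihr hQ hν) h
  | ite b p r ihp ihr => exact ⟨fun hb => ihp hQ (h.1 hb), fun hb => ihr hQ (h.2 hb)⟩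
  | _ b p ih => exact loopWp_mono (W := wp A B p) (fun Q Q' hQ μ h => ih hQ h) hQ B μ h

/-! ### Frames -/

/-- May the program write to the array `a` of natural numbers? -/
def Prog.wN (a : ℕ) : Prog → Bool
  | .setN b _ _ _ | .askDeg b _ _ _ | .askTie b _ _ _ _ _ _ _ => a == b
  | .seq p r | .ite _ p r => p.wN a || r.wN a
  | .while _ p => p.wN a
  | _ => false

/-- May the program write to the array `a` of reals? -/
def Prog.wR (a : ℕ) : Prog → Bool
  | .setR b _ _ _ => a == b
  | .seq p r | .ite _ p r => p.wR a || r.wR a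
  | .while _ p => p.wR a
  | _ => false

/-- May the program write to an array of references? -/
def Prog.wV : Prog → Bool
  | .setV _ _ _ _ => true
  | .seq p r | .ite _ p r => p.wV || r.wV
  | .while _ p => p.wV
  | _ => false

/-- `ν` differs from `μ` at most in arrays to which `p` may write. -/
structure Frame (p : Prog) (μ ν : Mem V) : Prop where
  nat : ∀ a, p.wN a = false → ν.nat a = μ.nat a
  real : ∀ a, p.wR a = false → ν.real a = μ.real a
  node : p.wV = false → ν.node = μ.node

theorem upd_of_ne {α : Type*} (f : ℕ → ℕ → ℕ → α) {a a' : ℕ} (h : a' ≠ a) (i j : ℕ) (y : α) :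
    upd f a i j y a' = f a' := by
  funext i' j'; simp [upd, h]

theorem upd_same {α : Type*} (f : ℕ → ℕ → ℕ → α) (a i j : ℕ) (y : α) (i' j' : ℕ) :
    upd f a i j y a i' j' = if i' = i ∧ j' = j then y else f a i' j' := by
  simp [upd]

theorem Frame.refl (p : Prog) (μ : Mem V) : Frame p μ μ :=
  ⟨fun _ _ => rfl, fun _ _ => rfl, fun _ => rfl⟩

/-- Which arrays a program can touch is decided syntactically; later proofs discharge preservation
of all other arrays by `rfl`. -/
theorem wp_frame (p : Prog) {Q : Mem V → Prop} {μ : Mem V} (h : wp A B p Q μ) :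
    wp A B p (fun ν => Q ν ∧ Frame p μ ν) μ := by
  induction p generalizing Q μ with
  | skip => exact ⟨h, .refl _ _⟩
  | setN a i j e =>
    exact ⟨h, fun b hb => upd_of_ne _ (by simpa [Prog.wN] using hb) _ _ _, fun _ _ => rfl,
      fun _ => rfl⟩
  | setR a i j e =>
    exact ⟨h, fun _ _ => rfl, fun b hb => upd_of_ne _ (by simpa [Prog.wR] using hb) _ _ _,
      fun _ => rfl⟩
  | setV a i j e => exact ⟨h, fun _ _ => rfl, fun _ _ => rfl, fun h => by simp [Prog.wV] at h⟩
  | askDeg a i j e =>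
    exact ⟨h, fun b hb => upd_of_ne _ (by simpa [Prog.wN] using hb) _ _ _, fun _ _ => rfl,
      fun _ => rfl⟩
  | askTie a i j v x t H M =>
    exact ⟨h.1, h.2, fun b hb => upd_of_ne _ (by simpa [Prog.wN] using hb) _ _ _, fun _ _ => rfl,
      fun _ => rfl⟩
  | seq p r ihp ihr =>
    refine wp_mono A B p (fun ξ hξ => ?_) (ihp h)
    refine wp_mono A B r (fun ν hν => ⟨hν.1, ?_⟩) (ihr hξ.1)
    refine ⟨fun a ha => ?_, fun a ha => ?_, fun ha => ?_⟩
    · rw [Prog.wN, Bool.or_eq_false_iff] at ha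
      rw [hν.2.nat a ha.2, hξ.2.nat a ha.1]
    · rw [Prog.wR, Bool.or_eq_false_iff] at ha
      rw [hν.2.real a ha.2, hξ.2.real a ha.1]
    · rw [Prog.wV, Bool.or_eq_false_iff] at ha
      rw [hν.2.node ha.2, hξ.2.node ha.1]
  | ite b p r ihp ihr =>
    refine ⟨fun hb => wp_mono A B p (fun ν hν => ⟨hν.1, ?_⟩) (ihp (h.1 hb)),
      fun hb => wp_mono A B r (fun ν hν => ⟨hν.1, ?_⟩) (ihr (h.2 hb))⟩
    · exact ⟨fun a ha => hν.2.nat a (Bool.or_eq_false_iff.1 ha).1,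
        fun a ha => hν.2.real a (Bool.or_eq_false_iff.1 ha).1,
        fun ha => hν.2.node (Bool.or_eq_false_iff.1 ha).1⟩
    · exact ⟨fun a ha => hν.2.nat a (Bool.or_eq_false_iff.1 ha).2,
        fun a ha => hν.2.real a (Bool.or_eq_false_iff.1 ha).2,
        fun ha => hν.2.node (Bool.or_eq_false_iff.1 ha).2⟩
  | _ b p ih =>
    have key : ∀ N ν, Frame p μ ν → loopWp (b.holds A) (wp A B p) Q N ν →
        loopWp (b.holds A) (wp A B p) (fun ξ => Q ξ ∧ Frame p μ ξ) N ν := by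
      intro N
      induction N with
      | zero => exact fun ν hF h => ⟨h.1, h.2, hF⟩
      | succ N ihN =>
        refine fun ν hF h => ⟨fun hb => ?_, fun hb => ⟨h.2 hb, hF⟩⟩
        refine wp_mono A B p (fun ξ hξ => ihN ξ ?_ hξ.1) (ih (h.1 hb))
        exact ⟨fun a ha => (hξ.2.nat a ha).trans (hF.nat a ha),
          fun a ha => (hξ.2.real a ha).trans (hF.real a ha),
          fun ha => (hξ.2.node ha).trans (hF.node ha)⟩
    have := key B μ (.refl _ _) h
    exact loopWp_mono (W := wp A B p) (fun Q Q' hQ μ h => wp_mono A B p hQ h)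
      (fun ν hν => ⟨hν.1, hν.2.nat, hν.2.real, hν.2.node⟩) B μ this

theorem wp_call (p : Prog) {R Q : Mem V → Prop} {μ : Mem V} (h : wp A B p R μ)
    (hQ : ∀ ν, R ν → Frame p μ ν → Q ν) : wp A B p Q μ :=
  wp_mono A B p (fun ν hν => hQ ν hν.1 hν.2) (wp_frame A B p h)

/-! ### Counting loops -/

/-- The content of the cell `(0, 0)` of the array `a`. -/
abbrev reg (a : ℕ) : NExpr := .get a (.lit 0) (.lit 0)

/-- Assign to the cell `(0, 0)` of the array `a`. -/
abbrev setReg (a : ℕ) (e : NExpr) : Prog := .setN a (.lit 0) (.lit 0) e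

/-- Repeat `p` while the counter `c` is less than `e`, incrementing the counter. -/
def Prog.count (c : ℕ) (e : NExpr) (p : Prog) : Prog :=
  .while (.nlt (reg c) e) (.seq p (setReg c (.add (reg c) (.lit 1))))

/-- Set the register `a`. -/
def Mem.setReg (μ : Mem V) (a y : ℕ) : Mem V := { μ with nat := upd μ.nat a 0 0 y }

@[simp] theorem Mem.setReg_nat (μ : Mem V) {a a' : ℕ} (y : ℕ) (h : a' ≠ a) :
    (μ.setReg a y).nat a' = μ.nat a' := upd_of_ne _ h _ _ _

@[simp] theorem Mem.setReg_real (μ : Mem V) (a y : ℕ) : (μ.setReg a y).real = μ.real := rfl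

@[simp] theorem Mem.setReg_node (μ : Mem V) (a y : ℕ) : (μ.setReg a y).node = μ.node := rfl

@[simp] theorem Mem.setReg_same (μ : Mem V) (a y : ℕ) : (μ.setReg a y).nat a 0 0 = y := by
  simp [Mem.setReg, upd]

/-- The rule for a counting loop with invariant `I`, started with counter `n₀`. -/
theorem wp_count {c : ℕ} {e : NExpr} {p : Prog} {μ : Mem V} {Q : Mem V → Prop} {n₀ N : ℕ}
    (I : ℕ → Mem V → Prop) (hn : μ.nat c 0 0 = n₀) (hle : n₀ ≤ N) (hNB : N ≤ B)
    (hc : p.wN c = false)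
    (he : ∀ ν, Frame (.count c e p) μ ν → e.eval ν = N)
    (h0 : I n₀ μ)
    (hstep : ∀ j, n₀ ≤ j → j < N → ∀ ν, Frame (.count c e p) μ ν → ν.nat c 0 0 = j → I j ν →
      wp A B p (fun ξ => I (j + 1) (ξ.setReg c (j + 1))) ν)
    (hQ : ∀ ν, Frame (.count c e p) μ ν → ν.nat c 0 0 = N → I N ν → Q ν) :
    wp A B (.count c e p) Q μ := by
  -- Induction on the fuel `k`, which need only cover the `N - j` rounds that remain.
  have key : ∀ k j ν, N - j ≤ k → n₀ ≤ j → j ≤ N → Frame (.count c e p) μ ν → ν.nat c 0 0 = j →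
      I j ν → loopWp ((Test.nlt (reg c) e).holds A)
        (wp A B (.seq p (setReg c (.add (reg c) (.lit 1))))) Q k ν := by
    intro k
    induction k with
    | zero =>
      intro j ν hk hnj hjN hF hj hI
      obtain rfl : j = N := by omega
      refine ⟨?_, hQ ν hF hj hI⟩
      simp only [Test.holds, NExpr.eval, hj, he ν hF]
      omega
    | succ k ih =>
      intro j ν hk hnj hjN hF hj hI
      constructor
      · intro hb
        simp only [Test.holds, NExpr.eval, hj, he ν hF] at hb
        refine wp_call A B p (hstep j hnj hb ν hF hj hI) fun ξ hξ hFξ => ?_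
        have hcξ : ξ.nat c 0 0 = j := by rw [hFξ.nat c hc, hj]
        simp only [wp, NExpr.eval, hcξ]
        refine ih (j + 1) _ (by omega) (by omega) (by omega) ?_ (by simp [upd]) hξ
        refine ⟨fun a ha => ?_, fun a ha => ?_, fun ha => ?_⟩
        · have h2 := ha
          rw [Prog.count, Prog.wN, Prog.wN, Bool.or_eq_false_iff] at h2
          refine (upd_of_ne _ (by simpa [Prog.wN] using h2.2) _ _ _).trans ?_
          rw [hFξ.nat a h2.1, hF.nat a ha]
        · have h2 := ha
          rw [Prog.count, Prog.wR, Prog.wR, Bool.or_eq_false_iff] at h2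
          exact (hFξ.real a h2.1).trans (hF.real a ha)
        · have h2 := ha
          rw [Prog.count, Prog.wV, Prog.wV, Bool.or_eq_false_iff] at h2
          exact (hFξ.node h2.1).trans (hF.node ha)
      · intro hb
        simp only [Test.holds, NExpr.eval, hj, he ν hF] at hb
        obtain rfl : j = N := by omega
        exact hQ ν hF hj hI
  exact key B n₀ μ (by omega) le_rfl hle (.refl _ _) hn h0

/-! ### Codes of edge histories -/

/-- The code of the sequence `s, τ 0, σ 0, …, τ (r - 1), σ (r - 1)` in bijective base-`q`
numeration. -/
def code (s : ℕ) (τ σ : ℕ → Fin q) : ℕ → ℕ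
  | 0 => s + 1
  | r + 1 => (code s τ σ r * q + τ r + 1) * q + σ r + 1

theorem code_congr {s : ℕ} {τ τ' σ σ' : ℕ → Fin q} {r : ℕ} (hτ : ∀ t < r, τ t = τ' t)
    (hσ : ∀ t < r, σ t = σ' t) : code s τ σ r = code s τ' σ' r := by
  induction r with
  | zero => rfl
  | succ r ih =>
    rw [code, code, ih (fun t ht => hτ t (by omega)) fun t ht => hσ t (by omega),
      hτ r (by omega), hσ r (by omega)]

theorem digit_inj {a b c d : ℕ} (hc : c < q) (hd : d < q) (h : a * q + c + 1 = b * q + d + 1) :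
    a = b ∧ c = d := by
  have h' : c + q * a = d + q * b := by linarith
  have h1 : c = d := by
    have := congrArg (· % q) h'
    simpa [Nat.mod_eq_of_lt hc, Nat.mod_eq_of_lt hd] using this
  subst h1
  exact ⟨Nat.eq_of_mul_eq_mul_left (by omega : 0 < q) (by omega), rfl⟩

/-- Codes of empty histories are `1, …, q`; longer histories lie above them. This separates level
`0` from the rest of the table. -/
theorem lt_code_succ (s : ℕ) (τ σ : ℕ → Fin q) (r : ℕ) : q < code s τ σ (r + 1) := by
  have : 0 < code s τ σ r * q + τ r + 1 := by omega
  rw [code]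
  nlinarith

/-- Bijective numeration has no zero digit, so the length is recovered as well. Distinct levels
therefore occupy disjoint cells of one row. -/
theorem code_inj {s s' : ℕ} (hs : s < q) (hs' : s' < q) {τ τ' σ σ' : ℕ → Fin q} {r r' : ℕ}
    (h : code s τ σ r = code s' τ' σ' r') :
    r = r' ∧ s = s' ∧ (∀ t < r, τ t = τ' t) ∧ ∀ t < r, σ t = σ' t := by
  induction r generalizing r' with
  | zero =>
    cases r' with
    | zero => exact ⟨rfl, by simpa [code] using h, by simp, by simp⟩
    | succ r' =>
      have := lt_code_succ s' τ' σ' r'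
      rw [← h, code] at this
      omega
  | succ r ih =>
    cases r' with
    | zero =>
      have := lt_code_succ s τ σ r
      rw [h, code] at this
      omega
    | succ r' =>
      rw [code, code] at h
      obtain ⟨h1, h2⟩ := digit_inj (σ r).2 (σ' r').2 h
      obtain ⟨h3, h4⟩ := digit_inj (τ r).2 (τ' r').2 h1
      obtain ⟨rfl, h5, h6, h7⟩ := ih h3
      refine ⟨rfl, h5, fun t ht => ?_, fun t ht => ?_⟩
      · rcases Nat.lt_succ_iff_lt_or_eq.1 ht with ht | rfl
        · exact h6 t ht
        · exact Fin.ext h4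
      · rcases Nat.lt_succ_iff_lt_or_eq.1 ht with ht | rfl
        · exact h7 t ht
        · exact Fin.ext h2

/-! ### Appending a digit -/

/-- The number of states. -/
abbrev eQ : NExpr := .get 0 (.lit 0) (.lit 0)

/-- Append the digit `e` to the code in the register `21`. -/
def appendDigit (e : NExpr) : Prog :=
  .seq (setReg 22 (.lit 0)) <| .seq (setReg 23 (.lit 0)) <|
    .seq (.count 22 eQ (setReg 23 (.add (reg 23) (reg 21)))) <|
      setReg 21 (.add (.add (reg 23) e) (.lit 1))

/-- The machine cannot multiply natural numbers, so the factor `q` is produced by `q` additions. The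
digit must not depend on the scratch registers `21` to `23`. -/
theorem wp_appendDigit {e : NExpr} {μ : Mem V} (hq : μ.nat 0 0 0 = q) (hqB : q ≤ B) {y : ℕ}
    (he : ∀ ν : Mem V, (∀ a, a < 21 ∨ 23 < a → ν.nat a = μ.nat a) → e.eval ν = y) :
    wp A B (appendDigit e) (fun ν => ν.nat 21 0 0 = μ.nat 21 0 0 * q + y + 1) μ := by
  simp only [appendDigit, wp, NExpr.eval]
  refine wp_count A B (N := q) (n₀ := 0) (fun j ν => ν.nat 23 0 0 = j * μ.nat 21 0 0) ?_ (by omega)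
    hqB rfl ?_ ?_ ?_ ?_
  · simp [upd]
  · intro ν hF
    simp [NExpr.eval, hF.nat 0 rfl, upd, hq]
  · simp [upd]
  · intro j _ _ ν hF _ hI
    have h21 : ν.nat 21 0 0 = μ.nat 21 0 0 := by rw [hF.nat 21 rfl]; simp [upd]
    simp only [wp, NExpr.eval, hI, h21]
    simp [upd, Mem.setReg]
    ring
  · intro ν hF _ hI
    simp only [hI]
    rw [he ν fun a ha => ?_]
    · simp [upd]; ring
    · rw [hF.nat a]
      · simp only
        rw [upd_of_ne _ (by omega), upd_of_ne _ (by omega)]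
      · have h1 : a ≠ 22 := by omega
        have h2 : a ≠ 23 := by omega
        simp [Prog.count, Prog.wN, h1, h2]

/-! ### Simulating one agent -/

/-- The cell `(n, code s τ σ r)` of the table of messages is correct for all `r ≤ R`, if the row
`n` belongs to the edge from `i` to `j`. -/
def RowOK (μ : Mem V) (R n : ℕ) (i j : V) : Prop :=
  ∀ r ≤ R, ∀ s : Fin q, ∀ σ τ : ℕ → Fin q, μ.real 0 n (code s τ σ r) = A.msg r i j s σ τ

/-- The memory is ready for the simulation of the agent `v` in row `n` with signal `x` until time
`r`, the histories `h` of her neighbours being stored in the array `H`. -/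
structure SimPre (H : ℕ) (μ : Mem V) (n : ℕ) (v : V) (x : Fin m) (h : Fin (A.deg v) → ℕ → Fin q)
    (r : ℕ) : Prop where
  states : μ.nat 0 0 0 = q
  row : μ.nat 11 0 0 = n
  node : μ.node 0 0 n = v
  deg : μ.nat 6 0 n = A.deg v
  signal : μ.nat 12 0 0 = x
  time : μ.nat 13 0 0 = r
  hist : ∀ k : Fin (A.deg v), ∀ t < r, μ.nat H k t = h k t
  rows : ∀ k : Fin (A.deg v), RowOK A μ r (μ.nat 5 0 n + k) v (A.nbr v k)

/-- The row, the signal and the final time of the simulation, and the degree and the row of the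
first neighbour. -/
abbrev eRow : NExpr := reg 11
abbrev eSig : NExpr := reg 12
abbrev eTime : NExpr := reg 13
abbrev eDeg : NExpr := .get 6 (.lit 0) eRow
abbrev eNode : VExpr := .get 0 (.lit 0) eRow
abbrev eChild (k : NExpr) : NExpr := .add (.get 5 (.lit 0) eRow) k

variable {A} in
-- Arrays below `14` hold the input of a simulation; the simulation writes only to scratch arrays
-- from `14` on.
theorem SimPre.congr {H : ℕ} {μ ν : Mem V} {n : ℕ} {v : V} {x : Fin m}
    {h : Fin (A.deg v) → ℕ → Fin q} {r : ℕ} (hμ : SimPre A H μ n v x h r) (hH : H < 14)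
    (hn : ∀ a < 14, ν.nat a = μ.nat a) (hr : ν.real 0 = μ.real 0) (hv : ν.node = μ.node) :
    SimPre A H ν n v x h r where
  states := by rw [hn 0 (by omega)]; exact hμ.states
  row := by rw [hn 11 (by omega)]; exact hμ.row
  node := by rw [hv]; exact hμ.node
  deg := by rw [hn 6 (by omega)]; exact hμ.deg
  signal := by rw [hn 12 (by omega)]; exact hμ.signal
  time := by rw [hn 13 (by omega)]; exact hμ.time
  hist := by rw [hn H hH]; exact hμ.hist
  rows := by unfold RowOK; rw [hn 5 (by omega), hr]; exact hμ.rows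

/-- Put the weight of the state in register `19` into the array of weights. -/
def weightProg : Prog :=
  .seq (.setR 1 (.lit 0) (reg 19) (.mul (.prior (reg 19)) (.lik eNode (reg 19) eSig))) <|
  .seq (setReg 18 (.lit 0)) <|
  .count 18 eDeg <| .setR 1 (.lit 0) (reg 19) <| .mul (.get 1 (.lit 0) (reg 19)) <|
    .get 0 (eChild (reg 18)) (.get 15 (reg 18) (reg 19))

/-- The keys of the neighbours are the codes of the histories before time `t`. -/
def Keys (μ : Mem V) (v : V) (x : Fin m) (h : Fin (A.deg v) → ℕ → Fin q) (t : ℕ) : Prop :=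
  ∀ k : Fin (A.deg v), ∀ s < q, μ.nat 15 k s = code s (A.own v x h) (h k) t

section Sim

variable {H : ℕ} {μ : Mem V} {n : ℕ} {v : V} {x : Fin m} {h : Fin (A.deg v) → ℕ → Fin q} {r : ℕ}

theorem wp_weightProg (hμ : SimPre A H μ n v x h r) (hB : A.deg v ≤ B) {t : ℕ}
    (ht : t ≤ r) (hk : Keys A μ v x h t) (s : Fin q) (hs : μ.nat 19 0 0 = s) :
    wp A B weightProg (fun ν => ∀ j, ν.real 1 0 j =
      if j = s then A.weight t v x h s else μ.real 1 0 j) μ := by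
  simp only [weightProg, wp, NExpr.eval, RExpr.eval, VExpr.eval, hs, hμ.row, hμ.node, hμ.signal]
  -- The factors are extended to all natural numbers so that the loop invariant can be a product
  -- over an initial range.
  set g : ℕ → ℝ := fun k => if hk : k < A.deg v then
    A.msg t v (A.nbr v ⟨k, hk⟩) s (h ⟨k, hk⟩) (A.own v x h) else 1 with hg
  refine wp_count A B (N := A.deg v) (n₀ := 0) (fun k ν => ∀ j, ν.real 1 0 j =
      if j = s then (A.prior s).toReal * (A.lik v s x).toReal * ∏ k' ∈ Finset.range k, g k'
      else μ.real 1 0 j) ?_ (by omega) hB rfl ?_ ?_ ?_ ?_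
  · simp [upd]
  · intro ν hF
    simp [NExpr.eval, hF.nat 6 rfl, hF.nat 11 rfl, upd, hμ.row, hμ.deg]
  · intro j
    simp [upd]
  · intro k _ hkN ν hF hk18 hI j
    have e19 : ν.nat 19 0 0 = s := by rw [hF.nat 19 rfl]; simpa [upd] using hs
    have e15 : ν.nat 15 = μ.nat 15 := by rw [hF.nat 15 rfl]; simp [upd_of_ne]
    have e5 : ν.nat 5 = μ.nat 5 := by rw [hF.nat 5 rfl]; simp [upd_of_ne]
    have e11 : ν.nat 11 0 0 = n := by rw [hF.nat 11 rfl]; simpa [upd] using hμ.row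
    have e0 : ν.real 0 = μ.real 0 := by rw [hF.real 0 rfl]; simp [upd_of_ne]
    simp only [NExpr.eval, RExpr.eval, e19, hk18, e5, e11, e0, e15, Mem.setReg_real, upd_same,
      true_and, hI]
    split_ifs with hj
    · rw [Finset.prod_range_succ, hk ⟨k, hkN⟩ s s.2, hμ.rows ⟨k, hkN⟩ t ht s _ _]
      simp only [hg, dif_pos hkN, mul_assoc]
    · rfl
  · intro ν hF _ hI j
    rw [hI, Finset.prod_range, Network.weight]
    simp only [hg, Fin.is_lt, dif_pos, Fin.eta]

/-- Compute the weights of all states. -/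
def weightsProg : Prog := .seq (setReg 19 (.lit 0)) <| .count 19 eQ weightProg

theorem wp_weightsProg (hμ : SimPre A H μ n v x h r) (hH : H < 14) (hB : A.deg v ≤ B)
    (hqB : q ≤ B) {t : ℕ} (ht : t ≤ r) (hk : Keys A μ v x h t) :
    wp A B weightsProg (fun ν => ∀ s : Fin q, ν.real 1 0 s = A.weight t v x h s) μ := by
  simp only [weightsProg, wp, NExpr.eval]
  refine wp_count A B (N := q) (n₀ := 0) (fun k ν => ∀ s : Fin q, (s : ℕ) < k →
      ν.real 1 0 s = A.weight t v x h s) ?_ (by omega) hqB rfl ?_ ?_ ?_ ?_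
  · simp [upd]
  · intro ν hF
    simp [NExpr.eval, hF.nat 0 rfl, upd, hμ.states]
  · simp
  · intro k _ hkq ν hF hk19 hI
    have hν : SimPre A H ν n v x h r := by
      refine hμ.congr hH (fun a ha => ?_) (hF.real 0 rfl) (hF.node rfl)
      rw [hF.nat a (by interval_cases a <;> rfl)]
      exact upd_of_ne _ (by omega) _ _ _
    have hkν : Keys A ν v x h t := by
      unfold Keys; rw [hF.nat 15 rfl]; simpa [Keys, upd_of_ne] using hk
    refine wp_call A B _ (wp_weightProg A B hν hB ht hkν ⟨k, hkq⟩ hk19) fun ξ hξ _ s hs => ?_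
    rw [Mem.setReg_real, hξ]
    split_ifs with h1
    · obtain rfl : s = ⟨k, hkq⟩ := Fin.ext h1
      rfl
    · exact hI s (by simp only at h1; omega)
  · intro ν hF _ hI s
    exact hI s s.2

/-- Mark the states of maximal weight. -/
def maskProg : Prog :=
  .seq (setReg 19 (.lit 0)) <| .count 19 eQ <|
    .seq (.setN 17 (reg 19) (.lit 0) (.lit 1)) <| .seq (setReg 20 (.lit 0)) <| .count 20 eQ <|
      .ite (.rlt (.get 1 (.lit 0) (reg 19)) (.get 1 (.lit 0) (reg 20)))
        (.setN 17 (reg 19) (.lit 0) (.lit 0)) .skip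

theorem wp_maskProg {μ : Mem V} (hq : μ.nat 0 0 0 = q) (hqB : q ≤ B) :
    wp A B maskProg (fun ν => ∀ s < q, ν.nat 17 s 0 ≠ 0 ↔
      ∀ s' < q, μ.real 1 0 s' ≤ μ.real 1 0 s) μ := by
  simp only [maskProg, wp, NExpr.eval]
  refine wp_count A B (N := q) (n₀ := 0) (fun k ν => ∀ s < k, ν.nat 17 s 0 ≠ 0 ↔
      ∀ s' < q, μ.real 1 0 s' ≤ μ.real 1 0 s) ?_ (by omega) hqB rfl ?_ ?_ ?_ ?_
  · simp [upd]
  · intro ν hF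
    simp [NExpr.eval, hF.nat 0 rfl, upd, hq]
  · simp
  · intro k _ hkq ν hF hk19 hI
    have e1 : ν.real 1 = μ.real 1 := hF.real 1 rfl
    have e0 : ν.nat 0 0 0 = q := by rw [hF.nat 0 rfl]; simpa [upd] using hq
    simp only [wp, NExpr.eval, hk19]
    refine wp_count A B (N := q) (n₀ := 0) (fun j ξ => (∀ s < k, ξ.nat 17 s 0 ≠ 0 ↔
        ∀ s' < q, μ.real 1 0 s' ≤ μ.real 1 0 s) ∧ (ξ.nat 17 k 0 ≠ 0 ↔
        ∀ s' < j, μ.real 1 0 s' ≤ μ.real 1 0 k)) ?_ (by omega) hqB rfl ?_ ?_ ?_ ?_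
    · simp [upd]
    · intro ξ hF'
      simp [NExpr.eval, hF'.nat 0 rfl, upd, e0]
    · refine ⟨fun s hs => ?_, ?_⟩
      · rw [← hI s hs]
        simp [upd, hs.ne]
      · simp [upd]
    · intro j _ hjq ξ hF' hj20 hI'
      have e19 : ξ.nat 19 0 0 = k := by rw [hF'.nat 19 rfl]; simpa [upd] using hk19
      have e1' : ξ.real 1 = μ.real 1 := (hF'.real 1 rfl).trans e1
      simp only [wp, NExpr.eval, RExpr.eval, Test.holds, e19, hj20, e1']
      refine ⟨fun hlt => ⟨fun s hs => ?_, ?_⟩, fun hlt => ⟨fun s hs => ?_, ?_⟩⟩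
      · rw [← hI'.1 s hs, Mem.setReg_nat _ _ (by decide)]; dsimp only; rw [upd_same, if_neg (by omega)]
      · rw [Mem.setReg_nat _ _ (by decide)]; dsimp only; rw [upd_same, if_pos ⟨rfl, rfl⟩]
        simp only [ne_eq, not_true_eq_false, false_iff, not_forall, not_le]
        exact ⟨j, by omega, hlt⟩
      · rw [← hI'.1 s hs, Mem.setReg_nat _ _ (by decide)]
      · rw [Mem.setReg_nat _ _ (by decide), hI'.2]
        refine ⟨fun H s' hs' => ?_, fun H s' hs' => H s' (by omega)⟩
        rcases Nat.lt_succ_iff_lt_or_eq.1 hs' with hs' | rfl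
        · exact H s' hs'
        · exact not_lt.1 hlt
    · intro ξ hF' _ hI' s hs
      rw [Mem.setReg_nat _ _ (by decide)]
      rcases Nat.lt_succ_iff_lt_or_eq.1 hs with hs | rfl
      · exact hI'.1 s hs
      · exact hI'.2
  · intro ν hF _ hI s hs
    exact hI s hs

/-- Compute the vote at the time in register `14`. -/
def voteProg (H : ℕ) : Prog :=
  .seq weightsProg <| .seq maskProg <| .askTie 16 (.lit 0) (reg 14) eNode eSig (reg 14) H 17

theorem wp_voteProg (hμ : SimPre A H μ n v x h r) (hH : H < 14) (hB : A.deg v ≤ B)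
    (hqB : A.deg v * r + q + 1 ≤ B) {t : ℕ} (ht : t ≤ r) (ht14 : μ.nat 14 0 0 = t)
    (hk : Keys A μ v x h t) :
    wp A B (voteProg H) (fun ν => ∀ j, ν.nat 16 0 j =
      if j = t then (A.own v x h t : ℕ) else μ.nat 16 0 j) μ := by
  have hqB' : q ≤ B := by omega
  simp only [voteProg, wp]
  refine wp_call A B _ (wp_weightsProg A B hμ hH hB hqB' ht hk) fun ν hν hF => ?_
  have hSν : SimPre A H ν n v x h r :=
    hμ.congr hH (fun a ha => hF.nat a (by interval_cases a <;> rfl)) (hF.real 0 rfl) (hF.node rfl)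
  refine wp_call A B _ (wp_maskProg A B hSν.states hqB') fun ξ hξ hF' => ?_
  have hSξ : SimPre A H ξ n v x h r :=
    hSν.congr hH (fun a ha => hF'.nat a (by interval_cases a <;> rfl)) (hF'.real 0 rfl)
      (hF'.node rfl)
  have e14 : ξ.nat 14 0 0 = t := by rw [hF'.nat 14 rfl, hF.nat 14 rfl, ht14]
  have e16 : ξ.nat 16 = μ.nat 16 := by rw [hF'.nat 16 rfl, hF.nat 16 rfl]
  simp only [NExpr.eval, VExpr.eval, hSξ.row, hSξ.node, hSξ.signal, e14]
  refine ⟨by nlinarith [Nat.mul_le_mul_left (A.deg v) ht], fun j => ?_⟩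
  rw [upd_same, e16]
  have hwf : (x : ℕ) < m ∧ ∀ k : Fin (A.deg v), ∀ t' : Fin t, ξ.nat H k t' < q :=
    ⟨x.2, fun k t' => by rw [hSξ.hist k t' (by omega)]; exact (h k t').2⟩
  -- The stored histories and the mask of maximal weights form exactly the query of `own_eq_tie`.
  have hans : tieAnswer A ξ v x t H 17 = A.own v x h t := by
    classical
    have : NeZero q := ⟨by have := (A.own v x h 0).2; omega⟩
    rw [tieAnswer, dif_pos hwf, A.own_eq_tie]
    congr 2
    · funext k t'
      exact Fin.ext (hSξ.hist k t' (by omega))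
    · refine Finset.filter_congr fun s _ => ?_
      rw [hξ s s.2]
      constructor
      · intro H s'
        rw [← hν, ← hν]
        exact H s' s'.2
      · intro H s' hs'
        have := H ⟨s', hs'⟩
        rwa [← hν, ← hν] at this
  rw [hans]
  split_ifs with h1 h2 h2
  · rfl
  · exact absurd h1.2 h2
  · exact absurd ⟨rfl, h2⟩ h1
  · rfl

/-- Extend the keys by the votes at the time in register `14`. -/
def keyProg (H : ℕ) : Prog :=
  .seq (setReg 18 (.lit 0)) <| .count 18 eDeg <|
    .seq (setReg 19 (.lit 0)) <| .count 19 eQ <|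
      .seq (setReg 21 (.get 15 (reg 18) (reg 19))) <|
      .seq (appendDigit (.get 16 (.lit 0) (reg 14))) <|
      .seq (appendDigit (.get H (reg 18) (reg 14))) <|
      .setN 15 (reg 18) (reg 19) (reg 21)

theorem wp_keyProg (hμ : SimPre A H μ n v x h r) (hH : H < 14) (hB : A.deg v ≤ B)
    (hqB : q ≤ B) {t : ℕ} (ht : t < r) (ht14 : μ.nat 14 0 0 = t)
    (hown : μ.nat 16 0 t = A.own v x h t) (hk : Keys A μ v x h t) :
    wp A B (keyProg H) (fun ν => Keys A ν v x h (t + 1)) μ := by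
  simp only [keyProg, wp, NExpr.eval]
  refine wp_count A B (N := A.deg v) (n₀ := 0) (fun k ν => ∀ k' : Fin (A.deg v), ∀ s < q,
    ν.nat 15 k' s = if (k' : ℕ) < k then code s (A.own v x h) (h k') (t + 1) else
      code s (A.own v x h) (h k') t) ?_ (by omega) hB rfl ?_ ?_ ?_ ?_
  · simp [upd]
  · intro ν hF
    simp [NExpr.eval, hF.nat 6 rfl, hF.nat 11 rfl, upd, hμ.row, hμ.deg]
  · intro k' s hs
    simpa [upd] using hk k' s hs
  · intro k _ hkd ν hF hk18 hI
    have hν : SimPre A H ν n v x h r := by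
      refine hμ.congr hH (fun a ha => ?_) (hF.real 0 rfl) (hF.node rfl)
      rw [hF.nat a (by interval_cases a <;> rfl)]
      exact upd_of_ne _ (by omega) _ _ _
    have e14 : ν.nat 14 0 0 = t := by rw [hF.nat 14 rfl]; simpa [upd] using ht14
    have e16 : ν.nat 16 0 t = A.own v x h t := by rw [hF.nat 16 rfl]; simpa [upd] using hown
    simp only [wp, NExpr.eval]
    -- The keys are extended in lexicographic order of neighbour and state; those already passed
    -- have length `t + 1`.
    refine wp_count A B (N := q) (n₀ := 0) (fun j ξ => ∀ k' : Fin (A.deg v), ∀ s < q,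
      ξ.nat 15 k' s = if (k' : ℕ) < k ∨ (k' : ℕ) = k ∧ s < j then
        code s (A.own v x h) (h k') (t + 1) else code s (A.own v x h) (h k') t)
      ?_ (by omega) hqB rfl ?_ ?_ ?_ ?_
    · simp [upd]
    · intro ξ hF'
      simp [NExpr.eval, hF'.nat 0 rfl, upd, hν.states]
    · intro k' s hs
      simpa [upd] using hI k' s hs
    · intro j _ hjq ξ hF' hj19 hI'
      have hξ : ∀ a < 14, ξ.nat a = ν.nat a := fun a ha => by
        rw [hF'.nat a (by interval_cases a <;> rfl)]
        exact upd_of_ne _ (by omega) _ _ _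
      have f18 : ξ.nat 18 0 0 = k := by rw [hF'.nat 18 rfl]; simpa [upd] using hk18
      have f14 : ξ.nat 14 0 0 = t := by rw [hF'.nat 14 rfl]; simpa [upd] using e14
      have f16 : ξ.nat 16 0 t = A.own v x h t := by rw [hF'.nat 16 rfl]; simpa [upd] using e16
      have fH : ξ.nat H k t = h ⟨k, hkd⟩ t := by rw [hξ H hH]; exact hν.hist ⟨k, hkd⟩ t ht
      have f0 : ξ.nat 0 0 0 = q := by rw [hξ 0 (by omega)]; exact hν.states
      simp only [wp, NExpr.eval, f18, hj19]
      have f15 := hI' ⟨k, hkd⟩ j hjq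
      simp only [lt_self_iff_false, and_false, or_self, if_false] at f15
      rw [f15]
      refine wp_call A B _ (wp_appendDigit A B (y := A.own v x h t) ?_ hqB ?_) fun ζ hζ hF3 => ?_
      · simpa [upd] using f0
      · intro ζ hζ
        simp [NExpr.eval, hζ 14 (by omega), hζ 16 (by omega), upd, f14, f16]
      refine wp_call A B _ (wp_appendDigit A B (y := h ⟨k, hkd⟩ t) ?_ hqB ?_) fun ζ' hζ' hF4 => ?_
      · rw [hF3.nat 0 rfl]; simpa [upd] using f0
      · intro ζ' hζ'
        have a1 : ζ.nat H = ξ.nat H := by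
          rw [hF3.nat H (by interval_cases H <;> rfl)]; exact upd_of_ne _ (by omega) _ _ _
        have a2 : ζ.nat 18 0 0 = k := by rw [hF3.nat 18 rfl]; simpa [upd] using f18
        have a3 : ζ.nat 14 0 0 = t := by rw [hF3.nat 14 rfl]; simpa [upd] using f14
        simp [NExpr.eval, hζ' 18 (by omega), hζ' 14 (by omega), hζ' H (by omega), a1, a2, a3, fH]
      have b18 : ζ'.nat 18 0 0 = k := by
        rw [hF4.nat 18 rfl, hF3.nat 18 rfl]; simpa [upd] using f18
      have b19 : ζ'.nat 19 0 0 = j := by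
        rw [hF4.nat 19 rfl, hF3.nat 19 rfl]; simpa [upd] using hj19
      have b15 : ζ'.nat 15 = ξ.nat 15 := by
        rw [hF4.nat 15 rfl, hF3.nat 15 rfl]
        dsimp only
        exact upd_of_ne _ (show 15 ≠ 21 by decide) _ _ _
      have bval : ζ'.nat 21 0 0 = code j (A.own v x h) (h ⟨k, hkd⟩) (t + 1) := by
        rw [hζ', hζ]; simp [upd, code]
      simp only [b18, b19, bval]
      intro k' s hs
      rw [Mem.setReg_nat _ _ (by decide)]
      dsimp only
      rw [upd_same, b15, hI' k' s hs]
      by_cases h1 : (k' : ℕ) = k ∧ s = j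
      · obtain ⟨h1, rfl⟩ := h1
        obtain rfl : k' = ⟨k, hkd⟩ := Fin.ext h1
        simp
      · rw [if_neg h1]
        have : ((k' : ℕ) < k ∨ (k' : ℕ) = k ∧ s < j) ↔
            ((k' : ℕ) < k ∨ (k' : ℕ) = k ∧ s < j + 1) := by omega
        simp only [this]
    · intro ξ hF' _ hI' k' s hs
      rw [Mem.setReg_nat _ _ (by decide), hI' k' s hs]
      have : ((k' : ℕ) < k ∨ (k' : ℕ) = k ∧ s < q) ↔ (k' : ℕ) < k + 1 := by omega
      simp only [this]
  · intro ν hF _ hI k' s hs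
    rw [hI k' s hs, if_pos k'.2]

/-- Set the keys to the codes of the empty histories. -/
def keyInitProg : Prog :=
  .seq (setReg 18 (.lit 0)) <| .count 18 eDeg <|
    .seq (setReg 19 (.lit 0)) <| .count 19 eQ <|
      .setN 15 (reg 18) (reg 19) (.add (reg 19) (.lit 1))

theorem wp_keyInitProg (hμ : SimPre A H μ n v x h r) (hB : A.deg v ≤ B) (hqB : q ≤ B) :
    wp A B keyInitProg (fun ν => Keys A ν v x h 0) μ := by
  simp only [keyInitProg, wp, NExpr.eval]
  refine wp_count A B (N := A.deg v) (n₀ := 0) (fun k ν => ∀ k' < k, ∀ s < q,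
    ν.nat 15 k' s = s + 1) ?_ (by omega) hB rfl ?_ ?_ ?_ ?_
  · simp [upd]
  · intro ν hF
    simp [NExpr.eval, hF.nat 6 rfl, hF.nat 11 rfl, upd, hμ.row, hμ.deg]
  · simp
  · intro k _ hkd ν hF hk18 hI
    have e0 : ν.nat 0 0 0 = q := by rw [hF.nat 0 rfl]; simpa [upd] using hμ.states
    simp only [wp, NExpr.eval]
    refine wp_count A B (N := q) (n₀ := 0) (fun j ξ => (∀ k' < k, ∀ s < q,
      ξ.nat 15 k' s = s + 1) ∧ ∀ s < j, ξ.nat 15 k s = s + 1) ?_ (by omega) hqB rfl ?_ ?_ ?_ ?_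
    · simp [upd]
    · intro ξ hF'
      simp [NExpr.eval, hF'.nat 0 rfl, upd, e0]
    · simpa [upd] using hI
    · intro j _ hjq ξ hF' hj19 hI'
      have f18 : ξ.nat 18 0 0 = k := by rw [hF'.nat 18 rfl]; simpa [upd] using hk18
      simp only [wp, NExpr.eval, f18, hj19, Mem.setReg_nat _ _ (show (15 : ℕ) ≠ 19 by decide), upd_same]
      refine ⟨fun k' hk' s hs => ?_, fun s hs => ?_⟩
      · rw [if_neg (by omega), hI'.1 k' hk' s hs]
      · split_ifs with h1
        · rw [h1.2]
        · refine hI'.2 s ((Nat.lt_succ_iff_lt_or_eq.1 hs).resolve_right fun h2 => h1 ?_)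
          simpa using h2
    · intro ξ hF' _ hI' k' hk' s hs
      rw [Mem.setReg_nat _ _ (by decide)]
      rcases Nat.lt_succ_iff_lt_or_eq.1 hk' with hk' | rfl
      · exact hI'.1 k' hk' s hs
      · exact hI'.2 s hs
  · intro ν hF _ hI k' s hs
    exact hI k' k'.2 s hs

/-- Compute all votes until the time in register `13`, and the keys at that time. -/
def simProg (H : ℕ) : Prog :=
  .seq keyInitProg <| .seq (setReg 14 (.lit 0)) <|
    .seq (.count 14 eTime <| .seq (voteProg H) (keyProg H)) (voteProg H)

/-- Keys at time `t` give the weights, hence the vote at time `t`, and that vote gives the keys at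
time `t + 1`. The last vote is computed after the loop, so the keys stay at length `r`, as the later
lookups need. -/
theorem wp_simProg (hμ : SimPre A H μ n v x h r) (hH : H < 14) (hB : A.deg v ≤ B) (hrB : r ≤ B)
    (hqB : A.deg v * r + q + 1 ≤ B) :
    wp A B (simProg H) (fun ν => (∀ t ≤ r, ν.nat 16 0 t = A.own v x h t) ∧
      Keys A ν v x h r) μ := by
  have hqB' : q ≤ B := by omega
  simp only [simProg, wp, NExpr.eval]
  refine wp_call A B _ (wp_keyInitProg A B hμ hB hqB') fun ν hν hF => ?_
  refine wp_count A B (N := r) (n₀ := 0) (fun t ξ => (∀ t' < t, ξ.nat 16 0 t' = A.own v x h t') ∧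
      Keys A ξ v x h t) ?_ (by omega) hrB
      (by rw [Prog.wN]; interval_cases H <;> rfl) ?_ ?_ ?_ ?_
  · simp [upd]
  · intro ξ hF'
    simp [NExpr.eval, hF'.nat 13 (by interval_cases H <;> rfl), hF.nat 13 rfl, upd, hμ.time]
  · refine ⟨by simp, ?_⟩
    simpa [Keys, upd] using hν
  · intro t _ htr ξ hF' ht14 hI
    have hξ : SimPre A H ξ n v x h r := by
      refine hμ.congr hH (fun a ha => ?_) ?_ ?_
      · rw [hF'.nat a (by interval_cases a <;> rfl)]
        refine (upd_of_ne _ (by omega) _ _ _).trans (hF.nat a (by interval_cases a <;> rfl))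
      · exact (hF'.real 0 rfl).trans (hF.real 0 rfl)
      · exact (hF'.node rfl).trans (hF.node rfl)
    simp only [wp]
    refine wp_call A B _ (wp_voteProg A B hξ hH hB hqB htr.le ht14 hI.2) fun ζ hζ hF3 => ?_
    have hSζ : SimPre A H ζ n v x h r :=
      hξ.congr hH (fun a ha => hF3.nat a (by interval_cases a <;> rfl)) (hF3.real 0 rfl)
        (hF3.node rfl)
    refine wp_call A B _ (wp_keyProg A B hSζ hH hB hqB' htr (by rw [hF3.nat 14 rfl, ht14])
      (by rw [hζ, if_pos rfl]) ?_) fun ζ' hζ' hF4 => ⟨fun t' ht' => ?_, ?_⟩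
    · unfold Keys; rw [hF3.nat 15 rfl]; exact hI.2
    · rw [Mem.setReg_nat _ _ (by decide), hF4.nat 16 rfl, hζ]
      split_ifs with h1
      · rw [h1]
      · exact hI.1 t' (by omega)
    · unfold Keys
      rw [Mem.setReg_nat _ _ (by decide)]
      exact hζ'
  · intro ξ hF' ht14 hI
    have hξ : SimPre A H ξ n v x h r := by
      refine hμ.congr hH (fun a ha => ?_) ?_ ?_
      · rw [hF'.nat a (by interval_cases a <;> rfl)]
        refine (upd_of_ne _ (by omega) _ _ _).trans (hF.nat a (by interval_cases a <;> rfl))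
      · exact (hF'.real 0 rfl).trans (hF.real 0 rfl)
      · exact (hF'.node rfl).trans (hF.node rfl)
    refine wp_call A B _ (wp_voteProg A B hξ hH hB hqB le_rfl ht14 hI.2)
      fun ζ hζ hF3 => ⟨fun t ht => ?_, ?_⟩
    · rw [hζ]
      split_ifs with h1
      · rw [h1]
      · exact hI.1 t (by omega)
    · unfold Keys; rw [hF3.nat 15 rfl]; exact hI.2

end Sim

theorem VExpr.eval_nbr {μ : Mem V} {v : VExpr} {e : NExpr} {w : V} {k : ℕ} (hv : v.eval A μ = w)
    (hk : e.eval μ = k) (h : k < A.deg w) : (VExpr.nbr v e).eval A μ = A.nbr w ⟨k, h⟩ := by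
  subst hv hk
  rw [VExpr.eval, dif_pos h]

/-! ### Enumerating the walks from an agent

Row `0` belongs to the agent `v`; if a row belongs to the agent `w`, then each of the neighbours of
`w` gets a row of its own. -/

/-- The first `n` rows have been expanded, and `c` rows are in use. -/
structure Tree (μ : Mem V) (v : V) (d n c : ℕ) : Prop where
  root : μ.node 0 0 0 = v
  deg : ∀ i < n, μ.nat 6 0 i = A.deg (μ.node 0 0 i)
  child : ∀ i < n, ∀ k : Fin (A.deg (μ.node 0 0 i)),
    μ.node 0 0 (μ.nat 5 0 i + k) = A.nbr (μ.node 0 0 i) k ∧ μ.nat 7 0 (μ.nat 5 0 i + k) = i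
  first : ∀ i < n, 1 ≤ μ.nat 5 0 i
  last : ∀ i < n, μ.nat 5 0 i + μ.nat 6 0 i ≤ c
  parent : ∀ i, 1 ≤ i → i < c → μ.nat 7 0 i < c ∧
    A.G.Adj (μ.node 0 0 (μ.nat 7 0 i)) (μ.node 0 0 i)
  pos : 1 ≤ c
  size : c ≤ d * n + 1

/-- Create rows for the neighbours of the agent in the row `n`, the content of register `4`. -/
def expandProg : Prog :=
  .seq (.setN 5 (.lit 0) (reg 4) (reg 3)) <|
  .seq (.askDeg 6 (.lit 0) (reg 4) (.get 0 (.lit 0) (reg 4))) <|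
  .seq (setReg 10 (.lit 0)) <| .count 10 (.get 6 (.lit 0) (reg 4)) <|
    .seq (.setV 0 (.lit 0) (reg 3) (.nbr (.get 0 (.lit 0) (reg 4)) (reg 10))) <|
    .seq (.setN 7 (.lit 0) (reg 3) (reg 4)) <| setReg 3 (.add (reg 3) (.lit 1))

theorem wp_expandProg {μ : Mem V} {v : V} {d n c : ℕ} (hT : Tree A μ v d n c) (hn : n < c)
    (h4 : μ.nat 4 0 0 = n) (h3 : μ.nat 3 0 0 = c) (hd : ∀ v, A.deg v ≤ d) (hB : d ≤ B) :
    wp A B expandProg (fun ν => ∃ c', c ≤ c' ∧ Tree A ν v d (n + 1) c' ∧ ν.nat 3 0 0 = c' ∧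
      ∀ i < n, ν.nat 5 0 i = μ.nat 5 0 i ∧ ν.nat 6 0 i = μ.nat 6 0 i) μ := by
  simp only [expandProg, wp, NExpr.eval, VExpr.eval]
  refine wp_count A B (N := A.deg (μ.node 0 0 n)) (n₀ := 0) (fun k ν => ν.nat 3 0 0 = c + k ∧
    (∀ i < c, ν.node 0 0 i = μ.node 0 0 i ∧ ν.nat 7 0 i = μ.nat 7 0 i) ∧
    ∀ k' : Fin (A.deg (μ.node 0 0 n)), (k' : ℕ) < k →
      ν.node 0 0 (c + k') = A.nbr (μ.node 0 0 n) k' ∧ ν.nat 7 0 (c + k') = n)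
    ?_ (by omega) ((hd _).trans hB) rfl ?_ ?_ ?_ ?_
  · simp [upd]
  · intro ν hF
    simp [NExpr.eval, hF.nat 6 rfl, hF.nat 4 rfl, upd, h4]
  · simp [upd, h3]
  · intro k _ hk ν hF h10 hI
    have e4 : ν.nat 4 0 0 = n := by rw [hF.nat 4 rfl]; simpa [upd] using h4
    have ev : ν.node 0 0 n = μ.node 0 0 n := (hI.2.1 n hn).1
    have hev : VExpr.eval A ν (.nbr (.get 0 (.lit 0) (reg 4)) (reg 10))
        = A.nbr (μ.node 0 0 n) ⟨k, hk⟩ :=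
      VExpr.eval_nbr A (by simp only [VExpr.eval, NExpr.eval, e4, ev])
        (by simpa only [NExpr.eval] using h10) hk
    simp only [wp, hev]
    simp only [NExpr.eval, e4, hI.1]
    refine ⟨?_, fun i hi => ⟨?_, ?_⟩, fun k' hk' => ⟨?_, ?_⟩⟩
    · simp [Mem.setReg, upd, hI.1, add_assoc]
    · have : i ≠ c + k := by omega
      simp [upd, this, hI.2.1 i hi]
    · have : i ≠ c + k := by omega
      simp [Mem.setReg, upd, this, hI.2.1 i hi, hI.1]
    · simp only [Mem.setReg_node, upd_same, true_and]
      split_ifs with h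
      · obtain rfl : k' = ⟨k, hk⟩ := Fin.ext (by simp only; omega)
        rfl
      · exact (hI.2.2 k' (by omega)).1
    · simp only [Mem.setReg, upd, hI.1]
      by_cases h : (k' : ℕ) = k
      · simp [h]
      · simp [h, (hI.2.2 k' (by omega)).2]
  · intro ν hF _ hI
    have e5 : ∀ i, ν.nat 5 0 i = if i = n then c else μ.nat 5 0 i := by
      intro i; rw [hF.nat 5 rfl]; simp [upd, h4, h3]
    have e6 : ∀ i, ν.nat 6 0 i = if i = n then A.deg (μ.node 0 0 n) else μ.nat 6 0 i := by
      intro i; rw [hF.nat 6 rfl]; simp [upd, h4]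
    have en : ∀ i < c, ν.node 0 0 i = μ.node 0 0 i := fun i hi => (hI.2.1 i hi).1
    have e7 : ∀ i < c, ν.nat 7 0 i = μ.nat 7 0 i := fun i hi => (hI.2.1 i hi).2
    refine ⟨c + A.deg (μ.node 0 0 n), by omega, ?_, hI.1, fun i hi => ?_⟩
    · refine ⟨?_, fun i hi => ?_, fun i hi => ?_, fun i hi => ?_, fun i hi => ?_,
        fun i h1 hi => ?_, by have := hT.pos; omega, ?_⟩
      · rw [en 0 (by omega), hT.root]
      · rw [e6, en i (by omega)]
        split_ifs with h
        · rw [h]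
        · exact hT.deg i (by omega)
      · rw [en i (by omega), e5]
        intro k
        split_ifs with h
        · subst h
          exact hI.2.2 k k.2
        · have h1 := hT.child i (by omega) k
          have h2 := hT.last i (by omega)
          have h3 := hT.deg i (by omega)
          have h4 : μ.nat 5 0 i + k < c := by have := k.2; omega
          rw [en _ h4, e7 _ h4]
          exact h1
      · rw [e5]
        split_ifs with h
        · exact hT.pos
        · exact hT.first i (by omega)
      · rw [e5, e6]
        split_ifs with h
        · omega
        · have := hT.last i (by omega)
          omega
      · rcases lt_or_ge i c with hic | hic
        · have h2 := hT.parent i h1 hic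
          rw [e7 i hic, en _ h2.1, en i hic]
          exact ⟨by omega, h2.2⟩
        · obtain ⟨k, rfl⟩ := Nat.exists_eq_add_of_le hic
          have h2 := hI.2.2 ⟨k, by omega⟩ (by simp only; omega)
          simp only at h2
          rw [h2.2, h2.1, en n hn]
          exact ⟨by omega, A.adj_nbr _ _⟩
      · have h1 := hT.size
        have h2 := hd (μ.node 0 0 n)
        rw [mul_add]
        omega
    · rw [e5, e6, if_neg (by omega), if_neg (by omega)]
      exact ⟨rfl, rfl⟩

/-- The rows of the walks of length at most `ℓ` from `v` are those before `μ.nat 8 0 ℓ`. -/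
structure Ball (μ : Mem V) (v : V) (d T : ℕ) : Prop where
  root : μ.node 0 0 0 = v
  zero : μ.nat 8 0 0 = 1
  mono : ∀ ℓ < T, μ.nat 8 0 ℓ ≤ μ.nat 8 0 (ℓ + 1)
  size : ∀ ℓ ≤ T, μ.nat 8 0 ℓ ≤ (d + 1) ^ ℓ
  deg : ∀ ℓ < T, ∀ i < μ.nat 8 0 ℓ, μ.nat 6 0 i = A.deg (μ.node 0 0 i)
  child : ∀ ℓ < T, ∀ i < μ.nat 8 0 ℓ, ∀ k : Fin (A.deg (μ.node 0 0 i)),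
    μ.node 0 0 (μ.nat 5 0 i + k) = A.nbr (μ.node 0 0 i) k ∧ μ.nat 7 0 (μ.nat 5 0 i + k) = i
  first : ∀ ℓ < T, ∀ i < μ.nat 8 0 ℓ, 1 ≤ μ.nat 5 0 i
  last : ∀ ℓ < T, ∀ i < μ.nat 8 0 ℓ, μ.nat 5 0 i + μ.nat 6 0 i ≤ μ.nat 8 0 (ℓ + 1)
  parent : ∀ i, 1 ≤ i → i < μ.nat 8 0 T → A.G.Adj (μ.node 0 0 (μ.nat 7 0 i)) (μ.node 0 0 i)

/-- The time at which the vote is cast. -/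
abbrev eT : NExpr := .get 0 (.lit 0) (.lit 2)

/-- Enumerate the walks which are by at most one step longer than the time of the vote. -/
def treeProg : Prog :=
  .seq (.setN 8 (.lit 0) (.lit 0) (.lit 1)) <| .seq (setReg 3 (.lit 1)) <|
  .seq (setReg 4 (.lit 0)) <| .seq (setReg 9 (.lit 0)) <| .count 9 (.add eT (.lit 1)) <|
    .seq (.count 4 (.get 8 (.lit 0) (reg 9)) expandProg) <|
      .setN 8 (.lit 0) (.add (reg 9) (.lit 1)) (reg 3)

theorem wp_treeProg {μ : Mem V} {v : V} {d T : ℕ} (hv : μ.node 0 0 0 = v) (hT : μ.nat 0 0 2 + 1 = T)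
    (hd : ∀ v, A.deg v ≤ d) (hB : d ≤ B) (hTB : T ≤ B) (hdB : (d + 1) ^ T ≤ B) :
    wp A B treeProg (fun ν => Ball A ν v d T) μ := by
  simp only [treeProg, wp, NExpr.eval]
  -- Here `p` is the number of rows expanded so far. It covers all walks shorter than `L`, while the
  -- rows up to `ν.nat 8 0 L` have been created.
  refine wp_count A B (N := T) (n₀ := 0) (fun L ν => ∃ p, ν.nat 4 0 0 = p ∧
    p ≤ ν.nat 8 0 L ∧ Tree A ν v d p (ν.nat 8 0 L) ∧ ν.nat 3 0 0 = ν.nat 8 0 L ∧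
    ν.nat 8 0 0 = 1 ∧ (∀ ℓ < L, ν.nat 8 0 ℓ ≤ p) ∧
    (∀ ℓ < L, ν.nat 8 0 ℓ ≤ ν.nat 8 0 (ℓ + 1)) ∧ (∀ ℓ ≤ L, ν.nat 8 0 ℓ ≤ (d + 1) ^ ℓ) ∧
    ∀ ℓ < L, ∀ i < ν.nat 8 0 ℓ, ν.nat 5 0 i + ν.nat 6 0 i ≤ ν.nat 8 0 (ℓ + 1))
    ?_ (by omega) hTB rfl ?_ ?_ ?_ ?_
  · simp [upd]
  · intro ν hF
    simp [NExpr.eval, hF.nat 0 rfl, upd, hT]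
  · refine ⟨0, by simp [upd], by simp, ⟨by simpa using hv, by simp, by simp, by simp, by simp,
      ?_, by simp [upd], by simp [upd]⟩, by simp [upd], by simp [upd], by simp, by simp, ?_,
      by simp⟩
    · intro i h1 h2
      simp [upd] at h2
      omega
    · intro ℓ hℓ
      obtain rfl : ℓ = 0 := by omega
      simp [upd]
  · rintro L _ hLT ν hF h9 ⟨p, h4, hp, hTree, h3, hz, hlp, hmono, hsize, hlast⟩
    have hLB : ν.nat 8 0 L ≤ B :=
      (hsize L le_rfl).trans ((Nat.pow_le_pow_right (by omega) hLT.le).trans hdB)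
    refine wp_count A B (N := ν.nat 8 0 L) (n₀ := p) (fun n ξ => ∃ c, ν.nat 8 0 L ≤ c ∧
      Tree A ξ v d n c ∧ ξ.nat 3 0 0 = c ∧
      ∀ i < p, ξ.nat 5 0 i = ν.nat 5 0 i ∧ ξ.nat 6 0 i = ν.nat 6 0 i)
      h4 hp hLB rfl ?_ ?_ ?_ ?_
    · intro ξ hF'
      simp [NExpr.eval, hF'.nat 8 rfl, hF'.nat 9 rfl, h9]
    · exact ⟨_, le_rfl, hTree, h3, fun i _ => ⟨rfl, rfl⟩⟩
    · rintro n hpn hn ξ hF' h4' ⟨c, hc, hT', h3', hold⟩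
      refine wp_call A B _ (wp_expandProg A B hT' (by omega) h4' h3' hd hB) ?_
      rintro ζ ⟨c', hc', hT'', h3'', hold'⟩ _
      refine ⟨c', by omega, ?_, by simpa using h3'', fun i hi => ?_⟩
      · exact ⟨hT''.root, hT''.deg, hT''.child, hT''.first, hT''.last, hT''.parent, hT''.pos,
          hT''.size⟩
      · have h1 := hold i hi
        have h2 := hold' i (by omega)
        simp [h2, h1]
    · rintro ξ hF' h4' ⟨c, hc, hT', h3', hold⟩
      have e9 : ξ.nat 9 0 0 = L := by rw [hF'.nat 9 rfl, h9]
      have e8 : ξ.nat 8 = ν.nat 8 := hF'.nat 8 rfl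
      simp only [wp, NExpr.eval, e9, h3']
      set ζ : Mem V := Mem.setReg { ξ with nat := upd ξ.nat 8 0 (L + 1) c } 9 (L + 1) with hζ
      have f8 : ∀ ℓ, ζ.nat 8 0 ℓ = if ℓ = L + 1 then c else ν.nat 8 0 ℓ := by
        intro ℓ; simp [hζ, upd, e8]
      have f : ∀ a, a ≠ 8 → a ≠ 9 → ζ.nat a = ξ.nat a := by
        intro a h1 h2
        rw [hζ, Mem.setReg_nat _ _ h2]
        exact upd_of_ne _ h1 _ _ _
      have fn : ζ.node = ξ.node := rfl
      have g1 : ∀ ℓ < L + 1, ζ.nat 8 0 ℓ ≤ ν.nat 8 0 L := by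
        intro ℓ hℓ
        rw [f8, if_neg (by omega)]
        rcases Nat.lt_succ_iff_lt_or_eq.1 hℓ with h | rfl
        · exact (hlp ℓ h).trans hp
        · exact le_rfl
      refine ⟨ν.nat 8 0 L, ?_, ?_, ?_, ?_, ?_, g1, ?_, ?_, ?_⟩
      · rw [f 4 (by decide) (by decide), h4']
      · rw [f8, if_pos rfl]; exact hc
      · rw [f8, if_pos rfl]
        constructor
        · rw [fn]; exact hT'.root
        · rw [fn, f 6 (by decide) (by decide)]; exact hT'.deg
        · rw [fn, f 5 (by decide) (by decide), f 7 (by decide) (by decide)]; exact hT'.child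
        · rw [f 5 (by decide) (by decide)]; exact hT'.first
        · rw [f 5 (by decide) (by decide), f 6 (by decide) (by decide)]; exact hT'.last
        · rw [fn, f 7 (by decide) (by decide)]; exact hT'.parent
        · exact hT'.pos
        · exact hT'.size
      · rw [f8, if_pos rfl, f 3 (by decide) (by decide), h3']
      · rw [f8, if_neg (by omega), hz]
      · intro ℓ hℓ
        rw [f8 (ℓ + 1)]
        split_ifs with h
        · exact (g1 ℓ hℓ).trans hc
        · rw [f8, if_neg (by omega)]
          exact hmono ℓ (by omega)
      · intro ℓ hℓ
        rw [f8]
        split_ifs with h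
        -- Each expanded row adds at most `d` rows, so the new total is at most `d * (d + 1) ^ L +
        -- 1`, which is at most `(d + 1) ^ (L + 1)`.
        · rw [h, pow_succ]
          have h1 := hT'.size
          have h2 := hsize L le_rfl
          have h3 : 1 ≤ (d + 1) ^ L := Nat.one_le_pow _ _ (by omega)
          nlinarith
        · exact hsize ℓ (by omega)
      · intro ℓ hℓ i hi
        rw [f8 (ℓ + 1), f 5 (by decide) (by decide), f 6 (by decide) (by decide)]
        split_ifs with h
        · exact hT'.last i (hi.trans_le (g1 ℓ hℓ))
        · rw [f8, if_neg (by omega)] at hi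
          have h1 := hold i (hi.trans_le (hlp ℓ (by omega)))
          rw [h1.1, h1.2]
          exact hlast ℓ (by omega) i hi
  · rintro ν hF h9 ⟨p, h4, hp, hTree, h3, hz, hlp, hmono, hsize, hlast⟩
    exact ⟨hTree.root, hz, hmono, hsize, fun ℓ hℓ i hi => hTree.deg i (hi.trans_le (hlp ℓ hℓ)),
      fun ℓ hℓ i hi => hTree.child i (hi.trans_le (hlp ℓ hℓ)),
      fun ℓ hℓ i hi => hTree.first i (hi.trans_le (hlp ℓ hℓ)), hlast,
      fun i h1 h2 => (hTree.parent i h1 h2).2⟩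

/-! ### Enumerating histories -/

/-- The history of length `r` of the `k`-th neighbour which is encoded by the number `c`. -/
def digits [NeZero q] (r c k t : ℕ) : Fin q := Fin.ofNat q (c / q ^ (r * k + t))

/-- A tuple of `D` histories of length `r` is a string of `D * r` base-`q` digits, so one counter
runs through all tuples. `F` must ignore later times, where `digits` and `ext` differ. -/
theorem sum_digits [NeZero q] (r D : ℕ) (F : (Fin D → ℕ → Fin q) → ℝ)
    (hF : ∀ h h', (∀ k, ∀ t < r, h k t = h' k t) → F h = F h') :
    ∑ c ∈ Finset.range (q ^ (D * r)), F (fun k => digits r c k)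
      = ∑ h : Fin D → Fin r → Fin q, F (fun k => Network.ext (h k)) := by
  rw [Finset.sum_range]
  let e : Fin (q ^ (D * r)) ≃ (Fin D → Fin r → Fin q) :=
    finFunctionFinEquiv.symm.trans
      ((finProdFinEquiv.symm.arrowCongr (Equiv.refl _)).trans (Equiv.curry _ _ _))
  refine Fintype.sum_equiv e _ _ fun c => hF _ _ fun k t ht => ?_
  rw [Network.ext_apply _ ht]
  apply Fin.ext
  have : (e c k ⟨t, ht⟩ : ℕ) = (c : ℕ) / q ^ ((finProdFinEquiv (k, ⟨t, ht⟩) : Fin (D * r)) : ℕ) % q :=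
    rfl
  rw [this, finProdFinEquiv_apply_val, add_comm]
  rfl

/-- Put the number of histories of the neighbours of the agent in the row in register `11` until
the time in register `13` into register `25`. -/
def powProg : Prog :=
  .seq (setReg 25 (.lit 1)) <| .seq (setReg 30 (.lit 0)) <| .count 30 eDeg <|
    .seq (setReg 31 (.lit 0)) <| .count 31 eTime <|
      .seq (setReg 28 (.lit 0)) <| .seq (setReg 29 (.lit 0)) <|
      .seq (.count 29 eQ (setReg 28 (.add (reg 28) (reg 25)))) <| setReg 25 (reg 28)

theorem wp_powProg {μ : Mem V} {D r : ℕ} (hq : μ.nat 0 0 0 = q)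
    (hD : μ.nat 6 0 (μ.nat 11 0 0) = D) (hr : μ.nat 13 0 0 = r) (hqB : q ≤ B) (hDB : D ≤ B)
    (hrB : r ≤ B) :
    wp A B powProg (fun ν => ν.nat 25 0 0 = q ^ (D * r)) μ := by
  simp only [powProg, wp, NExpr.eval]
  refine wp_count A B (N := D) (n₀ := 0) (fun k ν => ν.nat 25 0 0 = q ^ (k * r))
    ?_ (by omega) hDB rfl ?_ ?_ ?_ ?_
  · simp [upd]
  · intro ν hF
    simpa [NExpr.eval, hF.nat 6 rfl, hF.nat 11 rfl, upd] using hD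
  · simp [upd]
  · intro k _ hk ν hF _ hI
    have f0 : ν.nat 0 0 0 = q := by rw [hF.nat 0 rfl]; simpa [upd] using hq
    have f13 : ν.nat 13 0 0 = r := by rw [hF.nat 13 rfl]; simpa [upd] using hr
    simp only [wp, NExpr.eval]
    refine wp_count A B (N := r) (n₀ := 0) (fun j ξ => ξ.nat 25 0 0 = q ^ (k * r + j))
      ?_ (by omega) hrB rfl ?_ ?_ ?_ ?_
    · simp [upd]
    · intro ξ hF'
      simpa [NExpr.eval, hF'.nat 13 rfl, upd] using f13
    · simpa [upd] using hI
    · intro j _ hj ξ hF' _ hI'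
      have g0 : ξ.nat 0 0 0 = q := by rw [hF'.nat 0 rfl]; simpa [upd] using f0
      simp only [wp, NExpr.eval]
      refine wp_count A B (N := q) (n₀ := 0) (fun a ζ => ζ.nat 28 0 0 = a * q ^ (k * r + j))
        ?_ (by omega) hqB rfl ?_ ?_ ?_ ?_
      · simp [upd]
      · intro ζ hF3
        simpa [NExpr.eval, hF3.nat 0 rfl, upd] using g0
      · simp [upd]
      · intro a _ _ ζ hF3 _ hI3
        have g25 : ζ.nat 25 0 0 = q ^ (k * r + j) := by
          rw [hF3.nat 25 rfl]; simpa [upd] using hI'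
        simp only [wp, NExpr.eval, hI3, g25]
        simp [Mem.setReg, upd]
        ring
      · intro ζ _ _ hI3
        simp [Mem.setReg, upd, hI3]
        ring
    · intro ξ _ _ hI'
      rw [Mem.setReg_nat _ _ (by decide), hI']
      ring
  · intro ν _ _ hI
    exact hI

/-- Decode the number in register `24`. -/
def decodeProg : Prog :=
  .seq (setReg 26 (reg 24)) <| .seq (setReg 30 (.lit 0)) <| .count 30 eDeg <|
    .seq (setReg 31 (.lit 0)) <| .count 31 eTime <|
      .seq (setReg 27 (.lit 0)) <| .seq (setReg 28 (.lit 0)) <| .seq (setReg 29 (.lit 0)) <|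
      .seq (.count 29 (reg 26) <| .seq (setReg 28 (.add (reg 28) (.lit 1))) <|
        .ite (.nlt (reg 28) eQ) .skip <|
          .seq (setReg 28 (.lit 0)) (setReg 27 (.add (reg 27) (.lit 1)))) <|
      .seq (.setN 2 (reg 30) (reg 31) (reg 28)) <| setReg 26 (reg 27)

/-- Without division on natural numbers, quotient and remainder by `q` come from counting up to the
dividend; this is affordable because `c ≤ B`. -/
theorem wp_decodeProg {μ : Mem V} {D r c : ℕ} (hq : μ.nat 0 0 0 = q) (hq0 : 0 < q)
    (hD : μ.nat 6 0 (μ.nat 11 0 0) = D) (hr : μ.nat 13 0 0 = r) (hc : μ.nat 24 0 0 = c)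
    (hDB : D ≤ B) (hrB : r ≤ B) (hcB : c ≤ B) :
    wp A B decodeProg (fun ν => ∀ k < D, ∀ t < r, ν.nat 2 k t = c / q ^ (r * k + t) % q) μ := by
  simp only [decodeProg, wp, NExpr.eval]
  refine wp_count A B (N := D) (n₀ := 0) (fun k ν => ν.nat 26 0 0 = c / q ^ (r * k) ∧
    ∀ k' < k, ∀ t < r, ν.nat 2 k' t = c / q ^ (r * k' + t) % q) ?_ (by omega) hDB rfl ?_ ?_ ?_ ?_
  · simp [upd]
  · intro ν hF
    simpa [NExpr.eval, hF.nat 6 rfl, hF.nat 11 rfl, upd] using hD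
  · simp [upd, hc]
  · intro k _ hk ν hF h30 hI
    have f0 : ν.nat 0 0 0 = q := by rw [hF.nat 0 rfl]; simpa [upd] using hq
    have f13 : ν.nat 13 0 0 = r := by rw [hF.nat 13 rfl]; simpa [upd] using hr
    simp only [wp, NExpr.eval]
    refine wp_count A B (N := r) (n₀ := 0) (fun j ξ => ξ.nat 26 0 0 = c / q ^ (r * k + j) ∧
      (∀ k' < k, ∀ t < r, ξ.nat 2 k' t = c / q ^ (r * k' + t) % q) ∧
      ∀ t < j, ξ.nat 2 k t = c / q ^ (r * k + t) % q) ?_ (by omega) hrB rfl ?_ ?_ ?_ ?_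
    · simp [upd]
    · intro ξ hF'
      simpa [NExpr.eval, hF'.nat 13 rfl, upd] using f13
    · simpa [upd] using hI
    · intro j _ hj ξ hF' h31 hI'
      have g0 : ξ.nat 0 0 0 = q := by rw [hF'.nat 0 rfl]; simpa [upd] using f0
      have g30 : ξ.nat 30 0 0 = k := by rw [hF'.nat 30 rfl]; simpa [upd] using h30
      simp only [wp, NExpr.eval]
      -- Register `27` is the quotient and register `28` the remainder of the count reached so far.
      refine wp_count A B (N := c / q ^ (r * k + j)) (n₀ := 0)
        (fun a ζ => a = ζ.nat 27 0 0 * q + ζ.nat 28 0 0 ∧ ζ.nat 28 0 0 < q)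
        ?_ (by omega) ((Nat.div_le_self _ _).trans hcB) rfl ?_ ?_ ?_ ?_
      · simp [upd]
      · intro ζ hF3
        simpa [NExpr.eval, hF3.nat 26 rfl, upd] using hI'.1
      · simpa [upd] using hq0
      · intro a _ _ ζ hF3 _ hI3
        have e0 : ζ.nat 0 0 0 = q := by rw [hF3.nat 0 rfl]; simpa [upd] using g0
        simp only [wp, NExpr.eval, Test.holds]
        simp only [Mem.setReg, upd, e0]
        refine ⟨fun hlt => ?_, fun hlt => ?_⟩
        · simp at hlt ⊢
          exact ⟨by omega, hlt⟩
        · simp at hlt ⊢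
          have : q = ζ.nat 28 0 0 + 1 := by omega
          refine ⟨?_, hq0⟩
          rw [add_mul, one_mul]
          omega
      · intro ζ hF3 _ hI3
        have e30 : ζ.nat 30 0 0 = k := by rw [hF3.nat 30 rfl]; simpa [upd] using g30
        have e31 : ζ.nat 31 0 0 = j := by rw [hF3.nat 31 rfl]; simpa [upd] using h31
        have e2 : ζ.nat 2 = ξ.nat 2 := by rw [hF3.nat 2 rfl]; funext i j; simp [upd]
        have hdiv : ζ.nat 27 0 0 = c / q ^ (r * k + j) / q := by
          rw [hI3.1, add_comm, Nat.add_mul_div_right _ _ hq0, Nat.div_eq_of_lt hI3.2, zero_add]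
        have hmod : ζ.nat 28 0 0 = c / q ^ (r * k + j) % q := by
          rw [hI3.1, add_comm, Nat.add_mul_mod_self_right, Nat.mod_eq_of_lt hI3.2]
        simp only [e30, e31, hmod]
        simp only [Mem.setReg, upd, e2, hdiv]
        refine ⟨?_, fun k' hk' t ht => ?_, fun t ht => ?_⟩
        · simp [Nat.div_div_eq_div_mul, ← pow_succ, add_assoc]
        · have : k' ≠ k := by omega
          simp [this, hI'.2.1 k' hk' t ht]
        · by_cases h : t = j
          · simp [h]
          · simp [h, hI'.2.2 t (by omega)]
    · intro ξ _ _ hI'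
      rw [Mem.setReg_nat _ _ (by decide), Mem.setReg_nat _ _ (by decide), hI'.1]
      refine ⟨by rw [mul_add, mul_one], fun k' hk' t ht => ?_⟩
      rcases Nat.lt_succ_iff_lt_or_eq.1 hk' with hk' | rfl
      · exact hI'.2.1 k' hk' t ht
      · exact hI'.2.2 t ht
  · intro ν _ _ hI
    exact hI.2

/-! ### Contributing to the messages -/

/-- Find the neighbour which the row comes from. -/
def backProg : Prog :=
  .seq (setReg 32 (.lit 0)) <| .seq (setReg 30 (.lit 0)) <| .count 30 eDeg <|
    .ite (.veq (.get 0 (.lit 0) (eChild (reg 30))) (.get 0 (.lit 0) (.get 7 (.lit 0) eRow)))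
      (setReg 32 (reg 30)) .skip

/-- The contribution of the state in register `33`. -/
def factorProg : Prog :=
  .seq (.setR 2 (.lit 0) (.lit 0) (.lik eNode (reg 33) eSig)) <|
  .seq (setReg 30 (.lit 0)) <| .count 30 eDeg <|
    .ite (.veq (.get 0 (.lit 0) (eChild (reg 30))) (.get 0 (.lit 0) (.get 7 (.lit 0) eRow)))
      .skip <|
      .setR 2 (.lit 0) (.lit 0) <| .mul (.get 2 (.lit 0) (.lit 0)) <|
        .get 0 (eChild (reg 30)) (.get 15 (reg 30) (reg 33))

/-- The code of the history of the edge to the neighbour in register `32`, from the point of view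
of that neighbour. -/
def parentKeyProg : Prog :=
  .seq (setReg 21 (.add (reg 33) (.lit 1))) <| .seq (setReg 31 (.lit 0)) <|
  .seq (.count 31 eTime <| .seq (appendDigit (.get 2 (reg 32) (reg 31))) <|
    appendDigit (.get 16 (.lit 0) (reg 31))) <| setReg 34 (reg 21)

/-- Add the contribution to the cells in question. -/
def addProg : Prog :=
  .seq (setReg 35 (.lit 0)) <| .count 35 eQ <|
    .seq (setReg 21 (reg 34)) <| .seq (appendDigit (reg 35)) <|
    .seq (appendDigit (.get 16 (.lit 0) eTime)) <|
      .setR 0 eRow (reg 21) (.add (.get 0 eRow (reg 21)) (.get 2 (.lit 0) (.lit 0)))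

def scatterProg : Prog :=
  .seq backProg <| .seq (setReg 33 (.lit 0)) <| .count 33 eQ <|
    .seq factorProg <| .seq parentKeyProg addProg

/-- The state of the memory after a simulation, in a row for the edge from `i`, the `k₀`-th
neighbour of `v`, to `v`. -/
structure ScatterPre (μ : Mem V) (n : ℕ) (v : V) (x : Fin m) (h : Fin (A.deg v) → ℕ → Fin q)
    (r : ℕ) (k₀ : Fin (A.deg v)) : Prop extends SimPre A 2 μ n v x h r where
  keys : Keys A μ v x h r
  own : ∀ t ≤ r, μ.nat 16 0 t = A.own v x h t
  back : μ.node 0 0 (μ.nat 7 0 n) = A.nbr v k₀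
  child : ∀ k : Fin (A.deg v), μ.node 0 0 (μ.nat 5 0 n + k) = A.nbr v k

variable {A} in
theorem ScatterPre.congr {μ ν : Mem V} {n : ℕ} {v : V} {x : Fin m}
    {h : Fin (A.deg v) → ℕ → Fin q} {r : ℕ} {k₀ : Fin (A.deg v)} (hμ : ScatterPre A μ n v x h r k₀)
    (hn : ∀ a < 17, a ≠ 14 → ν.nat a = μ.nat a) (hv : ν.node = μ.node)
    (hr : ∀ k : Fin (A.deg v), RowOK A ν r (μ.nat 5 0 n + k) v (A.nbr v k)) :
    ScatterPre A ν n v x h r k₀ where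
  states := by rw [hn 0 (by omega) (by omega)]; exact hμ.states
  row := by rw [hn 11 (by omega) (by omega)]; exact hμ.row
  node := by rw [hv]; exact hμ.node
  deg := by rw [hn 6 (by omega) (by omega)]; exact hμ.deg
  signal := by rw [hn 12 (by omega) (by omega)]; exact hμ.signal
  time := by rw [hn 13 (by omega) (by omega)]; exact hμ.time
  hist := by rw [hn 2 (by omega) (by omega)]; exact hμ.hist
  rows := by rw [hn 5 (by omega) (by omega)]; exact hr
  keys := by unfold Keys; rw [hn 15 (by omega) (by omega)]; exact hμ.keys
  own := by rw [hn 16 (by omega) (by omega)]; exact hμ.own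
  back := by rw [hv, hn 7 (by omega) (by omega)]; exact hμ.back
  child := by rw [hv, hn 5 (by omega) (by omega)]; exact hμ.child

/-- Prescribing a vote `a` of the first agent at time `r` leaves the shorter code unchanged. This
identifies the cells written by `addProg` as cells of level `r + 1`. -/
theorem code_extend (s : ℕ) (τ σ : ℕ → Fin q) (r : ℕ) (a : Fin q) :
    code s (fun t => if t = r then a else τ t) σ (r + 1)
      = (code s τ σ r * q + a + 1) * q + σ r + 1 := by
  rw [code, if_pos rfl, code_congr (τ' := τ) (σ' := σ) (fun t ht => if_neg ht.ne) fun _ _ => rfl]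

section Scatter

variable {μ : Mem V} {n : ℕ} {v : V} {x : Fin m} {h : Fin (A.deg v) → ℕ → Fin q} {r : ℕ}
  {k₀ : Fin (A.deg v)}

theorem wp_backProg (hμ : ScatterPre A μ n v x h r k₀) (hB : A.deg v ≤ B) :
    wp A B backProg (fun ν => ν.nat 32 0 0 = k₀) μ := by
  simp only [backProg, wp, NExpr.eval]
  refine wp_count A B (N := A.deg v) (n₀ := 0) (fun k ν => (k₀ : ℕ) < k → ν.nat 32 0 0 = k₀)
    ?_ (by omega) hB rfl ?_ ?_ ?_ ?_
  · simp [upd]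
  · intro ν hF
    simp [NExpr.eval, hF.nat 6 rfl, hF.nat 11 rfl, upd, hμ.row, hμ.deg]
  · simp
  · intro k _ hk ν hF h30 hI
    have e11 : ν.nat 11 0 0 = n := by rw [hF.nat 11 rfl]; simpa [upd] using hμ.row
    have e5 : ν.nat 5 = μ.nat 5 := by rw [hF.nat 5 rfl]; simp [upd_of_ne]
    have e7 : ν.nat 7 = μ.nat 7 := by rw [hF.nat 7 rfl]; simp [upd_of_ne]
    have ev : ν.node = μ.node := hF.node rfl
    have hc := hμ.child ⟨k, hk⟩
    simp only at hc
    simp only [wp, NExpr.eval, Test.holds, VExpr.eval, e11, e5, e7, ev, h30, hc, hμ.back]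
    refine ⟨fun heq _ => ?_, fun hne hlt => ?_⟩
    · have : (⟨k, hk⟩ : Fin (A.deg v)) = k₀ := (A.nbr v).injective (Subtype.ext heq)
      rw [Mem.setReg_nat _ _ (by decide), ← this]
      simp [upd]
    · rw [Mem.setReg_nat _ _ (by decide)]
      refine hI (lt_of_le_of_ne (by omega) fun h' => hne ?_)
      congr 2
      exact Fin.ext h'.symm
  · intro ν _ _ hI
    exact hI k₀.2

open Classical in
/-- The probability of the signal `x` and the histories `h` given the state `s`, if the `k₀`-th
neighbour does what `h` says. -/
def factor (r : ℕ) (v : V) (x : Fin m) (h : Fin (A.deg v) → ℕ → Fin q) (k₀ : Fin (A.deg v))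
    (s : Fin q) : ℝ :=
  (A.lik v s x).toReal * ∏ k, if (A.nbr v k : V) = A.nbr v k₀ then 1 else
    A.msg r v (A.nbr v k) s (h k) (A.own v x h)

theorem wp_factorProg (hμ : ScatterPre A μ n v x h r k₀) (hB : A.deg v ≤ B) {s : Fin q}
    (hs : μ.nat 33 0 0 = s) :
    wp A B factorProg (fun ν => ν.real 2 0 0 = factor A r v x h k₀ s) μ := by
  classical
  simp only [factorProg, wp, NExpr.eval, RExpr.eval, VExpr.eval, hs, hμ.row, hμ.node, hμ.signal]
  set g : ℕ → ℝ := fun k => if hk : k < A.deg v then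
    if (A.nbr v ⟨k, hk⟩ : V) = A.nbr v k₀ then 1 else
    A.msg r v (A.nbr v ⟨k, hk⟩) s (h ⟨k, hk⟩) (A.own v x h) else 1 with hg
  refine wp_count A B (N := A.deg v) (n₀ := 0) (fun k ν => ν.real 2 0 0 =
      (A.lik v s x).toReal * ∏ k' ∈ Finset.range k, g k') ?_ (by omega) hB rfl ?_ ?_ ?_ ?_
  · simp [upd]
  · intro ν hF
    simp [NExpr.eval, hF.nat 6 rfl, hF.nat 11 rfl, upd, hμ.row, hμ.deg]
  · simp [upd]
  · intro k _ hk ν hF h30 hI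
    have e33 : ν.nat 33 0 0 = s := by rw [hF.nat 33 rfl]; simpa [upd] using hs
    have e11 : ν.nat 11 0 0 = n := by rw [hF.nat 11 rfl]; simpa [upd] using hμ.row
    have e15 : ν.nat 15 = μ.nat 15 := by rw [hF.nat 15 rfl]; simp [upd_of_ne]
    have e5 : ν.nat 5 = μ.nat 5 := by rw [hF.nat 5 rfl]; simp [upd_of_ne]
    have e7 : ν.nat 7 = μ.nat 7 := by rw [hF.nat 7 rfl]; simp [upd_of_ne]
    have e0 : ν.real 0 = μ.real 0 := by rw [hF.real 0 rfl]; simp [upd_of_ne]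
    have ev : ν.node = μ.node := hF.node rfl
    have hc := hμ.child ⟨k, hk⟩
    have hkey := hμ.keys ⟨k, hk⟩ s s.2
    have hrow := hμ.rows ⟨k, hk⟩ r le_rfl s (h ⟨k, hk⟩) (A.own v x h)
    simp only at hc hkey hrow
    simp only [wp, NExpr.eval, RExpr.eval, Test.holds, VExpr.eval, e11, e5, e7, e15, e0, ev, h30,
      e33, hc, hμ.back, hkey, hrow, hI, Finset.prod_range_succ, Mem.setReg_real, upd_same]
    refine ⟨fun heq => ?_, fun hne => ?_⟩
    · simp only [hg, dif_pos hk, if_pos heq, mul_one]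
    · simp only [hg, dif_pos hk, if_neg hne, and_self, if_true, mul_assoc]
  · intro ν hF _ hI
    rw [hI, Finset.prod_range, factor]
    simp only [hg, Fin.is_lt, dif_pos, Fin.eta]

/-- The roles are swapped relative to `Keys`: the row belongs to the edge into `v`, so the
neighbour's history is the prescribed sequence and the votes of `v` are the response. -/
theorem wp_parentKeyProg (hμ : ScatterPre A μ n v x h r k₀) (hqB : q ≤ B) (hrB : r ≤ B)
    {s : ℕ} (hs : μ.nat 33 0 0 = s) (h32 : μ.nat 32 0 0 = k₀) :
    wp A B parentKeyProg (fun ν => ν.nat 34 0 0 = code s (h k₀) (A.own v x h) r) μ := by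
  simp only [parentKeyProg, wp, NExpr.eval, hs]
  refine wp_count A B (N := r) (n₀ := 0) (fun j ν => ν.nat 21 0 0 =
    code s (h k₀) (A.own v x h) j) ?_ (by omega) hrB rfl ?_ ?_ ?_ ?_
  · simp [upd]
  · intro ν hF
    simp [NExpr.eval, hF.nat 13 rfl, upd, hμ.time]
  · simp [upd, code]
  · intro j _ hj ν hF h31 hI
    have f0 : ν.nat 0 0 0 = q := by rw [hF.nat 0 rfl]; simpa [upd] using hμ.states
    have f2 : ν.nat 2 k₀ j = h k₀ j := by rw [hF.nat 2 rfl]; simpa [upd] using hμ.hist k₀ j hj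
    have f16 : ν.nat 16 0 j = A.own v x h j := by
      rw [hF.nat 16 rfl]; simpa [upd] using hμ.own j hj.le
    have f32 : ν.nat 32 0 0 = k₀ := by rw [hF.nat 32 rfl]; simpa [upd] using h32
    simp only [wp]
    refine wp_call A B _ (wp_appendDigit A B (y := h k₀ j) f0 hqB ?_) fun ξ hξ hF' => ?_
    · intro ξ hξ
      simp [NExpr.eval, hξ 2 (by omega), hξ 31 (by omega), hξ 32 (by omega), h31, f2, f32]
    refine wp_call A B _ (wp_appendDigit A B (y := A.own v x h j) ?_ hqB ?_) fun ζ hζ _ => ?_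
    · rw [hF'.nat 0 rfl, f0]
    · intro ζ hζ
      simp [NExpr.eval, hζ 16 (by omega), hζ 31 (by omega), hF'.nat 16 rfl, hF'.nat 31 rfl, h31,
        f16]
    · rw [Mem.setReg_nat _ _ (by decide), hζ, hξ, hI, code]
  · intro ν _ _ hI
    simp [upd, hI]

/-- Votes of `v` up to time `r` cannot depend on the parent's vote at time `r`, so the contribution
is added for each of its `q` values `a`. -/
theorem wp_addProg (hμ : ScatterPre A μ n v x h r k₀) (hqB : q ≤ B) {K : ℕ}
    (h34 : μ.nat 34 0 0 = K) :
    wp A B addProg (fun ν => ∀ i j, ν.real 0 i j = μ.real 0 i j + ∑ a ∈ Finset.range q,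
      if i = n ∧ j = (K * q + a + 1) * q + A.own v x h r + 1 then μ.real 2 0 0 else 0) μ := by
  simp only [addProg, wp, NExpr.eval]
  refine wp_count A B (N := q) (n₀ := 0) (fun b ν => ∀ i j, ν.real 0 i j = μ.real 0 i j +
    ∑ a ∈ Finset.range b, if i = n ∧ j = (K * q + a + 1) * q + A.own v x h r + 1
      then μ.real 2 0 0 else 0) ?_ (by omega) hqB rfl ?_ ?_ ?_ ?_
  · simp [upd]
  · intro ν hF
    simp [NExpr.eval, hF.nat 0 rfl, upd, hμ.states]
  · simp
  · intro a _ ha ν hF h35 hI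
    have f0 : ν.nat 0 0 0 = q := by rw [hF.nat 0 rfl]; simpa [upd] using hμ.states
    have f11 : ν.nat 11 0 0 = n := by rw [hF.nat 11 rfl]; simpa [upd] using hμ.row
    have f13 : ν.nat 13 0 0 = r := by rw [hF.nat 13 rfl]; simpa [upd] using hμ.time
    have f34 : ν.nat 34 0 0 = K := by rw [hF.nat 34 rfl]; simpa [upd] using h34
    have f16 : ν.nat 16 0 r = A.own v x h r := by
      rw [hF.nat 16 rfl]; simpa [upd] using hμ.own r le_rfl
    have f2 : ν.real 2 = μ.real 2 := hF.real 2 rfl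
    simp only [wp, NExpr.eval, f34]
    refine wp_call A B _ (wp_appendDigit A B (y := a) (by simpa [upd] using f0) hqB ?_)
      fun ξ hξ hF' => ?_
    · intro ξ hξ
      simp [NExpr.eval, hξ 35 (by omega), upd, h35]
    refine wp_call A B _ (wp_appendDigit A B (y := A.own v x h r) ?_ hqB ?_) fun ζ hζ hF3 => ?_
    · rw [hF'.nat 0 rfl]; simpa [upd] using f0
    · intro ζ hζ
      simp [NExpr.eval, hζ 16 (by omega), hζ 13 (by omega), hF'.nat 16 rfl, hF'.nat 13 rfl, upd,
        f13, f16]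
    · have g11 : ζ.nat 11 0 0 = n := by
        rw [hF3.nat 11 rfl, hF'.nat 11 rfl]; simpa [upd] using f11
      have g21 : ζ.nat 21 0 0 = (K * q + a + 1) * q + A.own v x h r + 1 := by
        rw [hζ, hξ]; simp [upd]
      have g2 : ζ.real 2 = μ.real 2 := by rw [hF3.real 2 rfl, hF'.real 2 rfl]; exact f2
      have g0 : ζ.real 0 = ν.real 0 := by rw [hF3.real 0 rfl, hF'.real 0 rfl]
      intro i j
      simp only [RExpr.eval, NExpr.eval, g11, g21, g2, g0, Mem.setReg_real, upd_same,
        Finset.sum_range_succ]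
      split_ifs with hij
      · rw [hij.1, hij.2, hI]; ring
      · rw [hI]; ring
  · intro ν _ _ hI
    exact hI

/-- The cells of the level `r + 1` in the row `n` get contributions, the others do not change. -/
theorem wp_scatterProg (hμ : ScatterPre A μ n v x h r k₀) (hB : A.deg v ≤ B) (hqB : q ≤ B)
    (hrB : r ≤ B) :
    wp A B scatterProg (fun ν => ∀ i j, ν.real 0 i j = μ.real 0 i j +
      ∑ s : Fin q, ∑ a ∈ Finset.range q,
        if i = n ∧ j = (code s (h k₀) (A.own v x h) r * q + a + 1) * q + A.own v x h r + 1 then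
          factor A r v x h k₀ s else 0) μ := by
  simp only [scatterProg, wp]
  refine wp_call A B _ (wp_backProg A B hμ hB) fun ν₀ h32 hF₀ => ?_
  have hμ₀ : ScatterPre A ν₀ n v x h r k₀ := by
    refine hμ.congr (fun a ha _ => hF₀.nat a (by interval_cases a <;> rfl)) (hF₀.node rfl) ?_
    unfold RowOK
    rw [hF₀.real 0 rfl]
    exact hμ.rows
  set G : ℕ → ℕ → ℕ → ℝ := fun s i j => if hs : s < q then ∑ a ∈ Finset.range q,
        if i = n ∧ j = (code s (h k₀) (A.own v x h) r * q + a + 1) * q + A.own v x h r + 1 then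
          factor A r v x h k₀ ⟨s, hs⟩ else 0 else 0 with hG
  -- Everything written has level `r + 1`; the messages of level at most `r` read in later rounds
  -- stay intact.
  have hGz : ∀ s < q, ∀ r' ≤ r, ∀ s' : Fin q, ∀ (σ τ : ℕ → Fin q) (i : ℕ), G s i (code s' τ σ r') = 0 := by
    intro s hs r' hr' s' σ τ i
    simp only [hG, dif_pos hs]
    refine Finset.sum_eq_zero fun a ha => if_neg fun hc => ?_
    have h1 : code s' τ σ r' = code s (fun t => if t = r then ⟨a, Finset.mem_range.1 ha⟩ else h k₀ t)
        (A.own v x h) (r + 1) := by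
      rw [hc.2, code_extend]
    have := (code_inj s'.2 hs h1).1
    omega
  simp only [NExpr.eval]
  refine wp_count A B (N := q) (n₀ := 0) (fun s ν => ∀ i j, ν.real 0 i j = μ.real 0 i j +
    ∑ s' ∈ Finset.range s, G s' i j) ?_ (by omega) hqB rfl ?_ ?_ ?_ ?_
  · simp [upd]
  · intro ν hF
    simp [NExpr.eval, hF.nat 0 rfl, upd, hμ₀.states]
  · simp [hF₀.real 0 rfl]
  · intro s _ hs ν hF h33 hI
    have hν : ScatterPre A ν n v x h r k₀ := by
      refine hμ₀.congr (fun a ha h14 => ?_) (hF.node rfl) fun k r' hr' s' σ τ => ?_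
      · rw [hF.nat a (by interval_cases a <;> rfl)]
        exact upd_of_ne _ (by omega) _ _ _
      · rw [hI, Finset.sum_eq_zero, add_zero, hF₀.nat 5 rfl]
        · exact hμ.rows k r' hr' s' σ τ
        · intro s'' hs''
          rw [Finset.mem_range] at hs''
          exact hGz s'' (by omega) r' hr' s' σ τ _
    simp only [wp]
    refine wp_call A B _ (wp_factorProg A B hν hB (s := ⟨s, hs⟩) h33) fun ξ hξ hF' => ?_
    have hSξ : ScatterPre A ξ n v x h r k₀ := by
      refine hν.congr (fun a ha h14 => hF'.nat a (by interval_cases a <;> rfl)) (hF'.node rfl) ?_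
      unfold RowOK
      rw [hF'.real 0 rfl]
      exact hν.rows
    have g33 : ξ.nat 33 0 0 = s := by rw [hF'.nat 33 rfl, h33]
    have g32 : ξ.nat 32 0 0 = k₀ := by
      rw [hF'.nat 32 rfl, hF.nat 32 rfl]; simpa [upd] using h32
    refine wp_call A B _ (wp_parentKeyProg A B hSξ hqB hrB g33 g32) fun ζ hζ hF3 => ?_
    have hSζ : ScatterPre A ζ n v x h r k₀ := by
      refine hSξ.congr (fun a ha h14 => hF3.nat a (by interval_cases a <;> rfl)) (hF3.node rfl) ?_
      unfold RowOK
      rw [hF3.real 0 rfl]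
      exact hSξ.rows
    refine wp_call A B _ (wp_addProg A B hSζ hqB hζ) fun ρ hρ _ i j => ?_
    rw [Mem.setReg_real, hρ, hF3.real 0 rfl, hF3.real 2 rfl, hξ, hF'.real 0 rfl, hI,
      Finset.sum_range_succ, add_assoc]
    simp only [hG, dif_pos hs]
  · intro ν _ _ hI i j
    rw [hI, Finset.sum_range]
    simp only [hG, Fin.is_lt, dif_pos, Fin.eta]

open Classical in
-- By injectivity of the code, a given cell of level `r + 1` is hit by at most one pair of state and
-- parent's last vote, and it is hit exactly when the configuration is compatible. The compatibility
-- test of `msg_succ` is thus carried out by addressing alone.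
theorem sum_contribution (h : Fin (A.deg v) → ℕ → Fin q) (s : Fin q) (σ τ : ℕ → Fin q) :
    (∑ s' : Fin q, ∑ a ∈ Finset.range q, if code s τ σ (r + 1) =
        (code s' (h k₀) (A.own v x h) r * q + a + 1) * q + A.own v x h r + 1 then
          factor A r v x h k₀ s' else 0)
      = if A.Compat r (A.nbr v k₀) v σ τ x h then (A.lik v s x).toReal *
          ∏ k, if (A.nbr v k : V) = A.nbr v k₀ then 1 else A.msg r v (A.nbr v k) s (h k) σ
        else 0 := by
  have key : ∀ s' : Fin q, ∀ a : Fin q, code s τ σ (r + 1) =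
      (code s' (h k₀) (A.own v x h) r * q + a + 1) * q + A.own v x h r + 1 ↔
      s' = s ∧ a = τ r ∧ A.Compat r (A.nbr v k₀) v σ τ x h := by
    intro s' a
    have h1 : (code s' (h k₀) (A.own v x h) r * q + a + 1) * q + A.own v x h r + 1 =
        code s' (fun t => if t = r then a else h k₀ t) (A.own v x h) (r + 1) :=
      (code_extend _ _ _ _ _).symm
    rw [h1]
    constructor
    · intro heq
      obtain ⟨_, h2, h3, h4⟩ := code_inj s.2 s'.2 heq
      refine ⟨(Fin.ext h2).symm, by simpa using (h3 r (by omega)).symm, fun k hk t ht => ?_,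
        fun t ht => (h4 t ht).symm⟩
      have : k = k₀ := (A.nbr v).injective (Subtype.ext hk)
      rw [this]
      simpa [ht.ne] using (h3 t (by omega)).symm
    · rintro ⟨rfl, rfl, h3, h4⟩
      refine code_congr (fun t ht => ?_) fun t ht => (h4 t ht).symm
      split_ifs with h5
      · rw [h5]
      · exact (h3 k₀ rfl t (by omega)).symm
  simp only [Finset.sum_range, key]
  split_ifs with hc
  · rw [Finset.sum_eq_single s, Finset.sum_eq_single (τ r)]
    · rw [if_pos ⟨rfl, rfl, hc⟩, factor]
      congr 1
      refine Finset.prod_congr rfl fun k _ => ?_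
      split_ifs
      · rfl
      · exact A.msg_congr (fun _ _ => rfl) fun t ht => hc.2 t (by omega)
    · exact fun a _ ha => if_neg fun h => ha h.2.1
    · simp
    · exact fun s' _ hs' => Finset.sum_eq_zero fun a _ => if_neg fun h => hs' h.1
    · simp
  · exact Finset.sum_eq_zero fun s' _ => Finset.sum_eq_zero fun a _ => if_neg fun h => hc h.2.2

end Scatter

/-! ### Computing the messages of the next level in one row -/

/-- The cells of the level `r + 1` in the row `n` are increased by `F`. -/
structure Contrib (μ ν : Mem V) (n r : ℕ)
    (F : Fin q → (ℕ → Fin q) → (ℕ → Fin q) → ℝ) : Prop where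
  add : ∀ (s : Fin q) (σ τ : ℕ → Fin q), ν.real 0 n (code s τ σ (r + 1)) = μ.real 0 n (code s τ σ (r + 1)) + F s σ τ
  rest : ∀ i j, (i = n → ∀ (s : Fin q) (σ τ : ℕ → Fin q), j ≠ code s τ σ (r + 1)) →
    ν.real 0 i j = μ.real 0 i j

theorem Contrib.refl {μ ν : Mem V} (h : ν.real 0 = μ.real 0) (n r : ℕ) :
    Contrib (q := q) μ ν n r fun _ _ _ => 0 :=
  ⟨fun s σ τ => by rw [h, add_zero], fun i j _ => by rw [h]⟩

theorem Contrib.trans {μ ν ξ : Mem V} {n r : ℕ} {F F' F'' : Fin q → (ℕ → Fin q) → (ℕ → Fin q) → ℝ}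
    (h : Contrib μ ν n r F) (h' : Contrib ν ξ n r F') (hF : ∀ s σ τ, F s σ τ + F' s σ τ = F'' s σ τ) :
    Contrib μ ξ n r F'' :=
  ⟨fun s σ τ => by rw [h'.add, h.add, add_assoc, hF],
    fun i j hij => (h'.rest i j hij).trans (h.rest i j hij)⟩

variable {A} in
-- Writes at level `r + 1` cannot spoil levels up to `r`, in any row.
theorem Contrib.rowOK {μ ν : Mem V} {n r : ℕ} {F : Fin q → (ℕ → Fin q) → (ℕ → Fin q) → ℝ}
    (h : Contrib μ ν n r F) {i : ℕ} {w w' : V} (hi : RowOK A μ r i w w') : RowOK A ν r i w w' := by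
  intro r' hr' s σ τ
  rw [h.rest, hi r' hr' s σ τ]
  intro _ s' σ' τ' heq
  have := (code_inj s.2 s'.2 heq).1
  omega

open Classical in
/-- What the signal `x` and the histories `h` contribute to the message. -/
def contribution (r : ℕ) (v : V) (k₀ : Fin (A.deg v)) (s : Fin q) (σ τ : ℕ → Fin q) (x : Fin m)
    (h : Fin (A.deg v) → ℕ → Fin q) : ℝ :=
  if A.Compat r (A.nbr v k₀) v σ τ x h then (A.lik v s x).toReal *
    ∏ k, if (A.nbr v k : V) = A.nbr v k₀ then 1 else A.msg r v (A.nbr v k) s (h k) σ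
  else 0

theorem contribution_congr {r : ℕ} {v : V} {k₀ : Fin (A.deg v)} {s : Fin q} {σ τ : ℕ → Fin q}
    {x : Fin m} {h h' : Fin (A.deg v) → ℕ → Fin q} (H : ∀ k, ∀ t < r, h k t = h' k t) :
    contribution A r v k₀ s σ τ x h = contribution A r v k₀ s σ τ x h' := by
  have h1 : A.Compat r (A.nbr v k₀) v σ τ x h ↔ A.Compat r (A.nbr v k₀) v σ τ x h' := by
    refine and_congr (forall₂_congr fun k _ => forall₂_congr fun t ht => by rw [H k t ht])
      (forall₂_congr fun t ht => ?_)
    rw [A.own_congr fun k t' ht' => H k t' (by omega)]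
  classical
  refine if_congr h1 (congrArg _ (Finset.prod_congr rfl fun k _ => ?_)) rfl
  split_ifs
  · rfl
  · exact A.msg_congr (H k) fun _ _ => rfl

/-- The part of `ScatterPre` that does not refer to a signal or to histories. -/
structure RowPre (μ : Mem V) (n : ℕ) (v : V) (r : ℕ) (k₀ : Fin (A.deg v)) : Prop where
  states : μ.nat 0 0 0 = q
  row : μ.nat 11 0 0 = n
  node : μ.node 0 0 n = v
  deg : μ.nat 6 0 n = A.deg v
  time : μ.nat 13 0 0 = r
  rows : ∀ k : Fin (A.deg v), RowOK A μ r (μ.nat 5 0 n + k) v (A.nbr v k)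
  back : μ.node 0 0 (μ.nat 7 0 n) = A.nbr v k₀
  child : ∀ k : Fin (A.deg v), μ.node 0 0 (μ.nat 5 0 n + k) = A.nbr v k

variable {A} in
theorem RowPre.congr {μ ν : Mem V} {n : ℕ} {v : V} {r : ℕ} {k₀ : Fin (A.deg v)}
    (hμ : RowPre A μ n v r k₀) (hn : ∀ a ∈ [0, 5, 6, 7, 11, 13], ν.nat a = μ.nat a)
    (hv : ν.node = μ.node)
    (hr : ∀ k : Fin (A.deg v), RowOK A ν r (μ.nat 5 0 n + k) v (A.nbr v k)) :
    RowPre A ν n v r k₀ where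
  states := by rw [hn 0 (by simp)]; exact hμ.states
  row := by rw [hn 11 (by simp)]; exact hμ.row
  node := by rw [hv]; exact hμ.node
  deg := by rw [hn 6 (by simp)]; exact hμ.deg
  time := by rw [hn 13 (by simp)]; exact hμ.time
  rows := by rw [hn 5 (by simp)]; exact hr
  back := by rw [hv, hn 7 (by simp)]; exact hμ.back
  child := by rw [hv, hn 5 (by simp)]; exact hμ.child

/-- Sum over all histories. -/
def configProg : Prog :=
  .seq powProg <| .seq (setReg 24 (.lit 0)) <| .count 24 (reg 25) <|
    .seq decodeProg <| .seq (simProg 2) scatterProg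

/-- The number of signals. -/
abbrev eM : NExpr := .get 0 (.lit 0) (.lit 1)

/-- Sum over all signals and histories. -/
def rowProg : Prog := .seq (setReg 12 (.lit 0)) <| .count 12 eM configProg

section Row

variable {μ : Mem V} {n : ℕ} {v : V} {r : ℕ} {k₀ : Fin (A.deg v)}

theorem wp_configProg [NeZero q] (hμ : RowPre A μ n v r k₀) {x : Fin m} (hx : μ.nat 12 0 0 = x)
    (hB : A.deg v ≤ B) (hrB : r ≤ B) (hqB : A.deg v * r + q + 1 ≤ B)
    (hpB : q ^ (A.deg v * r) ≤ B) :
    wp A B configProg (fun ν => Contrib μ ν n r fun s σ τ =>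
      ∑ h : Fin (A.deg v) → Fin r → Fin q,
        contribution A r v k₀ s σ τ x fun k => Network.ext (h k)) μ := by
  have hqB' : q ≤ B := by omega
  simp only [configProg, wp, NExpr.eval]
  refine wp_call A B _ (wp_powProg A B hμ.states (by rw [hμ.row, hμ.deg]) hμ.time hqB' hB hrB)
    fun ν₀ h25 hF₀ => ?_
  refine wp_count A B (N := q ^ (A.deg v * r)) (n₀ := 0) (fun c ν => Contrib μ ν n r fun s σ τ =>
      ∑ c' ∈ Finset.range c, contribution A r v k₀ s σ τ x fun k => digits r c' k)
    ?_ (by omega) hpB rfl ?_ ?_ ?_ ?_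
  · simp [upd]
  · intro ν hF
    simpa [NExpr.eval, hF.nat 25 rfl, upd] using h25
  · simp only [Finset.sum_range_zero]
    refine Contrib.refl ?_ n r
    exact hF₀.real 0 rfl
  · intro c _ hc ν hF h24 hI
    have en : ∀ a ∈ [0, 5, 6, 7, 11, 13, 12], ν.nat a = μ.nat a := by
      intro a ha
      simp only [List.mem_cons, List.not_mem_nil, or_false] at ha
      rw [hF.nat a (by rcases ha with rfl | rfl | rfl | rfl | rfl | rfl | rfl <;> rfl)]
      refine (upd_of_ne _ (by omega) _ _ _).trans (hF₀.nat a ?_)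
      rcases ha with rfl | rfl | rfl | rfl | rfl | rfl | rfl <;> rfl
    have ev : ν.node = μ.node := (hF.node rfl).trans (hF₀.node rfl)
    have hν : RowPre A ν n v r k₀ := by
      refine hμ.congr (fun a ha => en a ?_) ev fun k => hI.rowOK (hμ.rows k)
      simp only [List.mem_cons, List.not_mem_nil, or_false] at ha ⊢
      omega
    simp only [wp]
    refine wp_call A B _ (wp_decodeProg A B hν.states (NeZero.pos q) (by rw [hν.row, hν.deg])
      hν.time h24 hB hrB (by omega)) fun ξ hξ hF' => ?_
    have hSξ : SimPre A 2 ξ n v x (fun k => digits r c k) r := by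
      constructor
      · rw [hF'.nat 0 rfl, hν.states]
      · rw [hF'.nat 11 rfl, hν.row]
      · rw [hF'.node rfl, hν.node]
      · rw [hF'.nat 6 rfl, hν.deg]
      · rw [hF'.nat 12 rfl, en 12 (by simp), hx]
      · rw [hF'.nat 13 rfl, hν.time]
      · exact fun k t ht => hξ k k.2 t ht
      · unfold RowOK
        rw [hF'.real 0 rfl, hF'.nat 5 rfl]
        exact hν.rows
    refine wp_call A B _ (wp_simProg A B hSξ (by decide) hB hrB hqB) fun ζ hζ hF3 => ?_
    have hSζ : ScatterPre A ζ n v x (fun k => digits r c k) r k₀ := by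
      refine ⟨hSξ.congr (by decide) (fun a ha => hF3.nat a (by interval_cases a <;> rfl))
        (hF3.real 0 rfl) (hF3.node rfl), hζ.2, hζ.1, ?_, ?_⟩
      · rw [hF3.node rfl, hF'.node rfl, hF3.nat 7 rfl, hF'.nat 7 rfl]
        exact hν.back
      · rw [hF3.node rfl, hF'.node rfl, hF3.nat 5 rfl, hF'.nat 5 rfl]
        exact hν.child
    refine wp_call A B _ (wp_scatterProg A B hSζ hB hqB' hrB) fun ρ hρ _ => ?_
    have hbase : ζ.real 0 = ν.real 0 := by rw [hF3.real 0 rfl, hF'.real 0 rfl]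
    have hstep : Contrib ν (ρ.setReg 24 (c + 1)) n r fun s σ τ =>
        contribution A r v k₀ s σ τ x fun k => digits r c k := by
      refine ⟨fun s σ τ => ?_, fun i j hij => ?_⟩
      · rw [Mem.setReg_real, hρ, hbase, contribution, ← sum_contribution]
        simp only [true_and]
      · rw [Mem.setReg_real, hρ, hbase, Finset.sum_eq_zero, add_zero]
        refine fun s _ => Finset.sum_eq_zero fun a ha => if_neg fun hc => ?_
        -- A written cell is the code of these two histories of length `r + 1`, contradicting that
        -- the cell is outside that level.
        refine hij hc.1 s (A.own v x fun k => digits r c k) (fun t => if t = r then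
          ⟨a, Finset.mem_range.1 ha⟩ else digits r c k₀ t) ?_
        rw [code_extend]
        exact hc.2
    exact hI.trans hstep fun s σ τ => (Finset.sum_range_succ _ _).symm
  · intro ν _ _ hI
    have : ∀ s σ τ, (∑ c ∈ Finset.range (q ^ (A.deg v * r)),
        contribution A r v k₀ s σ τ x fun k => digits r c k) =
        ∑ h : Fin (A.deg v) → Fin r → Fin q,
          contribution A r v k₀ s σ τ x fun k => Network.ext (h k) := fun s σ τ =>
      sum_digits r (A.deg v) (contribution A r v k₀ s σ τ x) fun h h' H => contribution_congr A H
    simpa only [this] using hI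

/-- Summing the contributions over all signals and histories gives the right side of `msg_succ`. -/
theorem wp_rowProg [NeZero q] (hμ : RowPre A μ n v r k₀) (hm : μ.nat 0 0 1 = m) (hmB : m ≤ B)
    (hB : A.deg v ≤ B) (hrB : r ≤ B) (hqB : A.deg v * r + q + 1 ≤ B)
    (hpB : q ^ (A.deg v * r) ≤ B) :
    wp A B rowProg (fun ν => Contrib μ ν n r fun s σ τ =>
      A.msg (r + 1) (A.nbr v k₀) v s σ τ) μ := by
  simp only [rowProg, wp, NExpr.eval]
  set g : ℕ → Fin q → (ℕ → Fin q) → (ℕ → Fin q) → ℝ := fun x s σ τ => if hx : x < m then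
    ∑ h : Fin (A.deg v) → Fin r → Fin q,
      contribution A r v k₀ s σ τ ⟨x, hx⟩ fun k => Network.ext (h k) else 0 with hg
  refine wp_count A B (N := m) (n₀ := 0) (fun x ν => Contrib μ ν n r fun s σ τ =>
      ∑ x' ∈ Finset.range x, g x' s σ τ) ?_ (by omega) hmB rfl ?_ ?_ ?_ ?_
  · simp [upd]
  · intro ν hF
    simpa [NExpr.eval, hF.nat 0 rfl, upd] using hm
  · simp only [Finset.sum_range_zero]
    refine Contrib.refl ?_ n r
    rfl
  · intro x _ hx ν hF h12 hI
    have en : ∀ a ∈ [0, 5, 6, 7, 11, 13], ν.nat a = μ.nat a := by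
      intro a ha
      simp only [List.mem_cons, List.not_mem_nil, or_false] at ha
      rw [hF.nat a (by rcases ha with rfl | rfl | rfl | rfl | rfl | rfl <;> rfl)]
      exact upd_of_ne _ (by omega) _ _ _
    have hν : RowPre A ν n v r k₀ :=
      hμ.congr en (hF.node rfl) fun k => hI.rowOK (hμ.rows k)
    refine wp_call A B _ (wp_configProg A B hν (x := ⟨x, hx⟩) h12 hB hrB hqB hpB) fun ξ hξ _ => ?_
    refine hI.trans (F' := g x) ⟨fun s σ τ => ?_, hξ.rest⟩
      fun s σ τ => (Finset.sum_range_succ _ _).symm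
    rw [Mem.setReg_real, hξ.add]
    simp only [hg, dif_pos hx]
  · intro ν _ _ hI
    have : ∀ s σ τ, (∑ x ∈ Finset.range m, g x s σ τ) = A.msg (r + 1) (A.nbr v k₀) v s σ τ := by
      intro s σ τ
      rw [Finset.sum_range, A.msg_succ]
      simp only [hg, Fin.is_lt, dif_pos, Fin.eta, contribution]
    simpa only [this] using hI

end Row

/-! ### The table of messages -/

/-- The messages up to the level `r` are correct in the rows of the walks of length at most
`T - r`, and there is nothing in the table for higher levels. -/
structure TableOK (μ : Mem V) (T r : ℕ) : Prop where
  rows : ∀ n, 1 ≤ n → n < μ.nat 8 0 (T - r) →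
    RowOK A μ r n (μ.node 0 0 (μ.nat 7 0 n)) (μ.node 0 0 n)
  zero : ∀ i, ∀ r' > r, ∀ (s : Fin q) (σ τ : ℕ → Fin q), μ.real 0 i (code s τ σ r') = 0

variable {A} in
theorem Ball.congr {μ ν : Mem V} {v : V} {d T : ℕ} (h : Ball A μ v d T)
    (hn : ∀ a ∈ [5, 6, 7, 8], ν.nat a = μ.nat a) (hv : ν.node = μ.node) : Ball A ν v d T where
  root := by rw [hv]; exact h.root
  zero := by rw [hn 8 (by simp)]; exact h.zero
  mono := by rw [hn 8 (by simp)]; exact h.mono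
  size := by rw [hn 8 (by simp)]; exact h.size
  deg := by rw [hv, hn 6 (by simp), hn 8 (by simp)]; exact h.deg
  child := by rw [hv, hn 5 (by simp), hn 7 (by simp), hn 8 (by simp)]; exact h.child
  first := by rw [hn 5 (by simp), hn 8 (by simp)]; exact h.first
  last := by rw [hn 5 (by simp), hn 6 (by simp), hn 8 (by simp)]; exact h.last
  parent := by rw [hv, hn 7 (by simp), hn 8 (by simp)]; exact h.parent

variable {A} in
theorem Ball.mono' {μ : Mem V} {v : V} {d T : ℕ} (h : Ball A μ v d T) {ℓ ℓ' : ℕ} (h1 : ℓ ≤ ℓ')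
    (h2 : ℓ' ≤ T) : μ.nat 8 0 ℓ ≤ μ.nat 8 0 ℓ' := by
  induction ℓ', h1 using Nat.le_induction with
  | base => exact le_rfl
  | succ ℓ' _ ih => exact (ih (by omega)).trans (h.mono ℓ' (by omega))

/-- Bounds which suffice for all loops and queries. -/
structure Bounds (q m d T B : ℕ) : Prop where
  two : 2 ≤ B
  states : q ≤ B
  signals : m ≤ B
  deg : d ≤ B
  time : T + 1 ≤ B
  query : d * T + q + 1 ≤ B
  walks : (d + 1) ^ (T + 1) ≤ B
  histories : q ^ (d * T) ≤ B

/-- Compute the messages of the next level. -/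
def stageProg : Prog :=
  .seq (setReg 11 (.lit 1)) <| .count 11 (.get 8 (.lit 0) (.sub eT eTime)) rowProg

variable {A B} in
-- A message of level `r + 1` in a row needs level `r` in the rows of its children, one step farther
-- out; hence the valid ball shrinks by one. The loop starts at row `1`, as the root has no incoming
-- edge.
theorem wp_stageProg [NeZero q] {μ : Mem V} {v : V} {d T r : ℕ} (hd : ∀ v, A.deg v ≤ d)
    (hB : Bounds q m d T B) (hball : Ball A μ v d (T + 1)) (hq : μ.nat 0 0 0 = q)
    (hm : μ.nat 0 0 1 = m) (hT : μ.nat 0 0 2 = T) (hr : μ.nat 13 0 0 = r) (hrT : r < T)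
    (hμ : TableOK A μ (T + 1) r) :
    wp A B stageProg (fun ν => TableOK A ν (T + 1) (r + 1)) μ := by
  simp only [stageProg, wp, NExpr.eval]
  have h1 : 1 ≤ μ.nat 8 0 (T - r) := hball.zero ▸ hball.mono' (Nat.zero_le _) (by omega)
  have hle : μ.nat 8 0 (T - r) ≤ μ.nat 8 0 (T + 1 - r) := hball.mono' (by omega) (by omega)
  have hle' : μ.nat 8 0 (T - r) ≤ μ.nat 8 0 (T + 1) := hball.mono' (by omega) (by omega)
  -- Besides the finished rows, the invariant keeps the cells of level `r + 1` in pending rows at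
  -- `0`, since rows are filled by increments.
  refine wp_count A B (N := μ.nat 8 0 (T - r)) (n₀ := 1) (fun n ν =>
    (∀ i, 1 ≤ i → i < μ.nat 8 0 (T + 1 - r) →
      RowOK A ν r i (μ.node 0 0 (μ.nat 7 0 i)) (μ.node 0 0 i)) ∧
    (∀ i, 1 ≤ i → i < n → RowOK A ν (r + 1) i (μ.node 0 0 (μ.nat 7 0 i)) (μ.node 0 0 i)) ∧
    (∀ i, n ≤ i → ∀ (s : Fin q) (σ τ : ℕ → Fin q), ν.real 0 i (code s τ σ (r + 1)) = 0) ∧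
    ∀ i, ∀ r' > r + 1, ∀ (s : Fin q) (σ τ : ℕ → Fin q), ν.real 0 i (code s τ σ r') = 0)
    ?_ h1 ?_ rfl ?_ ?_ ?_ ?_
  · simp [upd]
  · refine hle'.trans ((hball.size _ le_rfl).trans hB.walks)
  · intro ν hF
    simp [NExpr.eval, hF.nat 8 rfl, hF.nat 0 rfl, hF.nat 13 rfl, upd, hT, hr]
  · refine ⟨hμ.rows, fun i h1 h2 => by omega, fun i _ => hμ.zero i _ (by omega),
      fun i r' hr' => hμ.zero i _ (by omega)⟩
  · intro n h1n hn ν hF h11 hI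
    have en : ∀ a ∈ [0, 5, 6, 7, 8, 13], ν.nat a = μ.nat a := by
      intro a ha
      simp only [List.mem_cons, List.not_mem_nil, or_false] at ha
      rw [hF.nat a (by rcases ha with rfl | rfl | rfl | rfl | rfl | rfl <;> rfl)]
      exact upd_of_ne _ (by omega) _ _ _
    have ev : ν.node = μ.node := hF.node rfl
    obtain ⟨ℓ, hℓ⟩ : ∃ ℓ, ℓ = T - r := ⟨_, rfl⟩
    rw [← hℓ] at hn
    have hadj := hball.parent n h1n (by rw [hℓ] at hn; omega)
    set w := μ.node 0 0 n with hw
    set k₀ := (A.nbr w).symm ⟨μ.node 0 0 (μ.nat 7 0 n), hadj.symm⟩ with hk₀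
    have hk₀' : (A.nbr w k₀ : V) = μ.node 0 0 (μ.nat 7 0 n) := by
      rw [hk₀, Equiv.apply_symm_apply]
    have hchild := hball.child ℓ (by omega) n hn
    have hdeg : μ.nat 6 0 n = A.deg w := hball.deg ℓ (by omega) n hn
    have hlast := hball.last ℓ (by omega) n hn
    have hfirst := hball.first ℓ (by omega) n hn
    have hrow : RowPre A ν n w r k₀ := by
      refine ⟨by rw [en 0 (by simp), hq], h11, by rw [ev], by rw [en 6 (by simp), hdeg],
        by rw [en 13 (by simp), hr], fun k => ?_, ?_, fun k => ?_⟩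
      · have h2 := hI.1 (μ.nat 5 0 n + k) (by omega) (by
          have h3 := k.2
          rw [show T + 1 - r = ℓ + 1 by omega]
          rw [hdeg] at hlast
          omega)
        rw [(hchild k).1, (hchild k).2] at h2
        rw [en 5 (by simp)]
        exact h2
      · rw [ev, en 7 (by simp), hk₀']
      · rw [ev, en 5 (by simp)]
        exact (hchild k).1
    have hdw := hd w
    have hdr : A.deg w * r ≤ d * T := Nat.mul_le_mul hdw hrT.le
    have hq0 : 0 < q := NeZero.pos q
    refine wp_call A B _ (wp_rowProg A B hrow (by rw [en 0 (by simp), hm]) hB.signals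
      (hdw.trans hB.deg) (by have := hB.time; omega) (by have := hB.query; omega)
      ((Nat.pow_le_pow_right hq0 hdr).trans hB.histories)) fun ξ hξ _ => ⟨?_, ?_, ?_, ?_⟩
    · intro i h2 h3
      exact hξ.rowOK (hI.1 i h2 h3)
    · intro i h2 h3
      rcases Nat.lt_succ_iff_lt_or_eq.1 h3 with h3 | rfl
      · intro r' hr' s σ τ
        rw [Mem.setReg_real, hξ.rest _ _ (fun h => by omega)]
        exact hI.2.1 i h2 h3 r' hr' s σ τ
      · intro r' hr' s σ τ
        rcases Nat.le_succ_iff.1 hr' with hr' | rfl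
        · exact hξ.rowOK (hI.1 i h2 (by rw [hℓ] at hn; omega)) r' hr' s σ τ
        · rw [Mem.setReg_real, hξ.add, hI.2.2.1 i le_rfl, zero_add, hk₀']
    · intro i hi s σ τ
      rw [Mem.setReg_real, hξ.rest _ _ (fun h => by omega), hI.2.2.1 i (by omega)]
    · intro i r' hr' s σ τ
      rw [Mem.setReg_real, hξ.rest, hI.2.2.2 i r' hr']
      intro _ s' σ' τ' heq
      have := (code_inj s.2 s'.2 heq).1
      omega
  · intro ν hF _ hI
    have e7 : ν.nat 7 = μ.nat 7 := by rw [hF.nat 7 rfl]; simp [upd_of_ne]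
    have e8 : ν.nat 8 = μ.nat 8 := by rw [hF.nat 8 rfl]; simp [upd_of_ne]
    have ev : ν.node = μ.node := hF.node rfl
    constructor
    · intro n h2 h3
      rw [e8, show T + 1 - (r + 1) = T - r by omega] at h3
      rw [e7, ev]
      exact hI.2.1 n h2 h3
    · exact hI.2.2.2

/-- Fill in the messages of level `0`. -/
def initProg : Prog :=
  .seq (setReg 11 (.lit 0)) <| .count 11 (.get 8 (.lit 0) (.add eT (.lit 1))) <|
    .seq (setReg 33 (.lit 0)) <| .count 33 eQ <|
      .setR 0 (reg 11) (.add (reg 33) (.lit 1)) .one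

variable {A B} in
-- Empty histories have probability `1`; their codes are `1, …, q`, and all cells beyond stay `0`
-- for the accumulations to come.
theorem wp_initProg {μ : Mem V} {v : V} {d T : ℕ} (hB : Bounds q m d T B)
    (hball : Ball A μ v d (T + 1)) (hq : μ.nat 0 0 0 = q) (hT : μ.nat 0 0 2 = T)
    (hM : ∀ i j, μ.real 0 i j = 0) :
    wp A B initProg (fun ν => TableOK A ν (T + 1) 0) μ := by
  simp only [initProg, wp, NExpr.eval]
  refine wp_count A B (N := μ.nat 8 0 (T + 1)) (n₀ := 0) (fun n ν =>
    (∀ i < n, ∀ s < q, ν.real 0 i (s + 1) = 1) ∧ ∀ i j, q < j → ν.real 0 i j = 0)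
    ?_ (by omega) ((hball.size _ le_rfl).trans hB.walks) rfl ?_ ?_ ?_ ?_
  · simp [upd]
  · intro ν hF
    simp [NExpr.eval, hF.nat 8 rfl, hF.nat 0 rfl, upd, hT]
  · simp [hM]
  · intro n _ hn ν hF h11 hI
    have e0 : ν.nat 0 0 0 = q := by rw [hF.nat 0 rfl]; simpa [upd] using hq
    simp only [wp, NExpr.eval]
    refine wp_count A B (N := q) (n₀ := 0) (fun j ξ =>
      (∀ i < n, ∀ s < q, ξ.real 0 i (s + 1) = 1) ∧ (∀ s < j, ξ.real 0 n (s + 1) = 1) ∧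
      ∀ i j, q < j → ξ.real 0 i j = 0) ?_ (by omega) hB.states rfl ?_ ?_ ?_ ?_
    · simp [upd]
    · intro ξ hF'
      simp [NExpr.eval, hF'.nat 0 rfl, upd, e0]
    · exact ⟨hI.1, by simp, hI.2⟩
    · intro j _ hj ξ hF' h33 hI'
      have e11 : ξ.nat 11 0 0 = n := by rw [hF'.nat 11 rfl]; simpa [upd] using h11
      simp only [wp, NExpr.eval, RExpr.eval, e11, h33, Mem.setReg_real, upd_same]
      refine ⟨fun i hi s hs => ?_, fun s hs => ?_, fun i j' hj' => ?_⟩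
      · rw [if_neg (by omega), hI'.1 i hi s hs]
      · by_cases h : s = j
        · simp [h]
        · rw [if_neg (by omega), hI'.2.1 s (by omega)]
      · rw [if_neg (by omega), hI'.2.2 i j' hj']
    · intro ξ _ _ hI'
      refine ⟨fun i hi s hs => ?_, hI'.2.2⟩
      rcases Nat.lt_succ_iff_lt_or_eq.1 hi with hi | rfl
      · exact hI'.1 i hi s hs
      · exact hI'.2.1 s hs
  · intro ν hF _ hI
    have e8 : ν.nat 8 = μ.nat 8 := by rw [hF.nat 8 rfl]; simp [upd_of_ne]
    constructor
    · intro n _ h3 r hr s σ τ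
      obtain rfl : r = 0 := by omega
      rw [e8] at h3
      rw [A.msg_zero]
      exact hI.1 n h3 s s.2
    · intro i r' hr' s σ τ
      obtain ⟨r, rfl⟩ := Nat.exists_eq_add_of_lt hr'
      exact hI.2 i _ (lt_code_succ _ _ _ _)

/-- Compute all messages which are needed. -/
def tableProg : Prog :=
  .seq initProg <| .seq (setReg 13 (.lit 0)) <| .count 13 eT stageProg

variable {A B} in
theorem wp_tableProg [NeZero q] {μ : Mem V} {v : V} {d T : ℕ} (hd : ∀ v, A.deg v ≤ d)
    (hB : Bounds q m d T B) (hball : Ball A μ v d (T + 1)) (hq : μ.nat 0 0 0 = q)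
    (hm : μ.nat 0 0 1 = m) (hT : μ.nat 0 0 2 = T) (hM : ∀ i j, μ.real 0 i j = 0) :
    wp A B tableProg (fun ν => TableOK A ν (T + 1) T) μ := by
  simp only [tableProg, wp, NExpr.eval]
  refine wp_call A B _ (wp_initProg hB hball hq hT hM) fun ν₀ hν₀ hF₀ => ?_
  refine wp_count A B (N := T) (n₀ := 0) (fun r ν => TableOK A ν (T + 1) r)
    ?_ (by omega) (by have := hB.time; omega) rfl ?_ ?_ ?_ ?_
  · simp [upd]
  · intro ν hF
    simp [NExpr.eval, hF.nat 0 rfl, hF₀.nat 0 rfl, upd, hT]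
  · exact ⟨by simpa [upd, RowOK] using hν₀.rows, hν₀.zero⟩
  · intro r _ hr ν hF h13 hI
    have en : ∀ a ∈ [0, 5, 6, 7, 8], ν.nat a = μ.nat a := by
      intro a ha
      simp only [List.mem_cons, List.not_mem_nil, or_false] at ha
      rw [hF.nat a (by rcases ha with rfl | rfl | rfl | rfl | rfl <;> rfl)]
      refine (upd_of_ne _ (by omega) _ _ _).trans (hF₀.nat a ?_)
      rcases ha with rfl | rfl | rfl | rfl | rfl <;> rfl
    have hball' : Ball A ν v d (T + 1) := by
      refine hball.congr (fun a ha => en a ?_) ((hF.node rfl).trans (hF₀.node rfl))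
      simp only [List.mem_cons, List.not_mem_nil, or_false] at ha ⊢
      omega
    have e0 := en 0 (by simp)
    refine wp_call A B _ (wp_stageProg hd hB hball' (by rw [e0, hq]) (by rw [e0, hm])
      (by rw [e0, hT]) h13 hr hI) fun ξ hξ _ => ⟨?_, hξ.zero⟩
    unfold RowOK
    rw [Mem.setReg_nat _ _ (by decide), Mem.setReg_nat _ _ (by decide)]
    exact hξ.rows
  · intro ν _ _ hI
    exact hI

/-! ### The program -/

/-- The program which computes the vote. -/
def mainProg : Prog :=
  .seq treeProg <| .seq tableProg <|
  .seq (setReg 11 (.lit 0)) <| .seq (setReg 12 (.get 0 (.lit 0) (.lit 3))) <|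
  .seq (setReg 13 eT) <| .seq (simProg 1) <| setReg 0 (.get 16 (.lit 0) eTime)

variable {A B} in
-- With the messages of level `T` around the root, her vote is found by the same simulation, run on
-- her actual signal and the observed votes instead of hypothetical ones.
theorem wp_mainProg (v : V) {d T : ℕ} (hd : ∀ v, A.deg v ≤ d) (hB : Bounds q m d T B)
    (ω : Outcome q m V) :
    wp A B mainProg (fun ν => ν.nat 0 0 0 = A.vote T v ω) (input A v T ω) := by
  have : NeZero q := ⟨by have := ω.1.2; omega⟩
  set μ := input A v T ω with hμ
  have a0 : μ.nat 0 0 0 = q := by simp [hμ, input]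
  have a1 : μ.nat 0 0 1 = m := by simp [hμ, input]
  have a2 : μ.nat 0 0 2 = T := by simp [hμ, input]
  have a3 : μ.nat 0 0 3 = ω.2 v := by simp [hμ, input]
  simp only [mainProg, wp]
  refine wp_call A B _ (wp_treeProg A B (v := v) (d := d) (T := T + 1) (by simp [hμ, input])
    (by rw [a2]) hd hB.deg hB.time hB.walks) fun ν hball hF => ?_
  have e0 : ν.nat 0 = μ.nat 0 := hF.nat 0 rfl
  refine wp_call A B _ (wp_tableProg hd hB hball (by rw [e0, a0]) (by rw [e0, a1])
    (by rw [e0, a2]) (by rw [hF.real 0 rfl]; simp [hμ, input])) fun ξ hξ hF' => ?_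
  have hball' : Ball A ξ v d (T + 1) := by
    refine hball.congr (fun a ha => hF'.nat a ?_) (hF'.node rfl)
    simp only [List.mem_cons, List.not_mem_nil, or_false] at ha
    rcases ha with rfl | rfl | rfl | rfl <;> rfl
  have f0 : ξ.nat 0 = μ.nat 0 := (hF'.nat 0 rfl).trans e0
  have f1 : ξ.nat 1 = μ.nat 1 := (hF'.nat 1 rfl).trans (hF.nat 1 rfl)
  have hz : 0 < ξ.nat 8 0 0 := by rw [hball'.zero]; omega
  have hroot := hball'.root
  have hdeg := hball'.deg 0 (by omega) 0 hz
  have hchild := hball'.child 0 (by omega) 0 hz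
  have hlast := hball'.last 0 (by omega) 0 hz
  have hfirst := hball'.first 0 (by omega) 0 hz
  have hrows := hξ.rows
  rw [hroot] at hdeg hchild
  rw [hdeg] at hlast
  simp only [NExpr.eval]
  have hsim : SimPre A 1 (((ξ.setReg 11 0).setReg 12 (ω.2 v)).setReg 13 T) 0 v (ω.2 v)
      (fun k t => A.vote t (A.nbr v k) ω) T := by
    constructor
    · simp [f0, a0]
    · simp
    · simp [hroot]
    · simp [hdeg]
    · simp
    · simp
    · intro k t ht
      simp [f1, hμ, input, ht]
    · intro k
      -- At level `T` the table is valid for walks of length at most `1`, which is just enough for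
      -- the rows of the root's neighbours.
      have h1 := hrows (ξ.nat 5 0 0 + k) (by omega) (by
        have := k.2
        rw [show T + 1 - T = 0 + 1 by omega]
        omega)
      rw [(hchild k).1, (hchild k).2, hroot] at h1
      simpa [RowOK] using h1
  have hdT : A.deg v * T ≤ d * T := Nat.mul_le_mul_right _ (hd v)
  have hmem : ({ ξ with
      nat := upd (upd (upd ξ.nat 11 0 0 0) 12 0 0 (ξ.nat 0 0 3)) 13 0 0 (ξ.nat 0 0 2) } :
      Mem V) = ((ξ.setReg 11 0).setReg 12 (ω.2 v)).setReg 13 T := by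
    simp only [Mem.setReg, f0, a2, a3]
  have h02 : ∀ a, a ≠ 0 → ∀ y, upd ξ.nat a 0 0 y 0 = ξ.nat 0 := fun a ha y =>
    upd_of_ne _ ha.symm _ _ _
  have h03 : ∀ y, upd (upd ξ.nat 11 0 0 0) 12 0 0 y 0 = ξ.nat 0 := fun y =>
    (upd_of_ne _ (by decide) _ _ _).trans (h02 11 (by decide) 0)
  simp only [h02 11 (by decide), h03]
  rw [hmem]
  refine wp_call A B _ (wp_simProg A B hsim (by decide) ((hd v).trans hB.deg)
    (by have := hB.time; omega) (by have := hB.query; omega)) fun ζ hζ hF3 => ?_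
  have g13 : ζ.nat 13 0 0 = T := by rw [hF3.nat 13 rfl]; simp
  rw [g13, hζ.1 T le_rfl, A.vote_eq_own]
  simp [upd]

theorem computesVote_mainProg (v : V) {d T : ℕ} (hd : ∀ v, A.deg v ≤ d)
    (hB : Bounds q m d T B) (ω : Outcome q m V) :
    ∃ n ≤ B ^ mainProg.wt, ComputesVote A mainProg v T ω n := by
  obtain ⟨n, ν, hn, hex, hν⟩ := exec_of_wp A hB.two mainProg (wp_mainProg v hd hB ω)
  exact ⟨n, hn, ν, hex, hν⟩

end Machine

end

/-! ### The theorem -/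

/-- Each of the required bounds is at most a power of `q + m + d + 2` whose exponent is linear in
`T` for fixed `d`. -/
theorem Machine.bounds_pow (q m d T : ℕ) :
    Machine.Bounds q m d T ((q + m + d + 2) ^ ((d + 1) * (T + 1) + 1)) := by
  set β := q + m + d + 2 with hβ
  have h2 : 2 ≤ β := by omega
  have hE : (d + 1) * (T + 1) + 1 = d * T + d + T + 2 := by ring
  have mono : ∀ {e}, e ≤ d * T + d + T + 2 → β ^ e ≤ β ^ ((d + 1) * (T + 1) + 1) := fun he =>
    Nat.pow_le_pow_right (by omega) (hE ▸ he)
  have h1 : β ≤ β ^ ((d + 1) * (T + 1) + 1) := by simpa using mono (e := 1) (by omega)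
  refine ⟨h2.trans h1, le_trans (by omega) h1, le_trans (by omega) h1, le_trans (by omega) h1,
    ?_, ?_, ?_, ?_⟩
  · exact (Machine.le_two_pow_of_le h2 (T + 1)).trans (mono (by omega))
  · rw [add_assoc]
    exact (Machine.add_pow_le h2 (Machine.le_two_pow_of_le h2 (d * T))
      (show q + 1 ≤ β ^ 1 by rw [pow_one]; omega)).trans (mono (by omega))
  · exact (Nat.pow_le_pow_left (by omega) _).trans (mono (by omega))
  · exact (Nat.pow_le_pow_left (by omega) _).trans (mono (by omega))

theorem Network.law_errorEvent_le {q m : ℕ} {V : Type u} (A : Network q m V) {v : V} {b c : ℝ}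
    {t₀ t : ℕ} (h : A.DoublyExponential v b c t₀) (ht : t₀ ≤ t) {ε : ℝ} (hε : 0 < ε)
    (hle : Real.log (1 / ε) ≤ c * b ^ t) : A.law.real (A.errorEvent t v) ≤ ε := by
  have h1 : ((Real.log (1 / ε) : ℝ) : EReal) ≤ -ENNReal.log (A.law (A.errorEvent t v)) :=
    (EReal.coe_le_coe_iff.2 hle).trans (h t ht)
  have h2 := EReal.le_neg_of_le_neg h1
  rw [one_div, Real.log_inv, EReal.coe_neg, neg_neg, ← ENNReal.log_ofReal_of_pos hε,
    ENNReal.log_le_log_iff] at h2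
  exact ENNReal.toReal_le_of_le_ofReal hε.le h2

/-- Take the least `n` with `L ≤ c * b ^ n`: its predecessor fails, which bounds `b ^ n` by `b / c *
L`. The summand `1` in `1 + b / c` covers `n = 0`. -/
theorem exists_doublyExponential_time {b c L : ℝ} (hb : 1 < b) (hc : 0 < c) (hL : 0 ≤ L) :
    ∃ n : ℕ, L ≤ c * b ^ n ∧ b ^ n ≤ (1 + b / c) * (1 + L) := by
  classical
  have hex : ∃ n : ℕ, L ≤ c * b ^ n := by
    obtain ⟨n, hn⟩ := pow_unbounded_of_one_lt (L / c) hb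
    exact ⟨n, by rw [div_lt_iff₀ hc] at hn; linarith⟩
  refine ⟨Nat.find hex, Nat.find_spec hex, ?_⟩
  have hbc : 0 < b / c := by positivity
  rcases Nat.eq_zero_or_pos (Nat.find hex) with h0 | hpos
  · rw [h0, pow_zero]
    nlinarith [mul_nonneg hbc.le hL]
  · obtain ⟨n, hn⟩ := Nat.exists_eq_succ_of_ne_zero hpos.ne'
    have hlt := not_le.1 (Nat.find_min hex (show n < Nat.find hex by omega))
    rw [hn, pow_succ]
    have h1 : b ^ n ≤ L / c := by rw [le_div_iff₀ hc]; linarith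
    calc b ^ n * b ≤ L / c * b := by gcongr
      _ = b / c * L := by ring
      _ ≤ (1 + b / c) * (1 + L) := by nlinarith

theorem mainTheorem6 :
    ∃ p : Machine.Prog, ∀ (q m d : ℕ) (b c : ℝ) (t₀ : ℕ), 1 < b → 0 < c →
      ∃ (C : ℝ) (k : ℕ), ∀ ε : ℝ, 0 < ε → ε < 1 → ∃ t : ℕ,
        ∀ (V : Type u) (A : Network q m V) (i : V),
          (∀ v, A.deg v ≤ d) → A.DoublyExponential i b c t₀ →
            A.law.real (A.errorEvent t i) ≤ ε ∧
            ∀ ω : Outcome q m V, ∃ n : ℕ → ℕ,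
              (∀ r ≤ t, Machine.ComputesVote A p i r ω (n r)) ∧
              ((∑ r ∈ Finset.range (t + 1), n r : ℕ) : ℝ) ≤ C * (1 + Real.log (1 / ε)) ^ k := by
  refine ⟨Machine.mainProg, fun q m d b c t₀ hb hc => ?_⟩
  set β := q + m + d + 2 with hβ
  set w := Machine.mainProg.wt
  -- The total cost up to time `t` is at most `(β ^ ((d + 2) * w + 1)) ^ (t + 1)`. Dominating this
  -- base by `b ^ k` turns the cost into a `k`-th power of `b ^ (t + 1)`, which is linear in `1 +
  -- log (1 / ε)`.
  obtain ⟨k, hk⟩ := pow_unbounded_of_one_lt (((β ^ ((d + 2) * w + 1) : ℕ)) : ℝ) hb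
  refine ⟨(b ^ (t₀ + 1)) ^ k * (1 + b / c) ^ k, k, fun ε hε hε1 => ?_⟩
  have hL : 0 ≤ Real.log (1 / ε) := Real.log_nonneg (by rw [le_div_iff₀ hε]; linarith)
  obtain ⟨N, hN, hN'⟩ := exists_doublyExponential_time hb hc hL
  -- This time depends only on `ε`, `b`, `c` and `t₀`, not on the network; the shift by `t₀` costs
  -- the constant factor `(b ^ t₀) ^ k`.
  refine ⟨t₀ + N, fun V A i hd hi => ⟨?_, fun ω => ?_⟩⟩
  · refine A.law_errorEvent_le hi (by omega) hε (hN.trans ?_)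
    exact mul_le_mul_of_nonneg_left (pow_le_pow_right₀ hb.le (by omega)) hc.le
  · choose n hn hcomp using fun r =>
      Machine.computesVote_mainProg A _ i hd (Machine.bounds_pow q m d r) ω
    refine ⟨n, fun r _ => hcomp r, ?_⟩
    have hsum : ∑ r ∈ Finset.range (t₀ + N + 1), n r
        ≤ (β ^ ((d + 2) * w + 1)) ^ (t₀ + N + 1) := by
      have hterm : ∀ r ∈ Finset.range (t₀ + N + 1), n r ≤ β ^ ((d + 2) * w * (t₀ + N + 1)) := by
        intro r hr
        rw [Finset.mem_range] at hr
        refine (hn r).trans ?_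
        rw [← pow_mul]
        refine Nat.pow_le_pow_right (by omega) ?_
        have h1 : (d + 1) * (r + 1) + 1 ≤ (d + 2) * (t₀ + N + 1) := by nlinarith
        calc ((d + 1) * (r + 1) + 1) * w ≤ (d + 2) * (t₀ + N + 1) * w :=
              Nat.mul_le_mul_right _ h1
          _ = (d + 2) * w * (t₀ + N + 1) := by ring
      calc ∑ r ∈ Finset.range (t₀ + N + 1), n r
          ≤ (t₀ + N + 1) * β ^ ((d + 2) * w * (t₀ + N + 1)) := by
            simpa using Finset.sum_le_card_nsmul _ _ _ hterm
        _ ≤ β ^ (t₀ + N + 1) * β ^ ((d + 2) * w * (t₀ + N + 1)) :=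
            Nat.mul_le_mul_right _ (Machine.le_two_pow_of_le (by omega) _)
        _ = (β ^ ((d + 2) * w + 1)) ^ (t₀ + N + 1) := by rw [← pow_add, ← pow_mul]; ring_nf
    calc ((∑ r ∈ Finset.range (t₀ + N + 1), n r : ℕ) : ℝ)
        ≤ ((β ^ ((d + 2) * w + 1) : ℕ) : ℝ) ^ (t₀ + N + 1) := by exact_mod_cast hsum
      _ ≤ (b ^ k) ^ (t₀ + N + 1) := pow_le_pow_left₀ (Nat.cast_nonneg _) hk.le _
      _ = (b ^ (t₀ + 1)) ^ k * (b ^ N) ^ k := by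
          rw [← mul_pow, ← pow_add, ← pow_mul, ← pow_mul]; ring_nf
      _ ≤ (b ^ (t₀ + 1)) ^ k * ((1 + b / c) * (1 + Real.log (1 / ε))) ^ k := by gcongr
      _ = (b ^ (t₀ + 1)) ^ k * (1 + b / c) ^ k * (1 + Real.log (1 / ε)) ^ k := by
          rw [mul_pow]; ring
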